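/- **Setting.** Fix $e\in[0,1)$ and $T>0$, put $\mathbb R^2_{\diagup}=\{(v,v_*)\in\mathbb R^2: v\neq v_*\}$, $\sigma_e(r)=\frac{1-e}{4}r$ for $r\ge 0$, and $\tilde\nabla\varphi(v,v_*)=\varphi'(v_*)-\varphi'(v)$. Let $\mathcal P_2^{\mathrm{cm}}(\mathbb R)$ be the set of Borel probability measures on $\mathbb R$ with finite second moment and centre of mass $0$. For $f\in\mathcal P(\mathbb R)$ let $$\mathcal E(f)=\tfrac12\int v^2\,df(v),\qquad \mathcal D(f)=\iint_{\mathbb R^2_{\diagup}}|v-v_*|^2\sigma_e(|v-v_*|)\,d(f\otimes f)(v,v_*),$$ and for a finite signed Borel measure $U$ on $\mathbb R^2_{\diagup}$ let $$\mathcal A(f,U)=\iint_{\mathbb R^2_{\diagup}}\alpha\Bigl(\tfrac{d(f\otimes f)}{d\lambda},\tfrac{dU}{d\lambda}\Bigr)\sigma_e(|v-v_*|)\,d\lambda,\qquad \lambda=f\otimes f+|U|,$$ where $\alpha(s,u)=u^2/s$ if $s>0$, $\alpha(0,0)=0$, and $\alpha(0,u)=+\infty$ if $u\ne0$. For $S>0$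 and $\mu,\nu\in\mathcal P(\mathbb R)$, let $\mathrm{GCE}_S(\mu,\nu)$ be the set of pairs $(f_t,U_t)_{t\in[0,S]}$ such that: $t\mapsto f_t\in\mathcal P(\mathbb R)$ is narrowly continuous with $f_0=\mu$, $f_S=\nu$; $t\mapsto U_t$ is a weak-$*$ measurable family of finite signed measures on $\mathbb R^2_{\diagup}$ with $\int_0^S\iint\sigma_e(|v-v_*|)\,d|U_t|\,dt<\infty$; and, for all $\varphi\in C^1_c((0,S)\times\mathbb R)$, $$\int_0^S\!\!\int_{\mathbb R}\partial_t\varphi_t\,df_t\,dt+\int_0^S\!\!\iint_{\mathbb R^2_{\diagup}}\sigma_e(|v-v_*|)\,\tilde\nabla\varphi_t\,dU_t\,dt=0 .$$ Let $d_{\mathcal A}(\mu,\nu)^2=\inf\bigl\{\int_0^1\mathcal A(f_t,U_t)\,dt:(f,U)\in\mathrm{GCE}_1(\mu,\nu)\bigr\}\in[0,\infty]$. Write $f\in\mathrm{AC}([0,T],(\mathcal P_2^{\mathrm{cm}}(\mathbb R),d_{\mathcal A}))$ if $f_t\in\mathcal P_2^{\mathrm{cm}}(\mathbb R)$ for all $t\in[0,T]$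 and there is a nonnegative $m\in L^2(0,T)$ with $d_{\mathcal A}(f_s,f_t)\le\int_s^t m(r)\,dr$ for all $0\le s\le t\le T$. For such $f$ the De Giorgi functional is $$\mathcal G(f)=\mathcal E(f_T)-\mathcal E(f_0)+\tfrac12\inf_U\int_0^T\mathcal A(f_t,U_t)\,dt+\tfrac12\int_0^T\mathcal D(f_t)\,dt\in(-\infty,\infty],$$ the infimum being over all fluxes $U$ with $(f,U)\in\mathrm{GCE}_T(f_0,f_T)$ (that is, the action is that of the flux of least action of $f$; the infimum over the empty set is $+\infty$). **Theorem (Stability of curves of maximal slope).** Let $(f^n)_{n\in\mathbb N}\subset\mathrm{AC}([0,T],(\mathcal P_2^{\mathrm{cm}}(\mathbb R),d_{\mathcal A}))$ satisfy $\sup_n\mathcal G(f^n)<\infty$, and let $\mu_0\in\mathcal P(\mathbb R)$ with $\mathcal E(\mu_0)<\infty$ be such that $f^n_0\to\mu_0$ narrowly and $\mathcal E(f^n_0)\to\mathcal E(\mu_0)$. Then there exist a curve $f\in\mathrm{AC}([0,T],(\mathcal P_2^{\mathrm{cm}}(\mathbb R),d_{\mathcal A}))$ with $f_0=\mu_0$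 and a subsequence $(f^{n_k})_k$ such that $f^{n_k}_t\to f_t$ narrowly for a.e. $t\in[0,T]$, and $$\liminf_{n\to\infty}\mathcal G(f^n)\ge\mathcal G(f),$$ where the lower limit is taken along the whole sequence. -/

import Mathlib

open MeasureTheory Filter Topology Set
open scoped ENNReal ZeroAtInfty

namespace Granular

noncomputable section

/-- The off-diagonal plane `{(v, v_*) ∈ ℝ² : v ≠ v_*}`. -/
abbrev OffDiag : Type := {p : ℝ × ℝ // p.1 ≠ p.2}

/-- The weight `σ_e(|v - v_*|) = (1 - e) / 4 * |v - v_*|`. -/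
def sigma (e : ℝ) (p : OffDiag) : ℝ := (1 - e) / 4 * |p.1.1 - p.1.2|

/-- The nonlocal-local gradient `φ'(v_*) - φ'(v)`. -/
def nlGrad (φ : ℝ → ℝ) (p : OffDiag) : ℝ := deriv φ p.1.2 - deriv φ p.1.1

/-- The restriction of `f ⊗ f` to the off-diagonal plane. -/
def prodOff (f : ProbabilityMeasure ℝ) : Measure OffDiag :=
  ((f : Measure ℝ).prod (f : Measure ℝ)).comap Subtype.val

/-- The kinetic energy `½ ∫ v² df(v)`, with values in `[0, ∞]`. -/
def kineticEnergy (f : ProbabilityMeasure ℝ) : ℝ≥0∞ :=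
  (1 / 2) * ∫⁻ v, ENNReal.ofReal (v ^ 2) ∂(f : Measure ℝ)

/-- The dissipation `∬ |v - v_*|² σ_e(|v - v_*|) d(f ⊗ f)`, with values in `[0, ∞]`. -/
def dissipation (e : ℝ) (f : ProbabilityMeasure ℝ) : ℝ≥0∞ :=
  ∫⁻ p : OffDiag, ENNReal.ofReal (|p.1.1 - p.1.2| ^ 2 * sigma e p) ∂(prodOff f)

/-- Probability measures with finite second moment and centre of mass zero. -/
def P2cm : Set (ProbabilityMeasure ℝ) :=
  {f | Integrable (fun v : ℝ => v ^ 2) (f : Measure ℝ) ∧ ∫ v, v ∂(f : Measure ℝ) = 0}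

/-- `α(s, u) = u² / s` for `s > 0`, `α(0, 0) = 0`, `α(0, u) = ∞` for `u ≠ 0`. -/
def alpha (s u : ℝ) : ℝ≥0∞ :=
  if 0 < s then ENNReal.ofReal (u ^ 2 / s) else if u = 0 then 0 else ⊤

/-- The reference measure `f ⊗ f + |U|` on the off-diagonal plane. -/
def refMeasure (f : ProbabilityMeasure ℝ) (U : SignedMeasure OffDiag) : Measure OffDiag :=
  prodOff f + U.totalVariation

/-- The action density
`𝒜(f, U) = ∬ α(d(f ⊗ f)/dλ, dU/dλ) σ_e(|v - v_*|) dλ` with `λ = f ⊗ f + |U|`. -/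
def action (e : ℝ) (f : ProbabilityMeasure ℝ) (U : SignedMeasure OffDiag) : ℝ≥0∞ :=
  ∫⁻ p : OffDiag,
    alpha ((prodOff f).rnDeriv (refMeasure f U) p).toReal (U.rnDeriv (refMeasure f U) p)
      * ENNReal.ofReal (sigma e p) ∂(refMeasure f U)

/-- Weak solutions of the generalised continuity equation `∂ₜ f + ∇̃ · U = 0` on `[0, T]`: weak-*
measurable families of probability measures and of finite signed measures on the off-diagonal
plane, with integrable weighted total variation, satisfying the weak form for all test functions
in `C_c¹((0, T) × ℝ)`. Values of `f` and `U` outside `[0, T]` play no role. -/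
structure IsGCE (e T : ℝ) (f : ℝ → ProbabilityMeasure ℝ) (U : ℝ → SignedMeasure OffDiag) :
    Prop where
  measurable_curve : ∀ g : C₀(ℝ, ℝ),
    AEMeasurable (fun t => ∫ v, g v ∂(f t : Measure ℝ)) (volume.restrict (Icc 0 T))
  measurable_flux : ∀ g : C₀(OffDiag, ℝ),
    AEMeasurable (fun t => ∫ᵛ p, g p ∂•(U t)) (volume.restrict (Icc 0 T))
  integrable_flux :
    (∫⁻ t in Icc 0 T, ∫⁻ p, ENNReal.ofReal (sigma e p) ∂(U t).totalVariation) < ⊤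
  weak_form : ∀ φ : ℝ → ℝ → ℝ,
    ContDiff ℝ 1 (Function.uncurry φ) →
    HasCompactSupport (Function.uncurry φ) →
    tsupport (Function.uncurry φ) ⊆ Ioo 0 T ×ˢ univ →
    (∫ t in (0 : ℝ)..T, ∫ v, deriv (fun s => φ s v) t ∂(f t : Measure ℝ))
      + (∫ t in (0 : ℝ)..T, ∫ᵛ p, sigma e p * nlGrad (φ t) p ∂•(U t)) = 0

/-- The class `GCE_T(μ, ν)`: weak solutions, in their narrowly continuous representative, that
start at `μ` and end at `ν`. -/
structure IsGCEBetween (e T : ℝ) (μ ν : ProbabilityMeasure ℝ) (f : ℝ → ProbabilityMeasure ℝ)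
    (U : ℝ → SignedMeasure OffDiag) : Prop where
  isGCE : IsGCE e T f U
  continuousOn : ContinuousOn f (Icc 0 T)
  initial : f 0 = μ
  final : f T = ν

/-- The collision transportation cost `d_𝒜`, with values in `[0, ∞]`. -/
def collisionDist (e : ℝ) (μ ν : ProbabilityMeasure ℝ) : ℝ≥0∞ :=
  (⨅ (f : ℝ → ProbabilityMeasure ℝ) (U : ℝ → SignedMeasure OffDiag)
    (_ : IsGCEBetween e 1 μ ν f U), ∫⁻ t in Icc (0 : ℝ) 1, action e (f t) (U t)) ^ (1 / 2 : ℝ)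

/-- The class `AC([0, T]; (𝒫₂^cm(ℝ), d_𝒜))` of 2-absolutely continuous curves. -/
def ACCurves (e T : ℝ) : Set (ℝ → ProbabilityMeasure ℝ) :=
  {f | (∀ t ∈ Icc 0 T, f t ∈ P2cm) ∧
    ∃ m : ℝ → ℝ, (∀ t, 0 ≤ m t) ∧ MemLp m 2 (volume.restrict (Icc 0 T)) ∧
      ∀ s t, 0 ≤ s → s ≤ t → t ≤ T →
        collisionDist e (f s) (f t) ≤ ENNReal.ofReal (∫ r in s..t, m r)}

/-- The action `∫₀ᵀ 𝒜(f_t, U_t) dt` of a curve, where `U` is its flux of least action: the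
infimum over all fluxes `U` for which `(f, U)` solves the generalised continuity equation. -/
def curveAction (e T : ℝ) (f : ℝ → ProbabilityMeasure ℝ) : ℝ≥0∞ :=
  ⨅ (U : ℝ → SignedMeasure OffDiag) (_ : IsGCEBetween e T (f 0) (f T) f U),
    ∫⁻ t in Icc 0 T, action e (f t) (U t)

/-- The De Giorgi functional
`𝒢_T(f) = ℰ(f_T) - ℰ(f_0) + ½ ∫₀ᵀ 𝒜(f_t, U_t) dt + ½ ∫₀ᵀ 𝒟(f_t) dt`. On `ACCurves e T` both
energies are finite, so that the value lies in `(-∞, ∞]`. -/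
def deGiorgi (e T : ℝ) (f : ℝ → ProbabilityMeasure ℝ) : EReal :=
  (kineticEnergy (f T) : EReal) - (kineticEnergy (f 0) : EReal)
    + (((1 / 2) * curveAction e T f : ℝ≥0∞) : EReal)
    + (((1 / 2) * ∫⁻ t in Icc 0 T, dissipation e (f t) : ℝ≥0∞) : EReal)

end

end Granular

namespace Granular

lemma sigma_pos {e : ℝ} (he : e < 1) (p : OffDiag) : 0 < sigma e p := by
  have := abs_pos.2 (sub_ne_zero.2 p.2)
  unfold sigma
  have : 0 < (1 - e) / 4 := by linarith
  positivity

lemma continuous_sigma (e : ℝ) : Continuous (sigma e) := by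
  unfold sigma; fun_prop

lemma measurableSet_offDiag : MeasurableSet {p : ℝ × ℝ | p.1 ≠ p.2} :=
  (measurableSet_eq_fun measurable_fst measurable_snd).compl

lemma measurableEmbedding_offDiag : MeasurableEmbedding (Subtype.val : OffDiag → ℝ × ℝ) :=
  MeasurableEmbedding.subtype_coe measurableSet_offDiag

instance (f : ProbabilityMeasure ℝ) : IsFiniteMeasure (prodOff f) := by
  constructor
  rw [prodOff, measurableEmbedding_offDiag.comap_apply]
  exact measure_lt_top _ _

/-- Integrals over the off-diagonal plane of functions that vanish on the diagonal. -/
lemma lintegral_prodOff (f : ProbabilityMeasure ℝ) (G : ℝ × ℝ → ℝ≥0∞)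
    (h0 : ∀ v, G (v, v) = 0) :
    ∫⁻ p : OffDiag, G p.1 ∂prodOff f = ∫⁻ x, G x ∂((f : Measure ℝ).prod (f : Measure ℝ)) := by
  have h := lintegral_subtype_comap (μ := (f : Measure ℝ).prod (f : Measure ℝ))
    measurableSet_offDiag G
  refine h.trans ?_
  rw [← lintegral_indicator measurableSet_offDiag]
  congr 1
  ext x
  by_cases hx : x.1 = x.2
  · obtain ⟨a, b⟩ := x
    obtain rfl : a = b := hx
    simp [h0]
  · simp [indicator, hx]

instance (f : ProbabilityMeasure ℝ) (U : SignedMeasure OffDiag) :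
    IsFiniteMeasure (refMeasure f U) := by
  unfold refMeasure; infer_instance

lemma prodOff_ac (f : ProbabilityMeasure ℝ) (U : SignedMeasure OffDiag) :
    prodOff f ≪ refMeasure f U :=
  Measure.absolutelyContinuous_of_le (Measure.le_add_right le_rfl)

lemma totalVariation_ac (f : ProbabilityMeasure ℝ) (U : SignedMeasure OffDiag) :
    U.totalVariation ≪ refMeasure f U :=
  Measure.absolutelyContinuous_of_le (Measure.le_add_left le_rfl)

lemma withDensity_rnDeriv_refMeasure (f : ProbabilityMeasure ℝ) (U : SignedMeasure OffDiag) :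
    (refMeasure f U).withDensityᵥ (U.rnDeriv (refMeasure f U)) = U := by
  apply SignedMeasure.withDensityᵥ_rnDeriv_eq
  rw [SignedMeasure.absolutelyContinuous_ennreal_iff]
  rw [VectorMeasure.ennrealToMeasure_toENNRealVectorMeasure]
  exact totalVariation_ac f U

lemma lintegral_withDensity_mul {X : Type*} [MeasurableSpace X] (μ : Measure X) {k g : X → ℝ≥0∞}
    (hk : Measurable k) (hg : Measurable g) :
    ∫⁻ p, g p ∂μ.withDensity k = ∫⁻ p, k p * g p ∂μ :=
  lintegral_withDensity_eq_lintegral_mul μ hk hg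

lemma totalVariation_eq_withDensity (f : ProbabilityMeasure ℝ) (U : SignedMeasure OffDiag) :
    U.totalVariation
      = (refMeasure f U).withDensity (fun p => ‖U.rnDeriv (refMeasure f U) p‖ₑ) := by
  rw [SignedMeasure.totalVariation_eq_variation]
  conv_lhs => rw [← withDensity_rnDeriv_refMeasure f U]
  exact Measure.variation_withDensityᵥ (SignedMeasure.integrable_rnDeriv _ _)

lemma mul_le_alpha (s u G ε : ℝ) (hε : 0 < ε) :
    ENNReal.ofReal |G| * ‖u‖ₑ
      ≤ ENNReal.ofReal (ε / 2) * alpha s u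
        + ENNReal.ofReal (1 / (2 * ε)) * (ENNReal.ofReal (G ^ 2) * ENNReal.ofReal s) := by
  unfold alpha
  rw [Real.enorm_eq_ofReal_abs, ← ENNReal.ofReal_mul (abs_nonneg _)]
  split_ifs with h1 h2
  · rw [← ENNReal.ofReal_mul (by positivity), ← ENNReal.ofReal_mul (by positivity),
      ← ENNReal.ofReal_mul (by positivity), ← ENNReal.ofReal_add (by positivity) (by positivity)]
    apply ENNReal.ofReal_le_ofReal
    have : ε / 2 * (u ^ 2 / s) + 1 / (2 * ε) * (G ^ 2 * s) - |G| * |u|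
        = (ε * |u| - |G| * s) ^ 2 / (2 * ε * s) := by
      rw [← sq_abs u, ← sq_abs G]
      field_simp
      ring
    have h3 : 0 ≤ (ε * |u| - |G| * s) ^ 2 / (2 * ε * s) := by positivity
    linarith
  · simp [h2]
  · rw [ENNReal.mul_top (by simpa using hε)]
    simp

/-- The Cauchy-Schwarz inequality between flux and action, in the form of Young's inequality. -/
lemma flux_bound (e : ℝ) (f : ProbabilityMeasure ℝ) (U : SignedMeasure OffDiag)
    (G : OffDiag → ℝ) (hG : Measurable G) {ε : ℝ} (hε : 0 < ε) :
    ∫⁻ p, ENNReal.ofReal (sigma e p) * ENNReal.ofReal |G p| ∂U.totalVariation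
      ≤ ENNReal.ofReal (ε / 2) * action e f U
        + ENNReal.ofReal (1 / (2 * ε))
          * ∫⁻ p, ENNReal.ofReal (sigma e p) * ENNReal.ofReal (G p ^ 2) ∂prodOff f := by
  have hσ : Measurable fun p : OffDiag => ENNReal.ofReal (sigma e p) :=
    (continuous_sigma e).measurable.ennreal_ofReal
  have hu := SignedMeasure.measurable_rnDeriv U (refMeasure f U)
  have hk := Measure.measurable_rnDeriv (prodOff f) (refMeasure f U)
  have hσG : Measurable fun p => ENNReal.ofReal (sigma e p) * ENNReal.ofReal |G p| :=
    hσ.mul hG.abs.ennreal_ofReal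
  have hσG2 : Measurable fun p => ENNReal.ofReal (sigma e p) * ENNReal.ofReal (G p ^ 2) :=
    hσ.mul (hG.pow_const 2).ennreal_ofReal
  rw [totalVariation_eq_withDensity f U, lintegral_withDensity_mul _ hu.enorm hσG]
  have h2 : ∫⁻ p, ENNReal.ofReal (sigma e p) * ENNReal.ofReal (G p ^ 2) ∂prodOff f
      = ∫⁻ p, ENNReal.ofReal (sigma e p) * (ENNReal.ofReal (G p ^ 2)
        * ENNReal.ofReal ((prodOff f).rnDeriv (refMeasure f U) p).toReal) ∂(refMeasure f U) := by
    conv_lhs => rw [← Measure.withDensity_rnDeriv_eq _ _ (prodOff_ac f U)]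
    rw [lintegral_withDensity_mul _ hk hσG2]
    apply lintegral_congr_ae
    filter_upwards [Measure.rnDeriv_lt_top (prodOff f) (refMeasure f U)] with p hp
    rw [ENNReal.ofReal_toReal hp.ne]
    ring
  rw [h2, action, ← lintegral_const_mul' _ _ ENNReal.ofReal_ne_top,
    ← lintegral_const_mul' _ _ ENNReal.ofReal_ne_top,
    ← lintegral_add_right]
  · apply lintegral_mono
    intro p
    have := mul_le_alpha ((prodOff f).rnDeriv (refMeasure f U) p).toReal
      (U.rnDeriv (refMeasure f U) p) (G p) ε hε
    beta_reduce
    calc _ = ENNReal.ofReal (sigma e p)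
          * (ENNReal.ofReal |G p| * ‖U.rnDeriv (refMeasure f U) p‖ₑ) := by ring
      _ ≤ _ := mul_le_mul_right this _
      _ = _ := by ring
  · exact (hσ.mul ((hG.pow_const 2).ennreal_ofReal.mul
      hk.ennreal_toReal.ennreal_ofReal)).const_mul _

lemma enorm_vintegral_le (U : SignedMeasure OffDiag) (F : OffDiag → ℝ) :
    ‖∫ᵛ p, F p ∂•U‖ₑ ≤ ∫⁻ p, ENNReal.ofReal |F p| ∂U.totalVariation := by
  rw [SignedMeasure.totalVariation_eq_variation]
  refine VectorMeasure.enorm_integral_le_lintegral_enorm_transpose.trans ?_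
  rw [VectorMeasure.variation_transpose_lsmul]
  simp [Real.enorm_eq_ofReal_abs]

lemma enorm_vintegral_sigma_le (e : ℝ) (he : e < 1) (f : ProbabilityMeasure ℝ)
    (U : SignedMeasure OffDiag) (G : OffDiag → ℝ) (hG : Measurable G) {ε : ℝ} (hε : 0 < ε) :
    ‖∫ᵛ p, sigma e p * G p ∂•U‖ₑ
      ≤ ENNReal.ofReal (ε / 2) * action e f U
        + ENNReal.ofReal (1 / (2 * ε))
          * ∫⁻ p, ENNReal.ofReal (sigma e p) * ENNReal.ofReal (G p ^ 2) ∂prodOff f := by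
  refine (enorm_vintegral_le U _).trans (le_trans (le_of_eq ?_) (flux_bound e f U G hG hε))
  congr 1
  ext p
  rw [abs_mul, abs_of_pos (sigma_pos he p), ENNReal.ofReal_mul (sigma_pos he p).le]

/-- Integration against a signed measure with a density. -/
lemma vintegral_withDensity {X : Type*} [MeasurableSpace X] (μ : Measure X)
    {w F : X → ℝ} (hw : Integrable w μ) (hwF : Integrable (fun x => F x * w x) μ)
    (hF : Measurable F) :
    ∫ᵛ x, F x ∂•(μ.withDensityᵥ w) = ∫ x, F x * w x ∂μ := by
  have flip : ∀ V : SignedMeasure X, ∫ᵛ x, F x ∂•V = ∫ᵛ x, F x ∂<•V := by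
    intro V
    congr 1
    ext
    simp
  obtain ⟨w', hw', hww'⟩ := hw.aestronglyMeasurable.aemeasurable
  rw [WithDensityᵥEq.congr_ae hww', integral_congr_ae (g := fun x => F x * w' x)
    (by filter_upwards [hww'] with x hx; rw [hx])]
  replace hwF : Integrable (fun x => F x * w' x) μ :=
    hwF.congr (by filter_upwards [hww'] with x hx; rw [hx])
  replace hw := hw.congr hww'
  rw [withDensityᵥ_eq_withDensity_pos_part_sub_withDensity_neg_part hw]
  have key : ∀ z : X → ℝ, Integrable z μ → Measurable z → Integrable (fun x => F x * z x) μ →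
      Integrable F (μ.withDensity fun x => ENNReal.ofReal (z x)) ∧
      ∫ x, F x ∂(μ.withDensity fun x => ENNReal.ofReal (z x)) = ∫ x, max (z x) 0 * F x ∂μ := by
    intro z hz hzm hzF
    constructor
    · have : (fun x => ENNReal.ofReal (z x)) = fun x => ((z x).toNNReal : ℝ≥0∞) := rfl
      rw [this, integrable_withDensity_iff_integrable_smul hzm.real_toNNReal]
      refine hzF.mono (hzm.real_toNNReal.smul hF).aestronglyMeasurable (ae_of_all _ fun x => ?_)
      simp only [NNReal.smul_def, Real.coe_toNNReal', smul_eq_mul, norm_mul, Real.norm_eq_abs]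
      rw [mul_comm]
      refine mul_le_mul_of_nonneg_left ?_ (abs_nonneg _)
      rw [abs_of_nonneg (le_max_right (z x) 0)]
      exact max_le (le_abs_self _) (abs_nonneg _)
    · have : (fun x => ENNReal.ofReal (z x)) = fun x => ((z x).toNNReal : ℝ≥0∞) := rfl
      rw [this, integral_withDensity_eq_integral_smul hzm.real_toNNReal]
      simp [NNReal.smul_def]
  obtain ⟨h1, h1'⟩ := key w' hw hw' hwF
  obtain ⟨h2, h2'⟩ := key (fun x => -w' x) hw.neg hw'.neg (by simpa using hwF.neg)
  have fin1 : IsFiniteMeasure (μ.withDensity fun x => ENNReal.ofReal (w' x)) :=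
    isFiniteMeasure_withDensity_ofReal hw.2
  have fin2 : IsFiniteMeasure (μ.withDensity fun x => ENNReal.ofReal (-w' x)) :=
    isFiniteMeasure_withDensity_ofReal hw.neg.2
  rw [VectorMeasure.integral_sub_vectorMeasure, flip, flip,
    VectorMeasure.integral_toSignedMeasure, VectorMeasure.integral_toSignedMeasure, h1', h2',
    ← integral_sub]
  · congr 1
    ext x
    rcases le_total 0 (w' x) with h | h
    · simp [h, mul_comm]
    · simp [h, mul_comm]
  · have := (integrable_withDensity_iff_integrable_smul (f := fun x => (w' x).toNNReal)
      hw'.real_toNNReal).1 h1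
    simpa [NNReal.smul_def] using this
  · have := (integrable_withDensity_iff_integrable_smul (f := fun x => (-w' x).toNNReal)
      hw'.neg.real_toNNReal).1 h2
    simpa [NNReal.smul_def] using this
  · simpa [VectorMeasure.Integrable] using h1
  · simpa [VectorMeasure.Integrable] using h2

lemma action_withDensity_le (e : ℝ) (f : ProbabilityMeasure ℝ) {w : OffDiag → ℝ}
    (hwm : Measurable w) (hw : Integrable w (prodOff f)) :
    action e f ((prodOff f).withDensityᵥ w)
      ≤ ∫⁻ p, ENNReal.ofReal (sigma e p) * ENNReal.ofReal (w p ^ 2) ∂prodOff f := by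
  set κ := prodOff f
  set U : SignedMeasure OffDiag := κ.withDensityᵥ w
  set l := refMeasure f U with hl
  have hσ : Measurable fun p : OffDiag => ENNReal.ofReal (sigma e p) :=
    (continuous_sigma e).measurable.ennreal_ofReal
  have hu := SignedMeasure.measurable_rnDeriv U l
  have hk := Measure.measurable_rnDeriv κ l
  have hκ : l.withDensity (κ.rnDeriv l) = κ := Measure.withDensity_rnDeriv_eq _ _ (prodOff_ac f U)
  -- the density of `U` with respect to `l`
  have hint : Integrable (fun p => w p * (κ.rnDeriv l p).toReal) l := by
    have h := hw
    rw [← hκ, integrable_withDensity_iff hk (Measure.rnDeriv_lt_top _ _)] at h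
    exact h
  have hUl : U.rnDeriv l =ᵐ[l] fun p => w p * (κ.rnDeriv l p).toReal := by
    symm
    apply Integrable.ae_eq_of_withDensityᵥ_eq hint (SignedMeasure.integrable_rnDeriv _ _)
    rw [withDensity_rnDeriv_refMeasure]
    ext s hs
    rw [withDensityᵥ_apply hint hs, withDensityᵥ_apply hw hs]
    conv_rhs => rw [← hκ]
    rw [setIntegral_withDensity_eq_setIntegral_toReal_smul hk
      (ae_restrict_of_ae (Measure.rnDeriv_lt_top κ l)) _ hs]
    simp [mul_comm]
  have hσw : Measurable fun p => ENNReal.ofReal (sigma e p) * ENNReal.ofReal (w p ^ 2) :=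
    hσ.mul (hwm.pow_const 2).ennreal_ofReal
  rw [action]
  conv_rhs => rw [← hκ]
  rw [lintegral_withDensity_mul _ hk hσw]
  apply lintegral_mono_ae
  filter_upwards [hUl, Measure.rnDeriv_lt_top κ l] with p hp hfin
  rw [hp]
  unfold alpha
  split_ifs with h1 h2
  · rw [mul_pow, pow_two (κ.rnDeriv l p).toReal, mul_div_assoc, mul_div_cancel_right₀ _ h1.ne',
      ENNReal.ofReal_mul (by positivity), ENNReal.ofReal_toReal hfin.ne]
    apply le_of_eq; ring
  · simp
  · exfalso
    have : (κ.rnDeriv l p).toReal = 0 := le_antisymm (not_lt.1 h1) ENNReal.toReal_nonneg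
    simp [this] at h2

section WeakConvergence

variable {X : Type*} [TopologicalSpace X] [MeasurableSpace X] [OpensMeasurableSpace X]

/-- Narrow convergence extends to continuous integrands that are dominated, up to bounded terms,
by arbitrarily small multiples of a function with bounded integrals. -/
lemma tendsto_integral_of_moment {ι : Type*} {L : Filter ι} {μs : ι → ProbabilityMeasure X}
    {μ : ProbabilityMeasure X} (h : Tendsto μs L (𝓝 μ)) {F W : X → ℝ} (hF : Continuous F)
    (hW : Measurable W) (hW0 : ∀ x, 0 ≤ W x) {M : ℝ} (hM0 : 0 ≤ M)
    (hM : ∀ i, ∫⁻ x, ENNReal.ofReal (W x) ∂(μs i : Measure X) ≤ ENNReal.ofReal M)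
    (hM' : ∫⁻ x, ENNReal.ofReal (W x) ∂(μ : Measure X) ≤ ENNReal.ofReal M)
    (hFW : ∀ ε > 0, ∃ C, ∀ x, |F x| ≤ C + ε * W x) :
    Tendsto (fun i => ∫ x, F x ∂(μs i : Measure X)) L (𝓝 (∫ x, F x ∂(μ : Measure X))) := by
  have int : ∀ ν : ProbabilityMeasure X,
      ∫⁻ x, ENNReal.ofReal (W x) ∂(ν : Measure X) ≤ ENNReal.ofReal M →
      Integrable W (ν : Measure X) ∧ ∫ x, W x ∂(ν : Measure X) ≤ M := by
    intro ν hν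
    refine ⟨⟨hW.aestronglyMeasurable, ?_⟩, ?_⟩
    · rw [hasFiniteIntegral_iff_ofReal (ae_of_all _ hW0)]
      exact hν.trans_lt ENNReal.ofReal_lt_top
    · rw [integral_eq_lintegral_of_nonneg_ae (ae_of_all _ hW0) hW.aestronglyMeasurable]
      exact ENNReal.toReal_le_of_le_ofReal hM0 hν
  have trunc : ∀ ε > 0, ∃ g : BoundedContinuousFunction X ℝ, ∀ ν : ProbabilityMeasure X,
      ∫⁻ x, ENNReal.ofReal (W x) ∂(ν : Measure X) ≤ ENNReal.ofReal M →
      |∫ x, F x ∂(ν : Measure X) - ∫ x, g x ∂(ν : Measure X)| ≤ ε * M := by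
    intro ε hε
    obtain ⟨C, hC⟩ := hFW ε hε
    let C' := max C 0
    have hC' : ∀ x, |F x| ≤ C' + ε * W x := fun x =>
      (hC x).trans (by gcongr; exact le_max_left _ _)
    have hC'0 : 0 ≤ C' := le_max_right _ _
    let g : BoundedContinuousFunction X ℝ := BoundedContinuousFunction.ofNormedAddCommGroup
      (fun x => max (-C') (min (F x) C')) (by fun_prop) C' (by
        intro x
        rw [Real.norm_eq_abs, abs_le]
        exact ⟨le_max_left _ _, max_le (by linarith) (min_le_right _ _)⟩)
    refine ⟨g, fun ν hν => ?_⟩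
    obtain ⟨hWi, hWM⟩ := int ν hν
    have hFi : Integrable F (ν : Measure X) := by
      refine ((integrable_const C').add (hWi.const_mul ε)).mono' hF.aestronglyMeasurable ?_
      exact ae_of_all _ fun x => by simpa using hC' x
    have hgi : Integrable g (ν : Measure X) := g.integrable _
    rw [← integral_sub hFi hgi]
    calc |∫ x, F x - g x ∂(ν : Measure X)| ≤ ∫ x, |F x - g x| ∂(ν : Measure X) :=
          abs_integral_le_integral_abs
      _ ≤ ∫ x, ε * W x ∂(ν : Measure X) := by
          apply integral_mono (hFi.sub hgi).abs (hWi.const_mul ε)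
          intro x
          change |F x - max (-C') (min (F x) C')| ≤ ε * W x
          have h1 := hC' x
          have h2 : 0 ≤ ε * W x := mul_nonneg hε.le (hW0 x)
          rw [abs_le] at h1
          rw [abs_le]
          rcases le_total (F x) C' with h3 | h3
          · rw [min_eq_left h3]
            rcases le_total (-C') (F x) with h4 | h4
            · rw [max_eq_right h4]; constructor <;> linarith
            · rw [max_eq_left h4]; constructor <;> linarith
          · rw [min_eq_right h3, max_eq_right (by linarith)]; constructor <;> linarith
      _ = ε * ∫ x, W x ∂(ν : Measure X) := integral_const_mul _ _
      _ ≤ ε * M := by gcongr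
  rw [Metric.tendsto_nhds]
  intro δ hδ
  obtain ⟨g, hg⟩ := trunc (δ / (4 * (M + 1))) (by positivity)
  have hb : δ / (4 * (M + 1)) * M ≤ δ / 4 := by
    rw [div_mul_eq_mul_div, div_le_div_iff₀ (by positivity) (by norm_num)]
    nlinarith
  have hgt := (ProbabilityMeasure.tendsto_iff_forall_integral_tendsto.1 h) g
  filter_upwards [Metric.tendsto_nhds.1 hgt (δ / 4) (by positivity)] with i hi
  rw [Real.dist_eq] at hi ⊢
  have h1 := (hg (μs i) (hM i)).trans hb
  have h2 := (hg μ hM').trans hb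
  rw [abs_le] at h1 h2
  rw [abs_lt] at hi ⊢
  constructor <;> linarith

lemma lintegral_le_liminf_of_tendsto [HasOuterApproxClosed X] {μs : ℕ → ProbabilityMeasure X}
    {μ : ProbabilityMeasure X} (h : Tendsto μs atTop (𝓝 μ)) {W : X → ℝ} (hW : Continuous W)
    (hW0 : ∀ x, 0 ≤ W x) :
    ∫⁻ x, ENNReal.ofReal (W x) ∂(μ : Measure X)
      ≤ liminf (fun i => ∫⁻ x, ENNReal.ofReal (W x) ∂(μs i : Measure X)) atTop :=
  lintegral_le_liminf_lintegral_of_forall_isOpen_measure_le_liminf_measure hW hW0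
    fun _ hG => ProbabilityMeasure.le_liminf_measure_open_of_tendsto h hG

lemma measurable_toMeasure_of_continuous [HasOuterApproxClosed X] [BorelSpace X]
    {g : ℝ → ProbabilityMeasure X} (hg : Continuous g) :
    Measurable fun t => (g t : Measure X) := by
  refine Measurable.measure_of_isPiSystem_of_isProbabilityMeasure
    (BorelSpace.measurable_eq (α := X)) isPiSystem_isOpen ?_
  intro G hG
  apply LowerSemicontinuous.measurable
  rw [lowerSemicontinuous_iff_le_liminf]
  intro t
  exact ProbabilityMeasure.le_liminf_measure_open_of_tendsto (hg.tendsto t) hG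

end WeakConvergence

/-- The second moment of a probability measure on the line. -/
noncomputable def secondMoment (f : ProbabilityMeasure ℝ) : ℝ≥0∞ :=
  ∫⁻ v, ENNReal.ofReal (v ^ 2) ∂(f : Measure ℝ)

/-- A compact set of probability measures with a tail bound of Chebyshev type. -/
def tailSet (M : NNReal) : Set (ProbabilityMeasure ℝ) :=
  {μ | ∀ n : ℕ, μ (Metric.closedBall 0 ((n : ℝ) + 1))ᶜ ≤ M / ((n : NNReal) + 1) ^ 2}

lemma isCompact_tailSet (M : NNReal) : IsCompact (tailSet M) := by
  apply isCompact_setOfPred_probabilityMeasure_mass_eq_compl_isCompact_le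
  · rw [← NNReal.tendsto_coe]
    have h1 : Tendsto (fun n : ℕ => ((n : ℝ) + 1) ^ 2) atTop atTop :=
      (tendsto_pow_atTop two_ne_zero).comp
        (tendsto_atTop_add_const_right _ _ tendsto_natCast_atTop_atTop)
    simpa using h1.const_div_atTop (M : ℝ)
  · exact fun n => isCompact_closedBall _ _
  · exact Or.inl inferInstance

lemma mem_tailSet {M : NNReal} {μ : ProbabilityMeasure ℝ} (h : secondMoment μ ≤ M) :
    μ ∈ tailSet M := by
  intro n
  have hn : (0 : ℝ) < (n : ℝ) + 1 := by positivity
  have h1 := mul_meas_ge_le_lintegral₀ (μ := (μ : Measure ℝ))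
    (f := fun v => ENNReal.ofReal (v ^ 2)) (by fun_prop) (ENNReal.ofReal (((n : ℝ) + 1) ^ 2))
  have h2 : (μ : Measure ℝ) (Metric.closedBall 0 ((n : ℝ) + 1))ᶜ
      ≤ (μ : Measure ℝ) {v | ENNReal.ofReal (((n : ℝ) + 1) ^ 2) ≤ ENNReal.ofReal (v ^ 2)} := by
    apply measure_mono
    intro v hv
    simp only [mem_compl_iff, Metric.mem_closedBall, dist_zero_right, Real.norm_eq_abs,
      not_le] at hv
    apply ENNReal.ofReal_le_ofReal
    rw [← sq_abs v]
    gcongr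
  have h3 : ENNReal.ofReal (((n : ℝ) + 1) ^ 2) = ((((n : NNReal) + 1) ^ 2 : NNReal) : ℝ≥0∞) := by
    rw [ENNReal.ofReal]
    congr 1
    ext
    rw [Real.coe_toNNReal _ (by positivity)]
    simp
  rw [← ENNReal.coe_le_coe, ProbabilityMeasure.ennreal_coeFn_eq_coeFn_toMeasure,
    ENNReal.coe_div (by positivity), ENNReal.le_div_iff_mul_le (by simp) (by simp), ← h3,
    mul_comm]
  exact (mul_le_mul_right h2 _).trans (h1.trans h)

lemma measure_ext_of_C1 (μ ν : ProbabilityMeasure ℝ)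
    (h : ∀ ψ : ℝ → ℝ, ContDiff ℝ 1 ψ → HasCompactSupport ψ →
      ∫ v, ψ v ∂(μ : Measure ℝ) = ∫ v, ψ v ∂(ν : Measure ℝ)) : μ = ν := by
  apply Subtype.ext
  change (μ : Measure ℝ) = (ν : Measure ℝ)
  apply Real.measure_ext_Ioo_rat
  intro a b
  rcases le_or_gt (b : ℝ) (a : ℝ) with hab | hab
  · simp [Ioo_eq_empty_of_le hab]
  set c : ℝ := (a + b) / 2
  set r : ℝ := (b - a) / 2
  have hr : 0 < r := by simp only [r]; linarith
  have hball : Ioo (a : ℝ) b = Metric.ball c r := by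
    rw [Real.ball_eq_Ioo]; congr 1 <;> simp only [c, r] <;> ring
  let B : ℕ → ContDiffBump c := fun k =>
    ⟨r * (1 - 1 / ((k : ℝ) + 2)), r, by
      have : 1 / ((k : ℝ) + 2) < 1 := by
        rw [div_lt_one (by positivity)]; linarith [(Nat.cast_nonneg k : (0 : ℝ) ≤ k)]
      have : 0 < 1 - 1 / ((k : ℝ) + 2) := by linarith
      positivity, by
      have : 0 < 1 / ((k : ℝ) + 2) := by positivity
      nlinarith⟩
  have lim : ∀ ρ : ProbabilityMeasure ℝ, Tendsto (fun k => ∫ v, B k v ∂(ρ : Measure ℝ)) atTop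
      (𝓝 (∫ v, (Ioo (a : ℝ) b).indicator 1 v ∂(ρ : Measure ℝ))) := by
    intro ρ
    apply tendsto_integral_of_dominated_convergence (fun _ => 1)
    · exact fun k => (B k).continuous.aestronglyMeasurable
    · exact integrable_const _
    · intro k
      refine ae_of_all _ fun v => ?_
      rw [Real.norm_eq_abs, abs_of_nonneg (B k).nonneg]
      exact (B k).le_one
    · refine ae_of_all _ fun v => ?_
      by_cases hv : v ∈ Ioo (a : ℝ) b
      · rw [indicator_of_mem hv]
        apply tendsto_const_nhds.congr'
        rw [hball, Metric.mem_ball] at hv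
        have h1 : Tendsto (fun k : ℕ => r * (1 - 1 / ((k : ℝ) + 2))) atTop (𝓝 (r * (1 - 0))) := by
          apply Tendsto.const_mul
          apply tendsto_const_nhds.sub
          apply Tendsto.const_div_atTop
          exact tendsto_atTop_add_const_right _ _ tendsto_natCast_atTop_atTop
        rw [sub_zero, mul_one] at h1
        filter_upwards [h1.eventually (lt_mem_nhds hv)] with k hk
        exact ((B k).one_of_mem_closedBall (Metric.mem_closedBall.2 hk.le)).symm
      · rw [indicator_of_notMem hv]
        apply tendsto_const_nhds.congr
        intro k
        rw [hball, ← (show Function.support (B k) = Metric.ball c r from (B k).support_eq)] at hv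
        exact (Function.notMem_support.1 hv).symm
  have h1 := tendsto_nhds_unique (lim μ)
    ((lim ν).congr fun k => (h _ (B k).contDiff (B k).hasCompactSupport).symm)
  rw [integral_indicator_one measurableSet_Ioo, integral_indicator_one measurableSet_Ioo] at h1
  exact (measureReal_eq_measureReal_iff).1 h1

lemma continuous_integral_of_compactSupport {ψ : ℝ → ℝ} (h1 : Continuous ψ)
    (h2 : HasCompactSupport ψ) :
    Continuous fun μ : ProbabilityMeasure ℝ => ∫ v, ψ v ∂(μ : Measure ℝ) := by
  obtain ⟨C, hC⟩ := h2.exists_bound_of_continuous h1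
  exact ProbabilityMeasure.continuous_integral_boundedContinuousFunction
    (BoundedContinuousFunction.ofNormedAddCommGroup ψ h1 C hC)

lemma tendsto_of_forall_C1 {ι : Type*} {L : Filter ι} {M : NNReal}
    {μs : ι → ProbabilityMeasure ℝ} {μ : ProbabilityMeasure ℝ} (hK : ∀ i, μs i ∈ tailSet M)
    (h : ∀ ψ : ℝ → ℝ, ContDiff ℝ 1 ψ → HasCompactSupport ψ →
      Tendsto (fun i => ∫ v, ψ v ∂(μs i : Measure ℝ)) L (𝓝 (∫ v, ψ v ∂(μ : Measure ℝ)))) :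
    Tendsto μs L (𝓝 μ) := by
  apply (isCompact_tailSet M).tendsto_nhds_of_unique_mapClusterPt (Eventually.of_forall hK)
  intro ν _ hν
  apply measure_ext_of_C1
  intro ψ h1 h2
  have h3 := hν.continuousAt_comp
    (continuous_integral_of_compactSupport h1.continuous h2).continuousAt
  have h4 : ClusterPt (∫ v, ψ v ∂(ν : Measure ℝ)) (𝓝 (∫ v, ψ v ∂(μ : Measure ℝ))) :=
    h3.clusterPt.mono (h ψ h1 h2)
  exact eq_of_nhds_neBot h4

/-- The kernel `t ↦ g t ⊗ g t` on the off-diagonal plane, of a narrowly continuous curve. -/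
noncomputable def pairKernel (g : ℝ → ProbabilityMeasure ℝ) (hg : Continuous g) :
    ProbabilityTheory.Kernel ℝ OffDiag where
  toFun t := prodOff (g t)
  measurable' := by
    let K : ProbabilityTheory.Kernel ℝ ℝ :=
      ⟨fun t => (g t : Measure ℝ), measurable_toMeasure_of_continuous hg⟩
    have : ProbabilityTheory.IsMarkovKernel K := ⟨fun t => (g t).2⟩
    have h := ((K.prod K).comapRight measurableEmbedding_offDiag).measurable
    convert h using 2 with t
    rw [ProbabilityTheory.Kernel.comapRight_apply, ProbabilityTheory.Kernel.prod_apply]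
    rfl

/-- The kernel `t ↦ g t` of a narrowly continuous curve. -/
noncomputable def curveKernel (g : ℝ → ProbabilityMeasure ℝ) (hg : Continuous g) :
    ProbabilityTheory.Kernel ℝ ℝ :=
  ⟨fun t => (g t : Measure ℝ), measurable_toMeasure_of_continuous hg⟩

instance (g : ℝ → ProbabilityMeasure ℝ) (hg : Continuous g) :
    ProbabilityTheory.IsMarkovKernel (curveKernel g hg) := ⟨fun t => (g t).2⟩

lemma prodOff_univ_le (f : ProbabilityMeasure ℝ) : prodOff f univ ≤ 1 := by
  rw [prodOff, measurableEmbedding_offDiag.comap_apply]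
  exact prob_le_one

instance (g : ℝ → ProbabilityMeasure ℝ) (hg : Continuous g) :
    ProbabilityTheory.IsFiniteKernel (pairKernel g hg) :=
  ⟨1, ENNReal.one_lt_top, fun t => prodOff_univ_le (g t)⟩

/-- The test functions `C_c¹((0, T) × ℝ)`. -/
def testSpace (T : ℝ) : Submodule ℝ (ℝ → ℝ → ℝ) where
  carrier := {φ | ContDiff ℝ 1 (Function.uncurry φ) ∧ HasCompactSupport (Function.uncurry φ) ∧
    tsupport (Function.uncurry φ) ⊆ Ioo 0 T ×ˢ univ}
  zero_mem' := by
    have : Function.uncurry (0 : ℝ → ℝ → ℝ) = 0 := rfl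
    rw [mem_ofPred_eq, this]
    exact ⟨contDiff_const, HasCompactSupport.zero, by simp⟩
  add_mem' {φ ψ} h1 h2 := by
    have : Function.uncurry (φ + ψ) = Function.uncurry φ + Function.uncurry ψ := rfl
    rw [mem_ofPred_eq, this]
    exact ⟨h1.1.add h2.1, h1.2.1.add h2.2.1,
      (tsupport_add _ _).trans (union_subset h1.2.2 h2.2.2)⟩
  smul_mem' c φ h := by
    have : Function.uncurry (c • φ) = c • Function.uncurry φ := rfl
    rw [mem_ofPred_eq, this]
    refine ⟨h.1.const_smul c, h.2.1.mono (Function.support_const_smul_subset c _), ?_⟩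
    exact (closure_mono (Function.support_const_smul_subset c (Function.uncurry φ))).trans h.2.2

section Test

variable {φ : ℝ → ℝ → ℝ}

lemma hasDerivAt_time (h : ContDiff ℝ 1 (Function.uncurry φ)) (t v : ℝ) :
    HasDerivAt (fun s => φ s v) (fderiv ℝ (Function.uncurry φ) (t, v) (1, 0)) t := by
  have h1 := ((h.differentiable one_ne_zero) (t, v)).hasFDerivAt
  exact h1.comp_hasDerivAt t ((hasDerivAt_id t).prodMk (hasDerivAt_const t v))

lemma hasDerivAt_space (h : ContDiff ℝ 1 (Function.uncurry φ)) (t v : ℝ) :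
    HasDerivAt (φ t) (fderiv ℝ (Function.uncurry φ) (t, v) (0, 1)) v := by
  have h1 := ((h.differentiable one_ne_zero) (t, v)).hasFDerivAt
  exact h1.comp_hasDerivAt v ((hasDerivAt_const v t).prodMk (hasDerivAt_id v))

lemma continuous_deriv_time (h : ContDiff ℝ 1 (Function.uncurry φ)) :
    Continuous fun x : ℝ × ℝ => deriv (fun s => φ s x.2) x.1 := by
  simp_rw [fun x : ℝ × ℝ => (hasDerivAt_time h x.1 x.2).deriv]
  exact (h.continuous_fderiv one_ne_zero).clm_apply continuous_const

lemma continuous_deriv_space (h : ContDiff ℝ 1 (Function.uncurry φ)) :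
    Continuous fun x : ℝ × ℝ => deriv (φ x.1) x.2 := by
  simp_rw [fun x : ℝ × ℝ => (hasDerivAt_space h x.1 x.2).deriv]
  exact (h.continuous_fderiv one_ne_zero).clm_apply continuous_const

lemma continuous_nlGrad (h : ContDiff ℝ 1 (Function.uncurry φ)) :
    Continuous fun x : ℝ × OffDiag => nlGrad (φ x.1) x.2 := by
  unfold nlGrad
  exact ((continuous_deriv_space h).comp
    (continuous_fst.prodMk (continuous_snd.comp (continuous_subtype_val.comp continuous_snd)))).sub
    ((continuous_deriv_space h).comp
    (continuous_fst.prodMk (continuous_fst.comp (continuous_subtype_val.comp continuous_snd))))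

lemma exists_bound_deriv (h : ContDiff ℝ 1 (Function.uncurry φ))
    (hc : HasCompactSupport (Function.uncurry φ)) :
    ∃ C, 0 ≤ C ∧ (∀ t v, |deriv (fun s => φ s v) t| ≤ C) ∧ (∀ t v, |deriv (φ t) v| ≤ C) := by
  obtain ⟨C, hC⟩ := (hc.fderiv (𝕜 := ℝ)).exists_bound_of_continuous
    (h.continuous_fderiv one_ne_zero)
  refine ⟨C, (norm_nonneg _).trans (hC 0), fun t v => ?_, fun t v => ?_⟩
  · rw [(hasDerivAt_time h t v).deriv, ← Real.norm_eq_abs]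
    refine (ContinuousLinearMap.le_opNorm (fderiv ℝ (Function.uncurry φ) (t, v)) _).trans ?_
    simpa [Prod.norm_def] using hC (t, v)
  · rw [(hasDerivAt_space h t v).deriv, ← Real.norm_eq_abs]
    refine (ContinuousLinearMap.le_opNorm (fderiv ℝ (Function.uncurry φ) (t, v)) _).trans ?_
    simpa [Prod.norm_def] using hC (t, v)

lemma fderiv_eq_zero_of_notMem {T t v : ℝ} (hs : tsupport (Function.uncurry φ) ⊆ Ioo 0 T ×ˢ univ)
    (ht : t ∉ Ioo 0 T) : fderiv ℝ (Function.uncurry φ) (t, v) = 0 := by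
  by_contra hne
  exact ht (hs (support_fderiv_subset ℝ hne)).1

lemma deriv_space_eq_zero {T t v : ℝ} (h : ContDiff ℝ 1 (Function.uncurry φ))
    (hs : tsupport (Function.uncurry φ) ⊆ Ioo 0 T ×ˢ univ)
    (ht : t ∉ Ioo 0 T) : deriv (φ t) v = 0 := by
  rw [(hasDerivAt_space h t v).deriv, fderiv_eq_zero_of_notMem hs ht]; rfl

lemma deriv_time_eq_zero {T t v : ℝ} (h : ContDiff ℝ 1 (Function.uncurry φ))
    (hs : tsupport (Function.uncurry φ) ⊆ Ioo 0 T ×ˢ univ)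
    (ht : t ∉ Ioo 0 T) : deriv (fun s => φ s v) t = 0 := by
  rw [(hasDerivAt_time h t v).deriv, fderiv_eq_zero_of_notMem hs ht]; rfl

end Test

lemma lintegral_prodOff_le (f : ProbabilityMeasure ℝ) (G : ℝ × ℝ → ℝ≥0∞) :
    ∫⁻ p : OffDiag, G p.1 ∂prodOff f ≤ ∫⁻ x, G x ∂((f : Measure ℝ).prod (f : Measure ℝ)) :=
  (lintegral_subtype_comap (μ := (f : Measure ℝ).prod (f : Measure ℝ))
    measurableSet_offDiag G).trans_le (setLIntegral_le_lintegral _ _)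

lemma lintegral_fst_prod (f : ProbabilityMeasure ℝ) {G : ℝ → ℝ≥0∞} (hG : Measurable G) :
    ∫⁻ x, G x.1 ∂((f : Measure ℝ).prod (f : Measure ℝ)) = ∫⁻ v, G v ∂(f : Measure ℝ) := by
  have h : Measurable fun x : ℝ × ℝ => G x.1 := hG.comp measurable_fst
  rw [lintegral_prod _ h.aemeasurable]; simp

lemma lintegral_snd_prod (f : ProbabilityMeasure ℝ) {G : ℝ → ℝ≥0∞} (hG : Measurable G) :
    ∫⁻ x, G x.2 ∂((f : Measure ℝ).prod (f : Measure ℝ)) = ∫⁻ v, G v ∂(f : Measure ℝ) := by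
  have h : Measurable fun x : ℝ × ℝ => G x.2 := hG.comp measurable_snd
  rw [lintegral_prod _ h.aemeasurable]; simp

lemma sigma_le {e : ℝ} (he0 : 0 ≤ e) (p : OffDiag) :
    sigma e p ≤ |p.1.1 - p.1.2| := by
  unfold sigma
  have := abs_nonneg (p.1.1 - p.1.2)
  nlinarith

lemma abs_sub_le_one_add_sq (v w : ℝ) : |v - w| ≤ 1 + v ^ 2 + w ^ 2 := by
  rw [abs_le]
  constructor <;> nlinarith [sq_nonneg (v - 1), sq_nonneg (v + 1), sq_nonneg (w - 1),
    sq_nonneg (w + 1)]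

lemma lintegral_sigma_le {e : ℝ} (he0 : 0 ≤ e) (f : ProbabilityMeasure ℝ) :
    ∫⁻ p, ENNReal.ofReal (sigma e p) ∂prodOff f ≤ 1 + 2 * secondMoment f := by
  have hm : Measurable fun v : ℝ => ENNReal.ofReal (v ^ 2) := by fun_prop
  calc ∫⁻ p, ENNReal.ofReal (sigma e p) ∂prodOff f
      ≤ ∫⁻ p : OffDiag, (1 + ENNReal.ofReal (p.1.1 ^ 2) + ENNReal.ofReal (p.1.2 ^ 2))
          ∂prodOff f := by
        apply lintegral_mono
        intro p
        beta_reduce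
        rw [← ENNReal.ofReal_one, ← ENNReal.ofReal_add (by norm_num) (by positivity),
          ← ENNReal.ofReal_add (by positivity) (by positivity)]
        exact ENNReal.ofReal_le_ofReal ((sigma_le he0 p).trans (abs_sub_le_one_add_sq _ _))
    _ ≤ ∫⁻ x, (1 + ENNReal.ofReal (x.1 ^ 2) + ENNReal.ofReal (x.2 ^ 2))
          ∂((f : Measure ℝ).prod (f : Measure ℝ)) :=
        lintegral_prodOff_le f fun x => 1 + ENNReal.ofReal (x.1 ^ 2) + ENNReal.ofReal (x.2 ^ 2)
    _ = 1 + 2 * secondMoment f := by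
        rw [lintegral_add_left (by fun_prop), lintegral_add_left (by fun_prop),
          lintegral_fst_prod f hm, lintegral_snd_prod f hm]
        simp only [lintegral_const, measure_univ, mul_one, secondMoment]
        ring

lemma lintegral_sigma_sq_le {e : ℝ} (he0 : 0 ≤ e) (f : ProbabilityMeasure ℝ) {G : OffDiag → ℝ}
    {C : ℝ} (hG : ∀ p, |G p| ≤ C) :
    ∫⁻ p, ENNReal.ofReal (sigma e p) * ENNReal.ofReal (G p ^ 2) ∂prodOff f
      ≤ ENNReal.ofReal (C ^ 2) * (1 + 2 * secondMoment f) := by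
  calc _ ≤ ∫⁻ p, ENNReal.ofReal (C ^ 2) * ENNReal.ofReal (sigma e p) ∂prodOff f := by
        apply lintegral_mono
        intro p
        beta_reduce
        rw [mul_comm]
        refine mul_le_mul_left (ENNReal.ofReal_le_ofReal ?_) _
        rw [← sq_abs (G p)]
        exact pow_le_pow_left₀ (abs_nonneg _) (hG p) 2
    _ ≤ _ := by
        rw [lintegral_const_mul' _ _ ENNReal.ofReal_ne_top]
        gcongr
        exact lintegral_sigma_le he0 f

lemma abs_nlGrad_le {ψ : ℝ → ℝ} {C : ℝ} (h : ∀ v, |deriv ψ v| ≤ C) (p : OffDiag) :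
    |nlGrad ψ p| ≤ 2 * C := by
  unfold nlGrad
  have := abs_sub (deriv ψ p.1.2) (deriv ψ p.1.1)
  linarith [h p.1.2, h p.1.1]

/-- The energy `∫ σ (∇̃φ)² d(f ⊗ f)` of a gradient is a measurable function of time. -/
lemma measurable_gradEnergy (e : ℝ) {f : ℝ → ProbabilityMeasure ℝ} (hf : Continuous f)
    {G : ℝ × OffDiag → ℝ} (hG : Measurable G) :
    Measurable fun t => ∫⁻ p, ENNReal.ofReal (sigma e p) * ENNReal.ofReal (G (t, p) ^ 2)
      ∂prodOff (f t) := by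
  have h1 : Measurable fun x : ℝ × OffDiag =>
      ENNReal.ofReal (sigma e x.2) * ENNReal.ofReal (G x ^ 2) :=
    ((continuous_sigma e).measurable.comp measurable_snd).ennreal_ofReal.mul
      (hG.pow_const 2).ennreal_ofReal
  exact h1.lintegral_kernel_prod_right' (κ := pairKernel f hf)

/-- The weak formulation controls the time derivative by the action and the gradient energy. -/
lemma weak_bound {e T : ℝ} (he1 : e < 1) {f : ℝ → ProbabilityMeasure ℝ}
    (hf : Continuous f) {U : ℝ → SignedMeasure OffDiag} (hU : IsGCE e T f U) (hT : 0 ≤ T)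
    {φ : ℝ → ℝ → ℝ} (hφ : φ ∈ testSpace T) {ε : ℝ} (hε : 0 < ε) :
    ‖∫ t in (0 : ℝ)..T, ∫ v, deriv (fun s => φ s v) t ∂(f t : Measure ℝ)‖ₑ
      ≤ ENNReal.ofReal (ε / 2) * (∫⁻ t in Icc 0 T, action e (f t) (U t))
        + ENNReal.ofReal (1 / (2 * ε)) * ∫⁻ t in Icc 0 T, ∫⁻ p, ENNReal.ofReal (sigma e p)
          * ENNReal.ofReal (nlGrad (φ t) p ^ 2) ∂prodOff (f t) := by
  have h1 := hU.weak_form φ hφ.1 hφ.2.1 hφ.2.2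
  rw [eq_neg_of_add_eq_zero_left h1, enorm_neg]
  have hG : Measurable fun x : ℝ × OffDiag => nlGrad (φ x.1) x.2 :=
    (continuous_nlGrad hφ.1).measurable
  calc _ ≤ ∫⁻ t in Ioc 0 T, ‖∫ᵛ p, sigma e p * nlGrad (φ t) p ∂•(U t)‖ₑ := by
        rw [intervalIntegral.integral_of_le hT]
        exact enorm_integral_le_lintegral_enorm _
    _ ≤ ∫⁻ t in Icc 0 T, ‖∫ᵛ p, sigma e p * nlGrad (φ t) p ∂•(U t)‖ₑ :=
        lintegral_mono_set Ioc_subset_Icc_self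
    _ ≤ ∫⁻ t in Icc 0 T, (ENNReal.ofReal (ε / 2) * action e (f t) (U t)
        + ENNReal.ofReal (1 / (2 * ε)) * ∫⁻ p, ENNReal.ofReal (sigma e p)
          * ENNReal.ofReal (nlGrad (φ t) p ^ 2) ∂prodOff (f t)) := by
        apply lintegral_mono
        intro t
        exact enorm_vintegral_sigma_le e he1 (f t) (U t) _ (hG.comp measurable_prodMk_left) hε
    _ = _ := by
        rw [lintegral_add_right _ ((measurable_gradEnergy e hf hG).const_mul _),
          lintegral_const_mul' _ _ ENNReal.ofReal_ne_top,
          lintegral_const_mul' _ _ ENNReal.ofReal_ne_top]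

/-- A `C¹` step from `0` to `1` on `[a, a + δ]`. -/
lemma exists_step (a : ℝ) {δ : ℝ} (hδ : 0 < δ) : ∃ P p : ℝ → ℝ, Continuous p ∧
    (∀ r, HasDerivAt P (p r) r) ∧ (∀ r, 0 ≤ p r) ∧ (∀ r ≤ a, P r = 0) ∧
    (∀ r, a + δ ≤ r → P r = 1) ∧ (∀ r, r ∉ Ioo a (a + δ) → p r = 0) ∧ ∀ r, P r ∈ Icc 0 1 := by
  let B : ContDiffBump (a + δ / 2) := ⟨δ / 4, δ / 2, by positivity, by linarith⟩
  let p : ℝ → ℝ := B.normed volume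
  have hp : Continuous p := B.continuous_normed
  have hp0 : ∀ r, 0 ≤ p r := fun r => B.nonneg_normed r
  have hs : ∀ r, r ∉ Ioo a (a + δ) → p r = 0 := by
    intro r hr
    rw [← Function.notMem_support]
    have : Function.support p = Metric.ball (a + δ / 2) (δ / 2) := B.support_normed_eq
    rw [this, Real.ball_eq_Ioo]
    convert hr using 3 <;> ring
  have h1 : ∫ r, p r = 1 := B.integral_normed
  have hint : Integrable p := B.integrable_normed
  let P : ℝ → ℝ := fun r => ∫ x in a..r, p x
  have hP : ∀ r, HasDerivAt P (p r) r := fun r =>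
    intervalIntegral.integral_hasDerivAt_right (hp.intervalIntegrable _ _)
      (hp.stronglyMeasurableAtFilter _ _) hp.continuousAt
  have hmono : Monotone P := monotone_of_deriv_nonneg (fun r => (hP r).differentiableAt)
    (fun r => by rw [(hP r).deriv]; exact hp0 r)
  have hP0 : ∀ r ≤ a, P r = 0 := by
    intro r hr
    apply intervalIntegral.integral_zero_ae
    refine ae_of_all _ fun x hx => hs x ?_
    rw [uIoc_of_ge hr] at hx
    exact fun h => absurd hx.2 (not_le.2 h.1)
  have hP1 : ∀ r, a + δ ≤ r → P r = 1 := by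
    intro r hr
    change ∫ x in a..r, p x = 1
    rw [intervalIntegral.integral_of_le (by linarith), ← h1]
    apply setIntegral_eq_integral_of_forall_compl_eq_zero
    intro x hx
    exact hs x fun h => hx ⟨h.1, h.2.le.trans hr⟩
  refine ⟨P, p, hp, hP, hp0, hP0, hP1, hs, fun r => ⟨?_, ?_⟩⟩
  · rw [← hP0 (min r a) (min_le_right _ _)]; exact hmono (min_le_left _ _)
  · rw [← hP1 (max r (a + δ)) (le_max_right _ _)]; exact hmono (le_max_left _ _)

lemma step_average {T a δ : ℝ} (h0a : 0 ≤ a) (haT : a + δ ≤ T)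
    {P p h : ℝ → ℝ} (hδ : 0 < δ) (hp : Continuous p) (hP : ∀ r, HasDerivAt P (p r) r)
    (hp0 : ∀ r, 0 ≤ p r) (hP0 : ∀ r ≤ a, P r = 0) (hP1 : ∀ r, a + δ ≤ r → P r = 1)
    (hs : ∀ r, r ∉ Ioo a (a + δ) → p r = 0) (hh : Continuous h) {c ω : ℝ}
    (hω : ∀ r ∈ Ioo a (a + δ), |h r - c| ≤ ω) :
    |(∫ r in (0 : ℝ)..T, p r * h r) - c| ≤ ω := by
  have hT : 0 ≤ T := by linarith
  have h1 : ∫ r in (0 : ℝ)..T, p r = 1 := by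
    rw [intervalIntegral.integral_eq_sub_of_hasDerivAt (fun r _ => hP r)
      (hp.intervalIntegrable _ _), hP1 T haT, hP0 0 h0a, sub_zero]
  have h2 : (∫ r in (0 : ℝ)..T, p r * h r) - c = ∫ r in (0 : ℝ)..T, p r * (h r - c) := by
    have : c = ∫ r in (0 : ℝ)..T, p r * c := by
      rw [intervalIntegral.integral_mul_const, h1, one_mul]
    conv_lhs => rw [this]
    have i1 : Continuous fun r => p r * h r := hp.mul hh
    have i2 : Continuous fun r => p r * c := hp.mul continuous_const
    rw [← intervalIntegral.integral_sub (i1.intervalIntegrable _ _) (i2.intervalIntegrable _ _)]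
    congr 1; ext r; ring
  rw [h2]
  calc _ ≤ ∫ r in (0 : ℝ)..T, |p r * (h r - c)| :=
        intervalIntegral.abs_integral_le_integral_abs hT
    _ ≤ ∫ r in (0 : ℝ)..T, p r * ω := by
        apply intervalIntegral.integral_mono_on hT
        · exact (hp.mul (hh.sub continuous_const)).abs.intervalIntegrable _ _
        · exact (hp.mul continuous_const).intervalIntegrable _ _
        · intro r _
          rw [abs_mul, abs_of_nonneg (hp0 r)]
          by_cases hr : r ∈ Ioo a (a + δ)
          · exact mul_le_mul_of_nonneg_left (hω r hr) (hp0 r)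
          · simp [hs r hr]
    _ = ω := by rw [intervalIntegral.integral_mul_const, h1, one_mul]

lemma mul_mem_testSpace {T s t : ℝ} (hs : 0 < s) (ht : t < T) {η ψ : ℝ → ℝ}
    (hη : ContDiff ℝ 1 η) (hη0 : ∀ r, r ∉ Icc s t → η r = 0)
    (hψ : ContDiff ℝ 1 ψ) (hψc : HasCompactSupport ψ) :
    (fun r v => η r * ψ v) ∈ testSpace T := by
  have hsub : tsupport (Function.uncurry fun r v => η r * ψ v) ⊆ Icc s t ×ˢ tsupport ψ := by
    apply closure_minimal _ (isClosed_Icc.prod (isClosed_tsupport ψ))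
    rintro ⟨r, v⟩ h
    simp only [Function.mem_support, Function.uncurry_apply_pair, ne_eq, mul_eq_zero, not_or] at h
    refine ⟨?_, subset_tsupport _ h.2⟩
    by_contra h'
    exact h.1 (hη0 r h')
  refine ⟨?_, ?_, hsub.trans ?_⟩
  · exact (hη.comp contDiff_fst).mul (hψ.comp contDiff_snd)
  · exact (isCompact_Icc.prod hψc).of_isClosed_subset (isClosed_tsupport _) hsub
  · exact prod_mono (fun r hr => ⟨hs.trans_le hr.1, hr.2.trans_lt ht⟩) (subset_univ _)

/-- Increments of a weak solution are controlled by the action. -/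
lemma increment_bound {e T : ℝ} (he1 : e < 1) {f : ℝ → ProbabilityMeasure ℝ}
    (hf : Continuous f) {U : ℝ → SignedMeasure OffDiag} (hU : IsGCE e T f U)
    {ψ : ℝ → ℝ} (hψ : ContDiff ℝ 1 ψ) (hψc : HasCompactSupport ψ)
    {s t : ℝ} (hs : 0 ≤ s) (hst : s < t) (ht : t ≤ T) {ε : ℝ} (hε : 0 < ε) :
    ENNReal.ofReal |∫ v, ψ v ∂(f t : Measure ℝ) - ∫ v, ψ v ∂(f s : Measure ℝ)|
      ≤ ENNReal.ofReal (ε / 2) * (∫⁻ t in Icc 0 T, action e (f t) (U t))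
        + ENNReal.ofReal (1 / (2 * ε)) * ∫⁻ r in Icc s t, ∫⁻ p, ENNReal.ofReal (sigma e p)
          * ENNReal.ofReal (nlGrad ψ p ^ 2) ∂prodOff (f r) := by
  have hh : Continuous fun r => ∫ v, ψ v ∂(f r : Measure ℝ) :=
    (continuous_integral_of_compactSupport hψ.continuous hψc).comp hf
  set h : ℝ → ℝ := fun r => ∫ v, ψ v ∂(f r : Measure ℝ)
  apply ENNReal.le_of_forall_pos_le_add
  intro ω hω _
  have hω' : (0 : ℝ) < ω / 2 := by have : (0 : ℝ) < ω := hω; positivity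
  obtain ⟨δ₁, hδ₁, h₁⟩ := Metric.continuous_iff.1 hh s (ω / 2) hω'
  obtain ⟨δ₂, hδ₂, h₂⟩ := Metric.continuous_iff.1 hh t (ω / 2) hω'
  let δ := min (min (δ₁ / 2) (δ₂ / 2)) ((t - s) / 4)
  have hδ : 0 < δ := by
    refine lt_min (lt_min ?_ ?_) ?_ <;> linarith
  have hd1 : δ ≤ δ₁ / 2 := (min_le_left _ _).trans (min_le_left _ _)
  have hd2 : δ ≤ δ₂ / 2 := (min_le_left _ _).trans (min_le_right _ _)
  have hd3 : δ ≤ (t - s) / 4 := min_le_right _ _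
  obtain ⟨P, p, hp, hP, hp0, hP0, hP1, hps, hP01⟩ := exists_step (s + δ) hδ
  obtain ⟨Q, q, hq, hQ, hq0, hQ0, hQ1, hqs, hQ01⟩ := exists_step (t - 2 * δ) hδ
  have hA := step_average (T := T) (by linarith) (by linarith) hδ hp hP hp0 hP0 hP1 hps hh
    (c := h s) (ω := ω / 2) (by
      intro r hr
      rw [← Real.dist_eq]
      apply (h₁ r _).le
      rw [Real.dist_eq, abs_lt]
      constructor <;> linarith [hr.1, hr.2])
  have hB := step_average (T := T) (by linarith) (by linarith) hδ hq hQ hq0 hQ0 hQ1 hqs hh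
    (c := h t) (ω := ω / 2) (by
      intro r hr
      rw [← Real.dist_eq]
      apply (h₂ r _).le
      rw [Real.dist_eq, abs_lt]
      constructor <;> linarith [hr.1, hr.2])
  let η : ℝ → ℝ := fun r => P r - Q r
  have hη' : ∀ r, HasDerivAt η (p r - q r) r := fun r => (hP r).sub (hQ r)
  have hηC : ContDiff ℝ 1 η := by
    rw [contDiff_one_iff_deriv]
    refine ⟨fun r => (hη' r).differentiableAt, ?_⟩
    rw [show deriv η = fun r => p r - q r from funext fun r => (hη' r).deriv]
    exact hp.sub hq
  have hη0 : ∀ r, r ∉ Icc (s + δ) (t - δ) → η r = 0 := by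
    intro r hr
    change P r - Q r = 0
    rcases lt_or_ge r (s + δ) with h3 | h3
    · rw [hP0 r h3.le, hQ0 r (by linarith), sub_zero]
    · have h4 : t - δ < r := by
        by_contra h5
        exact hr ⟨h3, not_lt.1 h5⟩
      rw [hP1 r (by linarith), hQ1 r (by linarith), sub_self]
  have hη1 : ∀ r, η r ^ 2 ≤ 1 := by
    intro r
    have h3 := hP01 r
    have h4 := hQ01 r
    have : |P r - Q r| ≤ 1 := abs_le.2 ⟨by linarith [h3.1, h4.2], by linarith [h3.2, h4.1]⟩
    change (P r - Q r) ^ 2 ≤ 1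
    rw [← sq_abs]
    exact pow_le_one₀ (abs_nonneg _) this
  have hφ : (fun r v => η r * ψ v) ∈ testSpace T :=
    mul_mem_testSpace (by linarith) (by linarith) hηC hη0 hψ hψc
  have hW := weak_bound he1 hf hU (by linarith) hφ hε
  have hL : ∀ r, ∫ v, deriv (fun s => η s * ψ v) r ∂(f r : Measure ℝ)
      = p r * h r - q r * h r := by
    intro r
    simp_rw [fun v => ((hη' r).mul_const (ψ v)).deriv]
    rw [integral_const_mul]; ring
  simp_rw [hL] at hW
  have i1 : Continuous fun r => p r * h r := hp.mul hh
  have i2 : Continuous fun r => q r * h r := hq.mul hh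
  rw [intervalIntegral.integral_sub (i1.intervalIntegrable _ _) (i2.intervalIntegrable _ _),
    Real.enorm_eq_ofReal_abs] at hW
  have hR : ∫⁻ r in Icc 0 T, ∫⁻ x, ENNReal.ofReal (sigma e x)
        * ENNReal.ofReal (nlGrad (fun v => η r * ψ v) x ^ 2) ∂prodOff (f r)
      ≤ ∫⁻ r in Icc s t, ∫⁻ x, ENNReal.ofReal (sigma e x)
        * ENNReal.ofReal (nlGrad ψ x ^ 2) ∂prodOff (f r) := by
    rw [← lintegral_indicator measurableSet_Icc, ← lintegral_indicator measurableSet_Icc]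
    apply lintegral_mono
    intro r
    have hg : ∀ x, nlGrad (fun v => η r * ψ v) x = η r * nlGrad ψ x := by
      intro x
      simp only [nlGrad]
      rw [deriv_const_mul _ (hψ.differentiable one_ne_zero _),
        deriv_const_mul _ (hψ.differentiable one_ne_zero _)]
      ring
    by_cases hr : r ∈ Icc s t
    · rw [indicator_of_mem hr]
      refine (indicator_le_self _ _ _).trans (lintegral_mono fun x => ?_)
      beta_reduce
      rw [hg, mul_pow]
      refine mul_le_mul_right (ENNReal.ofReal_le_ofReal ?_) _
      exact mul_le_of_le_one_left (sq_nonneg _) (hη1 r)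
    · have : η r = 0 := hη0 r fun h' => hr ⟨by linarith [h'.1], by linarith [h'.2]⟩
      have h3 : ∀ x, nlGrad (fun v => η r * ψ v) x = 0 := fun x => by rw [hg, this, zero_mul]
      by_cases h4 : r ∈ Icc 0 T
      · simp [indicator, hr, h4, h3]
      · simp [indicator, hr, h4]
  calc ENNReal.ofReal |h t - h s|
      ≤ ENNReal.ofReal (|(∫ r in (0 : ℝ)..T, p r * h r) - ∫ r in (0 : ℝ)..T, q r * h r| + ω) := by
        apply ENNReal.ofReal_le_ofReal
        rw [abs_le] at hA hB
        rw [abs_le]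
        have h5 := le_abs_self ((∫ r in (0 : ℝ)..T, p r * h r) - ∫ r in (0 : ℝ)..T, q r * h r)
        have h6 := neg_abs_le ((∫ r in (0 : ℝ)..T, p r * h r) - ∫ r in (0 : ℝ)..T, q r * h r)
        constructor <;> linarith [hA.1, hA.2, hB.1, hB.2]
    _ = ENNReal.ofReal |(∫ r in (0 : ℝ)..T, p r * h r) - ∫ r in (0 : ℝ)..T, q r * h r| + ω := by
        rw [ENNReal.ofReal_add (abs_nonneg _) (NNReal.coe_nonneg _), ENNReal.ofReal_coe_nnreal]
    _ ≤ _ := by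
        gcongr
        refine hW.trans ?_
        gcongr

/-- A compactly supported `C¹` function that is `v²` near the origin, with Lipschitz derivative. -/
lemma exists_truncated_square : ∃ (χ : ℝ → ℝ) (K : NNReal), ContDiff ℝ 1 χ ∧
    HasCompactSupport χ ∧ (∀ x, 0 ≤ χ x) ∧ (∀ x, χ x ≤ x ^ 2) ∧ (∀ x, |x| ≤ 1 → χ x = x ^ 2) ∧
    LipschitzWith K (deriv χ) := by
  let B : ContDiffBump (0 : ℝ) := ⟨1, 2, one_pos, one_lt_two⟩
  have h2 : ContDiff ℝ 2 fun x => x ^ 2 * B x := (contDiff_id.pow 2).mul B.contDiff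
  have hc : HasCompactSupport fun x => x ^ 2 * B x := B.hasCompactSupport.mul_left
  have hd : ContDiff ℝ 1 (deriv fun x => x ^ 2 * B x) := by
    have : ContDiff ℝ (1 + 1) fun x => x ^ 2 * B x := h2
    exact (contDiff_succ_iff_deriv.1 this).2.2
  obtain ⟨K, hK⟩ := hd.lipschitzWith_of_hasCompactSupport hc.deriv one_ne_zero
  refine ⟨fun x => x ^ 2 * B x, K, h2.of_le one_le_two, hc, fun x => ?_, fun x => ?_, ?_, hK⟩
  · exact mul_nonneg (sq_nonneg x) B.nonneg
  · exact mul_le_of_le_one_right (sq_nonneg x) B.le_one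
  · intro x hx
    change x ^ 2 * B x = x ^ 2
    rw [B.one_of_mem_closedBall (by simpa using hx), mul_one]

/-- The second moment along a weak solution is controlled by action and dissipation. -/
lemma secondMoment_bound : ∃ K : NNReal, ∀ (e T : ℝ), e < 1 →
    ∀ (f : ℝ → ProbabilityMeasure ℝ) (U : ℝ → SignedMeasure OffDiag), Continuous f →
    IsGCE e T f U → ∀ t ∈ Icc 0 T, secondMoment (f t) ≤ secondMoment (f 0)
      + ((∫⁻ t in Icc 0 T, action e (f t) (U t))
      + K * ∫⁻ t in Icc 0 T, dissipation e (f t)) := by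
  obtain ⟨χ, K, hχ, hχc, hχ0, hχsq, hχ1, hK⟩ := exists_truncated_square
  refine ⟨K ^ 2, fun e T he1 f U hf hU t ht => ?_⟩
  rcases eq_or_lt_of_le ht.1 with h0 | h0
  · rw [← h0]; exact le_self_add
  let ψ : ℕ → ℝ → ℝ := fun R v => ((R : ℝ) + 1) ^ 2 * χ (v / ((R : ℝ) + 1))
  have hR : ∀ R : ℕ, (0 : ℝ) < (R : ℝ) + 1 := fun R => by positivity
  have hψ : ∀ R, ContDiff ℝ 1 (ψ R) := fun R =>
    contDiff_const.mul (hχ.comp (contDiff_id.div_const _))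
  have hψc : ∀ R, HasCompactSupport (ψ R) := by
    intro R
    have : HasCompactSupport fun v => χ (((R : ℝ) + 1)⁻¹ • v) :=
      hχc.comp_smul (inv_ne_zero (hR R).ne')
    have h2 : ψ R = fun v => ((R : ℝ) + 1) ^ 2 * χ (((R : ℝ) + 1)⁻¹ • v) := by
      ext v; simp only [ψ, smul_eq_mul]; ring_nf
    rw [h2]
    exact this.mul_left
  have hψ0 : ∀ R v, 0 ≤ ψ R v := fun R v => mul_nonneg (sq_nonneg _) (hχ0 _)
  have hψsq : ∀ R v, ψ R v ≤ v ^ 2 := by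
    intro R v
    calc ψ R v ≤ ((R : ℝ) + 1) ^ 2 * (v / ((R : ℝ) + 1)) ^ 2 := by
          simp only [ψ]; gcongr; exact hχsq _
      _ = v ^ 2 := by have := (hR R).ne'; field_simp
  have hψd : ∀ R v, deriv (ψ R) v = ((R : ℝ) + 1) * deriv χ (v / ((R : ℝ) + 1)) := by
    intro R v
    have h3 := ((hχ.differentiable one_ne_zero (v / ((R : ℝ) + 1))).hasDerivAt.comp v
      ((hasDerivAt_id v).div_const ((R : ℝ) + 1))).const_mul (((R : ℝ) + 1) ^ 2)
    rw [show ψ R = fun v => ((R : ℝ) + 1) ^ 2 * (χ ∘ fun x => id x / ((R : ℝ) + 1)) v from rfl,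
      h3.deriv]
    have := (hR R).ne'
    change ((R : ℝ) + 1) ^ 2 * (deriv χ (v / ((R : ℝ) + 1)) * (1 / ((R : ℝ) + 1))) = _
    field_simp
  have hψg : ∀ R p, nlGrad (ψ R) p ^ 2 ≤ (K : ℝ) ^ 2 * |p.1.1 - p.1.2| ^ 2 := by
    intro R p
    rw [← mul_pow, ← sq_abs (nlGrad (ψ R) p)]
    refine pow_le_pow_left₀ (abs_nonneg _) ?_ 2
    rw [nlGrad, hψd, hψd, ← mul_sub, abs_mul, abs_of_pos (hR R)]
    have h4 := hK.dist_le_mul (p.1.2 / ((R : ℝ) + 1)) (p.1.1 / ((R : ℝ) + 1))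
    rw [Real.dist_eq, Real.dist_eq, ← sub_div, abs_div, abs_of_pos (hR R), abs_sub_comm p.1.2] at h4
    calc _ ≤ ((R : ℝ) + 1) * (K * (|p.1.1 - p.1.2| / ((R : ℝ) + 1))) := by
          have := (hR R).le
          gcongr
      _ = _ := by have := (hR R).ne'; field_simp
  have hint : ∀ R (μ : ProbabilityMeasure ℝ), ENNReal.ofReal (∫ v, ψ R v ∂(μ : Measure ℝ))
      = ∫⁻ v, ENNReal.ofReal (ψ R v) ∂(μ : Measure ℝ) := fun R μ =>
    ofReal_integral_eq_lintegral_ofReal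
      ((hψ R).continuous.integrable_of_hasCompactSupport (hψc R)) (ae_of_all _ (hψ0 R))
  have key : ∀ R, ∫⁻ v, ENNReal.ofReal (ψ R v) ∂(f t : Measure ℝ) ≤ secondMoment (f 0)
      + ((∫⁻ t in Icc 0 T, action e (f t) (U t))
      + ((K ^ 2 : NNReal) : ℝ≥0∞) * ∫⁻ t in Icc 0 T, dissipation e (f t)) := by
    intro R
    rw [← hint]
    have h5 := increment_bound he1 hf hU (hψ R) (hψc R) le_rfl h0 ht.2 one_pos
    calc ENNReal.ofReal (∫ v, ψ R v ∂(f t : Measure ℝ))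
        ≤ ENNReal.ofReal ((∫ v, ψ R v ∂(f 0 : Measure ℝ))
          + |∫ v, ψ R v ∂(f t : Measure ℝ) - ∫ v, ψ R v ∂(f 0 : Measure ℝ)|) := by
          apply ENNReal.ofReal_le_ofReal
          linarith [le_abs_self (∫ v, ψ R v ∂(f t : Measure ℝ) - ∫ v, ψ R v ∂(f 0 : Measure ℝ))]
      _ ≤ ENNReal.ofReal (∫ v, ψ R v ∂(f 0 : Measure ℝ)) + ENNReal.ofReal
          |∫ v, ψ R v ∂(f t : Measure ℝ) - ∫ v, ψ R v ∂(f 0 : Measure ℝ)| :=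
          ENNReal.ofReal_add_le
      _ ≤ secondMoment (f 0) + ((∫⁻ t in Icc 0 T, action e (f t) (U t))
          + ((K ^ 2 : NNReal) : ℝ≥0∞) * ∫⁻ t in Icc 0 T, dissipation e (f t)) := by
          refine add_le_add ?_ (h5.trans (add_le_add ?_ ?_))
          · rw [hint]
            exact lintegral_mono fun v => ENNReal.ofReal_le_ofReal (hψsq R v)
          · refine mul_le_of_le_one_left (zero_le) ?_
            rw [ENNReal.ofReal_le_one]; norm_num
          · refine (mul_le_of_le_one_left zero_le ?_).trans ?_
            · rw [ENNReal.ofReal_le_one]; norm_num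
            · rw [← lintegral_const_mul' _ _ ENNReal.coe_ne_top]
              refine (lintegral_mono_set (Icc_subset_Icc le_rfl ht.2)).trans ?_
              apply lintegral_mono
              intro r
              beta_reduce
              rw [dissipation, ← lintegral_const_mul' _ _ ENNReal.coe_ne_top]
              apply lintegral_mono
              intro p
              beta_reduce
              rw [← ENNReal.ofReal_coe_nnreal, ← ENNReal.ofReal_mul (sigma_pos he1 p).le,
                ← ENNReal.ofReal_mul (NNReal.coe_nonneg _)]
              apply ENNReal.ofReal_le_ofReal
              have := mul_le_mul_of_nonneg_left (hψg R p) (sigma_pos he1 p).le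
              push_cast
              linarith
  calc secondMoment (f t)
      = ∫⁻ v, liminf (fun R => ENNReal.ofReal (ψ R v)) atTop ∂(f t : Measure ℝ) := by
        apply lintegral_congr
        intro v
        symm
        apply Tendsto.liminf_eq
        apply tendsto_const_nhds.congr'
        obtain ⟨N, hN⟩ := exists_nat_ge |v|
        filter_upwards [eventually_ge_atTop N] with R hNR
        congr 1
        have h6 : (N : ℝ) ≤ R := by exact_mod_cast hNR
        simp only [ψ]
        rw [hχ1]
        · have := (hR R).ne'; field_simp
        · rw [abs_div, abs_of_pos (hR R), div_le_one (hR R)]; linarith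
    _ ≤ liminf (fun R => ∫⁻ v, ENNReal.ofReal (ψ R v) ∂(f t : Measure ℝ)) atTop :=
        lintegral_liminf_le fun R => (hψ R).continuous.measurable.ennreal_ofReal
    _ ≤ _ := liminf_le_of_le (by isBoundedDefault) fun b hb => by
        obtain ⟨R, hR⟩ := hb.exists
        exact hR.trans (key R)

lemma exists_subseq_limit {M : NNReal} (F : ℕ → ℝ → ProbabilityMeasure ℝ)
    (hM : ∀ n t, F n t ∈ tailSet M)
    (hinc : ∀ ψ : ℝ → ℝ, ContDiff ℝ 1 ψ → HasCompactSupport ψ → ∃ C, ∀ n s t,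
      |∫ v, ψ v ∂(F n t : Measure ℝ) - ∫ v, ψ v ∂(F n s : Measure ℝ)| ≤ C * √|t - s|) :
    ∃ (k : ℕ → ℕ) (g : ℝ → ProbabilityMeasure ℝ), StrictMono k ∧ Continuous g ∧
      ∀ t, Tendsto (fun j => F (k j) t) atTop (𝓝 (g t)) := by
  have hK := isCompact_tailSet M
  obtain ⟨G, -, k, hk, hG⟩ := (isCompact_univ_pi fun _ : ℚ => hK).tendsto_subseq
    (x := fun n (q : ℚ) => F n q) (fun n q _ => hM n q)
  rw [tendsto_pi_nhds] at hG
  have sq0 : ∀ (C t : ℝ), Tendsto (fun s => C * √|t - s|) (𝓝 t) (𝓝 0) := by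
    intro C t
    have : Continuous fun s => C * √|t - s| := by fun_prop
    simpa using this.tendsto t
  have hex : ∀ t, ∃ μ, Tendsto (fun j => F (k j) t) atTop (𝓝 μ) := by
    intro t
    obtain ⟨μ, -, l, hl, hμ⟩ := hK.tendsto_subseq (x := fun j => F (k j) t) (fun j => hM _ _)
    refine ⟨μ, tendsto_of_forall_C1 (fun j => hM _ _) fun ψ h1 h2 => ?_⟩
    have hc := continuous_integral_of_compactSupport h1.continuous h2
    refine tendsto_nhds_of_cauchySeq_of_subseq ?_ hl.tendsto_atTop
      ((hc.tendsto μ).comp hμ)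
    obtain ⟨C, hC⟩ := hinc ψ h1 h2
    rw [Metric.cauchySeq_iff]
    intro ε hε
    have h3 : ∀ᶠ s in 𝓝 t, C * √|t - s| < ε / 3 :=
      (sq0 C t).eventually (gt_mem_nhds (by positivity))
    obtain ⟨q, hq⟩ := Rat.denseRange_cast.exists_mem_open (isOpen_interior (X := ℝ))
      ⟨t, mem_interior_iff_mem_nhds.2 h3⟩
    have hs' : C * √|t - q| < ε / 3 := by
      have := interior_subset hq
      exact this
    have hcau := (((hc.tendsto _).comp (hG q)).cauchySeq)
    rw [Metric.cauchySeq_iff] at hcau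
    obtain ⟨N, hN⟩ := hcau (ε / 3) (by positivity)
    refine ⟨N, fun m hm n hn => ?_⟩
    have h4 := hN m hm n hn
    have h5 := hC (k m) q t
    have h6 := hC (k n) q t
    simp only [Function.comp, Real.dist_eq, abs_lt, abs_le] at h4 h5 h6 ⊢
    constructor <;> linarith [h4.1, h4.2, h5.1, h5.2, h6.1, h6.2]
  choose g hg using hex
  refine ⟨k, g, hk, ?_, hg⟩
  rw [continuous_iff_continuousAt]
  intro t
  refine tendsto_of_forall_C1 (M := M) (fun s => hK.isClosed.mem_of_tendsto (hg s)
    (Eventually.of_forall fun j => hM _ _)) fun ψ h1 h2 => ?_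
  have hc := continuous_integral_of_compactSupport h1.continuous h2
  obtain ⟨C, hC⟩ := hinc ψ h1 h2
  rw [tendsto_iff_dist_tendsto_zero]
  refine squeeze_zero (fun _ => dist_nonneg) (fun s => ?_) (sq0 C t)
  have h3 := (((hc.tendsto _).comp (hg s)).sub ((hc.tendsto _).comp (hg t))).abs
  rw [Real.dist_eq]
  refine le_of_tendsto h3 (Eventually.of_forall fun j => ?_)
  rw [abs_sub_comm t s]
  exact hC (k j) t s

lemma increment_sqrt {e T : ℝ} (he0 : 0 ≤ e) (he1 : e < 1) {M a : NNReal} {ψ : ℝ → ℝ}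
    (hψ : ContDiff ℝ 1 ψ) (hψc : HasCompactSupport ψ) : ∃ C, 0 ≤ C ∧
    ∀ (f : ℝ → ProbabilityMeasure ℝ) (U : ℝ → SignedMeasure OffDiag), Continuous f →
      IsGCE e T f U → (∀ t ∈ Icc 0 T, secondMoment (f t) ≤ M) →
      (∫⁻ t in Icc 0 T, action e (f t) (U t)) ≤ a →
      ∀ s ∈ Icc 0 T, ∀ t ∈ Icc 0 T,
      |∫ v, ψ v ∂(f t : Measure ℝ) - ∫ v, ψ v ∂(f s : Measure ℝ)| ≤ C * √|t - s| := by
  obtain ⟨L, hL⟩ := hψc.deriv.exists_bound_of_continuous (hψ.continuous_deriv le_rfl)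
  simp only [Real.norm_eq_abs] at hL
  let C : ℝ := a / 2 + (2 * L) ^ 2 * (1 + 2 * M) / 2
  have hC : 0 ≤ C := by positivity
  refine ⟨C, hC, fun f U hf hU hM ha => ?_⟩
  have main : ∀ s ∈ Icc 0 T, ∀ t ∈ Icc 0 T, s < t →
      |∫ v, ψ v ∂(f t : Measure ℝ) - ∫ v, ψ v ∂(f s : Measure ℝ)| ≤ C * √|t - s| := by
    intro s hs t ht hst
    rw [abs_of_pos (sub_pos.2 hst)]
    have hε : 0 < √(t - s) := Real.sqrt_pos.2 (sub_pos.2 hst)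
    have h1 := increment_bound he1 hf hU hψ hψc hs.1 hst ht.2 hε
    rw [← ENNReal.ofReal_le_ofReal_iff (by positivity)]
    refine h1.trans ?_
    calc _ ≤ ENNReal.ofReal (√(t - s) / 2) * a + ENNReal.ofReal (1 / (2 * √(t - s)))
          * ∫⁻ r in Icc s t, ENNReal.ofReal ((2 * L) ^ 2) * (1 + 2 * M) := by
          refine add_le_add (mul_le_mul_right ha _) (mul_le_mul_right ?_ _)
          apply setLIntegral_mono measurable_const
          intro r hr
          refine (lintegral_sigma_sq_le he0 (f r) (abs_nlGrad_le hL)).trans ?_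
          gcongr
          exact hM r ⟨hs.1.trans hr.1, hr.2.trans ht.2⟩
      _ = ENNReal.ofReal (C * √(t - s)) := by
          rw [setLIntegral_const, Real.volume_Icc]
          have e1 : (1 : ℝ≥0∞) + 2 * M = ENNReal.ofReal (1 + 2 * M) := by
            rw [ENNReal.ofReal_add (by norm_num) (by positivity), ENNReal.ofReal_mul (by norm_num)]
            simp
          rw [e1, ← ENNReal.ofReal_coe_nnreal (p := a), ← ENNReal.ofReal_mul (by positivity),
            ← ENNReal.ofReal_mul (by positivity), ← ENNReal.ofReal_mul (by positivity),
            ← ENNReal.ofReal_mul (by positivity), ← ENNReal.ofReal_add (by positivity)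
              (mul_nonneg (by positivity) (mul_nonneg (by positivity) (by linarith)))]
          congr 1
          have h3 : (t - s) = √(t - s) * √(t - s) := (Real.mul_self_sqrt (by linarith)).symm
          simp only [C]
          rw [show (2 * L) ^ 2 * (1 + 2 * (M : ℝ)) * (t - s)
            = (2 * L) ^ 2 * (1 + 2 * (M : ℝ)) * (√(t - s) * √(t - s)) by rw [← h3]]
          field_simp
  intro s hs t ht
  rcases lt_trichotomy s t with h | h | h
  · exact main s hs t ht h
  · simp [h]
  · rw [abs_sub_comm, abs_sub_comm t s]; exact main t ht s hs h

lemma integrable_of_lintegral_sq {X : Type*} [MeasurableSpace X] {μ : Measure X}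
    [IsFiniteMeasure μ] {w : X → ℝ} (hw : Measurable w)
    (h : ∫⁻ x, ENNReal.ofReal (w x ^ 2) ∂μ < ⊤) : Integrable w μ := by
  refine ⟨hw.aestronglyMeasurable, ?_⟩
  rw [hasFiniteIntegral_iff_norm]
  calc ∫⁻ x, ENNReal.ofReal ‖w x‖ ∂μ ≤ ∫⁻ x, (1 + ENNReal.ofReal (w x ^ 2)) ∂μ := by
        apply lintegral_mono
        intro x
        beta_reduce
        rw [← ENNReal.ofReal_one, ← ENNReal.ofReal_add (by norm_num) (by positivity)]
        apply ENNReal.ofReal_le_ofReal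
        rw [Real.norm_eq_abs, ← sq_abs]
        nlinarith [sq_nonneg (|w x| - 1)]
    _ < ⊤ := by
        rw [lintegral_add_left measurable_const]
        exact ENNReal.add_lt_top.2 ⟨by simp, h⟩

lemma lintegral_sigma_mul_le {e : ℝ} (he0 : 0 ≤ e) (he1 : e < 1) (f : ProbabilityMeasure ℝ)
    (w : OffDiag → ℝ) {G : OffDiag → ℝ} {C : ℝ} (hGC : ∀ p, |G p| ≤ C) :
    ∫⁻ p, ENNReal.ofReal ‖sigma e p * G p * w p‖ ∂prodOff f
      ≤ ENNReal.ofReal |C| * ((1 + 2 * secondMoment f)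
        + ∫⁻ p, ENNReal.ofReal (sigma e p) * ENNReal.ofReal (w p ^ 2) ∂prodOff f) := by
  have hC : 0 ≤ |C| := abs_nonneg C
  calc ∫⁻ p, ENNReal.ofReal ‖sigma e p * G p * w p‖ ∂prodOff f
      ≤ ∫⁻ p, ENNReal.ofReal |C| * (ENNReal.ofReal (sigma e p)
        + ENNReal.ofReal (sigma e p) * ENNReal.ofReal (w p ^ 2)) ∂prodOff f := by
        apply lintegral_mono
        intro p
        beta_reduce
        have hσ := (sigma_pos he1 p).le
        rw [← ENNReal.ofReal_mul hσ, ← ENNReal.ofReal_add hσ (by positivity),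
          ← ENNReal.ofReal_mul hC]
        apply ENNReal.ofReal_le_ofReal
        rw [norm_mul, norm_mul, Real.norm_of_nonneg hσ, Real.norm_eq_abs, Real.norm_eq_abs]
        have h1 : |G p| ≤ |C| := (hGC p).trans (le_abs_self C)
        have h2 : |w p| ≤ 1 + w p ^ 2 := by
          rw [← sq_abs]; nlinarith [sq_nonneg (|w p| - 1)]
        calc sigma e p * |G p| * |w p| ≤ sigma e p * |C| * (1 + w p ^ 2) := by gcongr
          _ = _ := by ring
    _ ≤ _ := by
        rw [lintegral_const_mul' _ _ ENNReal.ofReal_ne_top,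
          lintegral_add_left (continuous_sigma e).measurable.ennreal_ofReal]
        gcongr
        exact lintegral_sigma_le he0 f

lemma integrable_sigma_mul {e : ℝ} (he0 : 0 ≤ e) (he1 : e < 1) {f : ProbabilityMeasure ℝ}
    (hf : secondMoment f < ⊤) {w G : OffDiag → ℝ} (hw : Measurable w) (hG : Measurable G)
    {C : ℝ} (hGC : ∀ p, |G p| ≤ C)
    (h : ∫⁻ p, ENNReal.ofReal (sigma e p) * ENNReal.ofReal (w p ^ 2) ∂prodOff f < ⊤) :
    Integrable (fun p => sigma e p * G p * w p) (prodOff f) := by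
  refine ⟨(((continuous_sigma e).measurable.mul hG).mul hw).aestronglyMeasurable, ?_⟩
  rw [hasFiniteIntegral_iff_norm]
  refine (lintegral_sigma_mul_le he0 he1 f w hGC).trans_lt ?_
  exact ENNReal.mul_lt_top ENNReal.ofReal_lt_top (ENNReal.add_lt_top.2 ⟨ENNReal.add_lt_top.2
    ⟨ENNReal.one_lt_top, ENNReal.mul_lt_top (by simp) hf⟩, h⟩)

/-- A flux with a density, of finite action, that satisfies the weak formulation. -/
lemma isGCE_of_density {e T : ℝ} (he0 : 0 ≤ e) (he1 : e < 1) (hT : 0 ≤ T)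
    {g : ℝ → ProbabilityMeasure ℝ} (hg : Continuous g) {M : NNReal}
    (hM : ∀ t ∈ Icc 0 T, secondMoment (g t) ≤ M)
    {W : ℝ × OffDiag → ℝ} (hW : Measurable W)
    (hint : ∀ᵐ t ∂(volume.restrict (Icc 0 T)), Integrable (fun p => W (t, p)) (prodOff (g t)))
    (hfin : ∫⁻ t in Icc 0 T, ∫⁻ p, ENNReal.ofReal (sigma e p) * ENNReal.ofReal (W (t, p) ^ 2)
      ∂prodOff (g t) < ⊤)
    (hweak : ∀ φ ∈ testSpace T,
      (∫ t in (0 : ℝ)..T, ∫ v, deriv (fun s => φ s v) t ∂(g t : Measure ℝ))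
        + (∫ t in (0 : ℝ)..T, ∫ p, sigma e p * nlGrad (φ t) p * W (t, p) ∂prodOff (g t)) = 0) :
    IsGCE e T g (fun t => (prodOff (g t)).withDensityᵥ fun p => W (t, p)) ∧
      ∀ᵐ t ∂(volume.restrict (Icc 0 T)),
        action e (g t) ((prodOff (g t)).withDensityᵥ fun p => W (t, p))
          ≤ ∫⁻ p, ENNReal.ofReal (sigma e p) * ENNReal.ofReal (W (t, p) ^ 2) ∂prodOff (g t) := by
  have hWt : ∀ t, Measurable fun p => W (t, p) := fun t => hW.comp measurable_prodMk_left
  have hact : ∀ᵐ t ∂(volume.restrict (Icc 0 T)),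
      action e (g t) ((prodOff (g t)).withDensityᵥ fun p => W (t, p))
        ≤ ∫⁻ p, ENNReal.ofReal (sigma e p) * ENNReal.ofReal (W (t, p) ^ 2) ∂prodOff (g t) := by
    filter_upwards [hint] with t ht using action_withDensity_le e (g t) (hWt t) ht
  have hEm := measurable_gradEnergy e hg hW
  refine ⟨⟨fun h => ?_, fun h => ?_, ?_, fun φ h1 h2 h3 => ?_⟩, hact⟩
  · have := ProbabilityMeasure.continuous_integral_boundedContinuousFunction h.toBCF
    exact (this.comp hg).measurable.aemeasurable
  · have h1 : StronglyMeasurable fun t => ∫ p, h p * W (t, p) ∂pairKernel g hg t := by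
      apply StronglyMeasurable.integral_kernel_prod_right'
        (f := fun x : ℝ × OffDiag => h x.2 * W x)
      exact ((h.continuous.measurable.comp measurable_snd).mul hW).stronglyMeasurable
    refine ⟨_, h1.measurable, ?_⟩
    filter_upwards [hint] with t ht
    refine vintegral_withDensity _ ht ?_ h.continuous.measurable
    exact ht.bdd_mul (c := ‖h.toBCF‖) h.continuous.aestronglyMeasurable
      (ae_of_all _ fun p => h.toBCF.norm_coe_le_norm p)
  · calc _ ≤ ∫⁻ t in Icc 0 T, ((∫⁻ p, ENNReal.ofReal (sigma e p)
            * ENNReal.ofReal (W (t, p) ^ 2) ∂prodOff (g t)) + (1 + 2 * M)) := by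
          apply lintegral_mono_ae
          filter_upwards [hact, ae_restrict_mem measurableSet_Icc] with t ht htT
          have h1 := flux_bound e (g t) ((prodOff (g t)).withDensityᵥ fun p => W (t, p))
            (fun _ => 1) measurable_const one_pos
          simp only [abs_one, ENNReal.ofReal_one, mul_one, one_pow] at h1
          refine h1.trans (add_le_add ?_ ?_)
          · refine (mul_le_of_le_one_left zero_le ?_).trans ht
            rw [ENNReal.ofReal_le_one]; norm_num
          · refine (mul_le_of_le_one_left zero_le ?_).trans ((lintegral_sigma_le he0 _).trans ?_)
            · rw [ENNReal.ofReal_le_one]; norm_num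
            · gcongr; exact hM t htT
      _ < ⊤ := by
          rw [lintegral_add_right _ measurable_const, setLIntegral_const]
          refine ENNReal.add_lt_top.2 ⟨hfin, ENNReal.mul_lt_top ?_ (by simp)⟩
          exact ENNReal.add_lt_top.2 ⟨ENNReal.one_lt_top, ENNReal.mul_lt_top (by simp) (by simp)⟩
  · obtain ⟨C, -, -, hC⟩ := exists_bound_deriv h1 h2
    refine Eq.trans ?_ (hweak φ ⟨h1, h2, h3⟩)
    rw [add_right_inj]
    rw [intervalIntegral.integral_of_le hT, intervalIntegral.integral_of_le hT]
    apply integral_congr_ae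
    have hae := ae_lt_top hEm hfin.ne
    have hle := Measure.restrict_mono (μ := volume) (Ioc_subset_Icc_self (a := (0 : ℝ)) (b := T))
      le_rfl
    have hae2 := hint.and (hae.and (ae_restrict_mem measurableSet_Icc))
    filter_upwards [(Measure.absolutelyContinuous_of_le hle).ae_le hae2] with t ht
    obtain ⟨ht1, ht2, ht3⟩ := ht
    have hG : Measurable fun p => nlGrad (φ t) p :=
      (continuous_nlGrad h1).measurable.comp measurable_prodMk_left
    refine vintegral_withDensity _ ht1 ?_ ((continuous_sigma e).measurable.mul hG)
    exact integrable_sigma_mul he0 he1 ((hM t ht3).trans_lt ENNReal.coe_lt_top) (hWt t) hG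
      (abs_nlGrad_le (hC t)) ht2

lemma poincare_iterated (f : ProbabilityMeasure ℝ) {ζ : ℝ → ℝ} (hζ : Measurable ζ) :
    (∫⁻ v, ∫⁻ w, ENNReal.ofReal |v - w| ∂(f : Measure ℝ) ∂(f : Measure ℝ))
        * (∫⁻ v, ∫⁻ w, ENNReal.ofReal ((ζ w - ζ v) ^ 2) ∂(f : Measure ℝ) ∂(f : Measure ℝ))
      ≤ 10 * ∫⁻ v, ∫⁻ w, ENNReal.ofReal |v - w| * ENNReal.ofReal ((ζ w - ζ v) ^ 2)
        ∂(f : Measure ℝ) ∂(f : Measure ℝ) := by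
  set μ : Measure ℝ := (f : Measure ℝ)
  set q : ℝ → ℝ → ℝ≥0∞ := fun v w => ENNReal.ofReal |v - w| * ENNReal.ofReal ((ζ w - ζ v) ^ 2)
    with hq
  have hq2 : Measurable (Function.uncurry q) := by
    simp only [hq, Function.uncurry_def]; fun_prop
  have hq1 : ∀ v, Measurable (q v) := fun v => hq2.comp measurable_prodMk_left
  set I := ∫⁻ v, ∫⁻ w, ENNReal.ofReal |v - w| ∂μ ∂μ
  have hI : ∀ v, I ≤ 2 * ∫⁻ u, ENNReal.ofReal |v - u| ∂μ := by
    intro v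
    calc I ≤ ∫⁻ a, ∫⁻ b, (ENNReal.ofReal |v - a| + ENNReal.ofReal |v - b|) ∂μ ∂μ := by
          apply lintegral_mono; intro a
          apply lintegral_mono; intro b
          beta_reduce
          rw [← ENNReal.ofReal_add (abs_nonneg _) (abs_nonneg _)]
          apply ENNReal.ofReal_le_ofReal
          rw [abs_sub_comm v a]
          exact abs_sub_le _ _ _
      _ = _ := by
          have : ∀ a, ∫⁻ b, (ENNReal.ofReal |v - a| + ENNReal.ofReal |v - b|) ∂μ
              = ENNReal.ofReal |v - a| + ∫⁻ b, ENNReal.ofReal |v - b| ∂μ := by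
            intro a
            rw [lintegral_add_left measurable_const]; simp [μ]
          simp_rw [this]
          rw [lintegral_add_right _ measurable_const]
          simp only [lintegral_const, measure_univ, mul_one, μ]
          ring
  have hpt : ∀ v w u, ENNReal.ofReal |v - u| * ENNReal.ofReal ((ζ w - ζ v) ^ 2)
      ≤ q v w + (2 * q v u + 2 * q w u) := by
    intro v w u
    simp only [hq]
    have e2 : (2 : ℝ≥0∞) = ENNReal.ofReal 2 := by simp
    rw [e2, ← ENNReal.ofReal_mul (abs_nonneg _), ← ENNReal.ofReal_mul (abs_nonneg _),
      ← ENNReal.ofReal_mul (abs_nonneg _), ← ENNReal.ofReal_mul (abs_nonneg _),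
      ← ENNReal.ofReal_mul (by norm_num), ← ENNReal.ofReal_mul (by norm_num),
      ← ENNReal.ofReal_add (by positivity) (by positivity),
      ← ENNReal.ofReal_add (by positivity) (by positivity)]
    apply ENNReal.ofReal_le_ofReal
    have h1 : (ζ w - ζ v) ^ 2 ≤ 2 * (ζ u - ζ v) ^ 2 + 2 * (ζ u - ζ w) ^ 2 := by
      nlinarith [sq_nonneg ((ζ u - ζ v) + (ζ u - ζ w))]
    have h2 : |v - u| ≤ |v - w| + |w - u| := abs_sub_le _ _ _
    have p1 := abs_nonneg (v - u)
    have p2 := abs_nonneg (v - w)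
    have p3 := abs_nonneg (w - u)
    have s1 := sq_nonneg (ζ w - ζ v)
    have s2 := sq_nonneg (ζ u - ζ v)
    have s3 := sq_nonneg (ζ u - ζ w)
    rcases le_total |v - u| |w - u| with h3 | h3
    · calc |v - u| * (ζ w - ζ v) ^ 2 ≤ |v - u| * (2 * (ζ u - ζ v) ^ 2 + 2 * (ζ u - ζ w) ^ 2) := by
            gcongr
        _ = 2 * (|v - u| * (ζ u - ζ v) ^ 2) + 2 * (|v - u| * (ζ u - ζ w) ^ 2) := by ring
        _ ≤ 2 * (|v - u| * (ζ u - ζ v) ^ 2) + 2 * (|w - u| * (ζ u - ζ w) ^ 2) := by gcongr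
        _ ≤ _ := le_add_of_nonneg_left (by positivity)
    · calc |v - u| * (ζ w - ζ v) ^ 2 ≤ (|v - w| + |w - u|) * (ζ w - ζ v) ^ 2 := by gcongr
        _ = |v - w| * (ζ w - ζ v) ^ 2 + |w - u| * (ζ w - ζ v) ^ 2 := by ring
        _ ≤ |v - w| * (ζ w - ζ v) ^ 2
            + |w - u| * (2 * (ζ u - ζ v) ^ 2 + 2 * (ζ u - ζ w) ^ 2) := by gcongr
        _ = |v - w| * (ζ w - ζ v) ^ 2
            + (2 * (|w - u| * (ζ u - ζ v) ^ 2) + 2 * (|w - u| * (ζ u - ζ w) ^ 2)) := by ring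
        _ ≤ _ := by gcongr
  set Q := ∫⁻ v, ∫⁻ w, q v w ∂μ ∂μ
  have step : ∀ v w, I * ENNReal.ofReal ((ζ w - ζ v) ^ 2)
      ≤ 2 * (q v w + (2 * ∫⁻ u, q v u ∂μ + 2 * ∫⁻ u, q w u ∂μ)) := by
    intro v w
    calc I * ENNReal.ofReal ((ζ w - ζ v) ^ 2)
        ≤ (2 * ∫⁻ u, ENNReal.ofReal |v - u| ∂μ) * ENNReal.ofReal ((ζ w - ζ v) ^ 2) := by
          gcongr; exact hI v
      _ = 2 * ∫⁻ u, ENNReal.ofReal |v - u| * ENNReal.ofReal ((ζ w - ζ v) ^ 2) ∂μ := by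
          rw [lintegral_mul_const' _ _ ENNReal.ofReal_ne_top, mul_assoc]
      _ ≤ 2 * ∫⁻ u, (q v w + (2 * q v u + 2 * q w u)) ∂μ := by
          gcongr with u; exact hpt v w u
      _ = _ := by
          rw [lintegral_add_left measurable_const, lintegral_add_left ((hq1 v).const_mul 2),
            lintegral_const_mul _ (hq1 v), lintegral_const_mul _ (hq1 w)]
          simp [μ]
  have hJ : Measurable fun v => ∫⁻ u, q v u ∂μ := hq2.lintegral_prod_right'
  calc I * ∫⁻ v, ∫⁻ w, ENNReal.ofReal ((ζ w - ζ v) ^ 2) ∂μ ∂μ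
      = ∫⁻ v, ∫⁻ w, I * ENNReal.ofReal ((ζ w - ζ v) ^ 2) ∂μ ∂μ := by
        have hm : Measurable (Function.uncurry fun v w => ENNReal.ofReal ((ζ w - ζ v) ^ 2)) := by
          simp only [Function.uncurry_def]; fun_prop
        have hm' : Measurable fun v => ∫⁻ w, ENNReal.ofReal ((ζ w - ζ v) ^ 2) ∂μ :=
          hm.lintegral_prod_right'
        rw [← lintegral_const_mul _ hm']
        congr 1; ext v
        have hv : Measurable fun w => ENNReal.ofReal ((ζ w - ζ v) ^ 2) :=
          hm.comp measurable_prodMk_left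
        rw [← lintegral_const_mul _ hv]
    _ ≤ ∫⁻ v, ∫⁻ w, 2 * (q v w + (2 * ∫⁻ u, q v u ∂μ + 2 * ∫⁻ u, q w u ∂μ)) ∂μ ∂μ := by
        exact lintegral_mono fun v => lintegral_mono fun w => step v w
    _ = ∫⁻ v, 2 * ((∫⁻ w, q v w ∂μ) + (2 * (∫⁻ u, q v u ∂μ) + 2 * Q)) ∂μ := by
        congr 1; ext v
        rw [lintegral_const_mul' _ _ (by simp), lintegral_add_left (hq1 v),
          lintegral_add_left measurable_const,
          lintegral_const_mul _ hJ]
        simp [μ, Q]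
    _ = 10 * Q := by
        rw [lintegral_const_mul' _ _ (by simp), lintegral_add_left hJ,
          lintegral_add_left (hJ.const_mul 2), lintegral_const_mul _ hJ]
        simp only [lintegral_const, measure_univ, mul_one, μ]
        change 2 * (Q + (2 * Q + 2 * Q)) = 10 * Q
        ring

/-- A Poincaré inequality: the weight `σ` can be dropped for functions of gradient type. -/
lemma poincare {e : ℝ} (he1 : e < 1) {f : ProbabilityMeasure ℝ} (hf : secondMoment f < ⊤) :
    ∃ C : ℝ≥0∞, C ≠ ⊤ ∧ ∀ ζ : ℝ → ℝ, Measurable ζ →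
      ∫⁻ p : OffDiag, ENNReal.ofReal ((ζ p.1.2 - ζ p.1.1) ^ 2) ∂prodOff f
        ≤ C * ∫⁻ p : OffDiag, ENNReal.ofReal (sigma e p)
          * ENNReal.ofReal ((ζ p.1.2 - ζ p.1.1) ^ 2) ∂prodOff f := by
  set μ : Measure ℝ := (f : Measure ℝ)
  set I := ∫⁻ v, ∫⁻ w, ENNReal.ofReal |v - w| ∂μ ∂μ with hI
  set c : ℝ := (1 - e) / 4
  have hc : 0 < c := by simp only [c]; linarith
  have hIeq : I = ∫⁻ p : OffDiag, ENNReal.ofReal |p.1.1 - p.1.2| ∂prodOff f := by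
    rw [lintegral_prodOff f (fun x => ENNReal.ofReal |x.1 - x.2|) (by simp), lintegral_prod]
    fun_prop
  have hItop : I < ⊤ := by
    rw [hIeq]
    have h1 := lintegral_sigma_le (le_refl (0 : ℝ)) f
    have h2 : ∫⁻ p : OffDiag, ENNReal.ofReal |p.1.1 - p.1.2| ∂prodOff f
        = ENNReal.ofReal 4 * ∫⁻ p, ENNReal.ofReal (sigma 0 p) ∂prodOff f := by
      rw [← lintegral_const_mul' _ _ ENNReal.ofReal_ne_top]
      congr 1; ext p
      rw [← ENNReal.ofReal_mul (by norm_num), sigma]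
      congr 1; ring
    rw [h2]
    refine ENNReal.mul_lt_top ENNReal.ofReal_lt_top (h1.trans_lt ?_)
    exact ENNReal.add_lt_top.2 ⟨ENNReal.one_lt_top, ENNReal.mul_lt_top (by simp) hf⟩
  rcases eq_or_ne I 0 with h0 | h0
  · refine ⟨0, by simp, fun ζ hζ => ?_⟩
    have hz : prodOff f = 0 := by
      rw [hIeq, lintegral_eq_zero_iff (by fun_prop)] at h0
      rw [← ae_eq_bot, ← eventually_false_iff_eq_bot]
      filter_upwards [h0] with p hp
      have : (0 : ℝ) < |p.1.1 - p.1.2| := abs_pos.2 (sub_ne_zero.2 p.2)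
      simp only [Pi.zero_apply, ENNReal.ofReal_eq_zero] at hp
      linarith
    simp [hz]
  · refine ⟨10 * (I⁻¹ * (ENNReal.ofReal c)⁻¹), ?_, fun ζ hζ => ?_⟩
    · exact ENNReal.mul_ne_top (by simp) (ENNReal.mul_ne_top (ENNReal.inv_ne_top.2 h0)
        (ENNReal.inv_ne_top.2 (by simpa using hc)))
    have hP := poincare_iterated f hζ
    set Q := ∫⁻ v, ∫⁻ w, ENNReal.ofReal |v - w| * ENNReal.ofReal ((ζ w - ζ v) ^ 2) ∂μ ∂μ
    have hL : ∫⁻ p : OffDiag, ENNReal.ofReal ((ζ p.1.2 - ζ p.1.1) ^ 2) ∂prodOff f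
        = ∫⁻ v, ∫⁻ w, ENNReal.ofReal ((ζ w - ζ v) ^ 2) ∂μ ∂μ := by
      rw [lintegral_prodOff f (fun x => ENNReal.ofReal ((ζ x.2 - ζ x.1) ^ 2)) (by simp),
        lintegral_prod]
      fun_prop
    have hS : ∫⁻ p : OffDiag, ENNReal.ofReal (sigma e p)
          * ENNReal.ofReal ((ζ p.1.2 - ζ p.1.1) ^ 2) ∂prodOff f = ENNReal.ofReal c * Q := by
      have h3 : Q = ∫⁻ p : OffDiag, ENNReal.ofReal |p.1.1 - p.1.2|
          * ENNReal.ofReal ((ζ p.1.2 - ζ p.1.1) ^ 2) ∂prodOff f := by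
        rw [lintegral_prodOff f (fun x => ENNReal.ofReal |x.1 - x.2|
          * ENNReal.ofReal ((ζ x.2 - ζ x.1) ^ 2)) (by simp), lintegral_prod]
        fun_prop
      rw [h3, ← lintegral_const_mul' _ _ ENNReal.ofReal_ne_top]
      congr 1; ext p
      rw [sigma, ENNReal.ofReal_mul hc.le, mul_assoc]
    rw [hL, hS]
    have hcc : (ENNReal.ofReal c)⁻¹ * ENNReal.ofReal c = 1 :=
      ENNReal.inv_mul_cancel (by simpa using hc) ENNReal.ofReal_ne_top
    calc _ = I⁻¹ * (I * ∫⁻ v, ∫⁻ w, ENNReal.ofReal ((ζ w - ζ v) ^ 2) ∂μ ∂μ) := by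
          rw [← mul_assoc, ENNReal.inv_mul_cancel h0 hItop.ne, one_mul]
      _ ≤ I⁻¹ * (10 * Q) := by gcongr
      _ = 10 * (I⁻¹ * ((ENNReal.ofReal c)⁻¹ * ENNReal.ofReal c)) * Q := by rw [hcc]; ring
      _ = _ := by ring

/-- A functional dominated by the norm of a linear image is represented by a vector in the closure
of the range. -/
lemma exists_riesz {V H : Type*} [AddCommGroup V] [Module ℝ V] [NormedAddCommGroup H]
    [InnerProductSpace ℝ H] [CompleteSpace H] (Γ : V →ₗ[ℝ] H) (l : V →ₗ[ℝ] ℝ) {C : ℝ}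
    (hC : 0 ≤ C) (h : ∀ x, |l x| ≤ C * ‖Γ x‖) :
    ∃ w ∈ closure (range Γ), ‖w‖ ≤ C ∧ ∀ x, l x = inner ℝ w (Γ x) := by
  obtain ⟨s, hs⟩ := Γ.rangeRestrict.exists_rightInverse_of_surjective (by simp)
  have hs' : ∀ y : LinearMap.range Γ, Γ (s y) = y := fun y =>
    congrArg Subtype.val (LinearMap.congr_fun hs y)
  let l0 : LinearMap.range Γ →ₗ[ℝ] ℝ := l ∘ₗ s
  have hl0 : ∀ y, ‖l0 y‖ ≤ C * ‖y‖ := by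
    intro y
    have := h (s y)
    rw [hs' y] at this
    exact this
  obtain ⟨G, hG, hGn⟩ := _root_.exists_extension_norm_eq (LinearMap.range Γ) (l0.mkContinuous C hl0)
  have hlG : ∀ x, l x = G (Γ x) := by
    intro x
    have h1 : G (Γ x) = l (s ⟨Γ x, x, rfl⟩) := hG ⟨Γ x, x, rfl⟩
    have h2 := h (x - s ⟨Γ x, x, rfl⟩)
    rw [map_sub Γ, hs' ⟨Γ x, x, rfl⟩] at h2
    simp only [sub_self, norm_zero, mul_zero, map_sub] at h2
    rw [h1]
    exact sub_eq_zero.1 (abs_eq_zero.1 (le_antisymm h2 (abs_nonneg _)))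
  let w0 : H := (InnerProductSpace.toDual ℝ H).symm G
  let K : Submodule ℝ H := (LinearMap.range Γ).topologicalClosure
  have : CompleteSpace K :=
    (Submodule.isClosed_topologicalClosure (LinearMap.range Γ)).completeSpace_coe
  refine ⟨K.starProjection w0, ?_, ?_, fun x => ?_⟩
  · have h1 := K.starProjection_apply_mem w0
    have h2 : K.starProjection w0 ∈ (K : Set H) := h1
    rw [Submodule.topologicalClosure_coe, LinearMap.coe_range] at h2
    exact h2
  · refine (K.norm_starProjection_apply_le w0).trans ?_
    rw [LinearIsometryEquiv.norm_map, hGn]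
    exact LinearMap.mkContinuous_norm_le _ hC _
  · have hx : Γ x ∈ K := Submodule.le_topologicalClosure _ ⟨x, rfl⟩
    rw [Submodule.inner_starProjection_left_eq_right, Submodule.starProjection_eq_self_iff.2 hx,
      InnerProductSpace.toDual_symm_apply, hlG]

/-- The measure `σ d(g_t ⊗ g_t) dt` on `[0, T] × ℝ²`. -/
noncomputable def fluxMeasure (e T : ℝ) (g : ℝ → ProbabilityMeasure ℝ) (hg : Continuous g) :
    Measure (ℝ × OffDiag) :=
  ((volume.restrict (Icc 0 T)).compProd (pairKernel g hg)).withDensity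
    fun x => ENNReal.ofReal (sigma e x.2)

section FluxMeasure

variable {e T : ℝ} {g : ℝ → ProbabilityMeasure ℝ} (hg : Continuous g)

lemma measurable_sigma_snd (e : ℝ) :
    Measurable fun x : ℝ × OffDiag => ENNReal.ofReal (sigma e x.2) :=
  ((continuous_sigma e).measurable.comp measurable_snd).ennreal_ofReal

lemma lintegral_fluxMeasure {F : ℝ × OffDiag → ℝ≥0∞} (hF : Measurable F) :
    ∫⁻ x, F x ∂fluxMeasure e T g hg
      = ∫⁻ t in Icc 0 T, ∫⁻ p, ENNReal.ofReal (sigma e p) * F (t, p) ∂prodOff (g t) := by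
  have hm : Measurable fun x : ℝ × OffDiag => ENNReal.ofReal (sigma e x.2) * F x :=
    (measurable_sigma_snd e).mul hF
  rw [fluxMeasure, lintegral_withDensity_mul _ (measurable_sigma_snd e) hF,
    Measure.lintegral_compProd hm]
  rfl

lemma isFiniteMeasure_fluxMeasure (he0 : 0 ≤ e) {M : NNReal}
    (hM : ∀ t ∈ Icc 0 T, secondMoment (g t) ≤ M) : IsFiniteMeasure (fluxMeasure e T g hg) := by
  refine ⟨?_⟩
  have h := lintegral_fluxMeasure (e := e) (T := T) hg (measurable_const (a := (1 : ℝ≥0∞)))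
  rw [lintegral_one] at h
  rw [h]
  simp only [mul_one]
  calc _ ≤ ∫⁻ t in Icc 0 T, (1 + 2 * (M : ℝ≥0∞)) := by
        apply setLIntegral_mono measurable_const
        intro t ht
        refine (lintegral_sigma_le he0 _).trans ?_
        gcongr
        exact hM t ht
    _ < ⊤ := by
        rw [setLIntegral_const]
        refine ENNReal.mul_lt_top ?_ (by simp)
        exact ENNReal.add_lt_top.2 ⟨ENNReal.one_lt_top, ENNReal.mul_lt_top (by simp) (by simp)⟩

lemma integral_fluxMeasure (he1 : e < 1) {F : ℝ × OffDiag → ℝ}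
    (hF : Integrable F (fluxMeasure e T g hg)) :
    ∫ x, F x ∂fluxMeasure e T g hg
      = ∫ t in Icc 0 T, ∫ p, sigma e p * F (t, p) ∂prodOff (g t) := by
  have h0 : ∀ p : OffDiag, (ENNReal.ofReal (sigma e p)).toReal = sigma e p :=
    fun p => ENNReal.toReal_ofReal (sigma_pos he1 p).le
  have hF' := (integrable_withDensity_iff_integrable_smul' (measurable_sigma_snd e)
    (ae_of_all _ fun _ => ENNReal.ofReal_lt_top)).1 hF
  rw [fluxMeasure, integral_withDensity_eq_integral_toReal_smul (measurable_sigma_snd e)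
    (ae_of_all _ fun _ => ENNReal.ofReal_lt_top), Measure.integral_compProd hF']
  simp only [h0, smul_eq_mul]
  rfl

lemma ae_ae_of_ae_fluxMeasure (he1 : e < 1) {P : ℝ × OffDiag → Prop}
    (h : ∀ᵐ x ∂fluxMeasure e T g hg, P x) :
    ∀ᵐ t ∂(volume.restrict (Icc 0 T)), ∀ᵐ p ∂prodOff (g t), P (t, p) := by
  have h1 : (volume.restrict (Icc 0 T)).compProd (pairKernel g hg) ≪ fluxMeasure e T g hg :=
    withDensity_absolutelyContinuous' (measurable_sigma_snd e).aemeasurable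
      (ae_of_all _ fun x => by simpa using sigma_pos he1 x.2)
  have h2 : ∀ᵐ x ∂(volume.restrict (Icc 0 T)).compProd (pairKernel g hg), P x := h1 h
  have h3 := Measure.ae_ae_of_ae_compProd (κ := pairKernel g hg) h2
  exact h3

end FluxMeasure

lemma nlGrad_add {φ ψ : ℝ → ℝ} (h1 : Differentiable ℝ φ) (h2 : Differentiable ℝ ψ) (p : OffDiag) :
    nlGrad (φ + ψ) p = nlGrad φ p + nlGrad ψ p := by
  simp only [nlGrad, deriv_add (h1 _) (h2 _)]
  ring

lemma nlGrad_smul {φ : ℝ → ℝ} (c : ℝ) (p : OffDiag) :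
    nlGrad (c • φ) p = c * nlGrad φ p := by
  simp only [nlGrad, deriv_const_smul_field, smul_eq_mul]
  ring

lemma memLp_nlGrad {e T : ℝ} {g : ℝ → ProbabilityMeasure ℝ} (hg : Continuous g)
    [IsFiniteMeasure (fluxMeasure e T g hg)] (φ : testSpace T) :
    MemLp (fun x : ℝ × OffDiag => nlGrad (φ.1 x.1) x.2) 2 (fluxMeasure e T g hg) := by
  obtain ⟨C, -, -, hC⟩ := exists_bound_deriv φ.2.1 φ.2.2.1
  exact MemLp.of_bound (continuous_nlGrad φ.2.1).aestronglyMeasurable (2 * C)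
    (ae_of_all _ fun x => abs_nlGrad_le (hC x.1) x.2)

/-- The gradient of test functions, as an element of the weighted `L²` space. -/
noncomputable def gradLp {e T : ℝ} {g : ℝ → ProbabilityMeasure ℝ} (hg : Continuous g)
    [IsFiniteMeasure (fluxMeasure e T g hg)] :
    testSpace T →ₗ[ℝ] Lp ℝ 2 (fluxMeasure e T g hg) where
  toFun φ := (memLp_nlGrad hg φ).toLp
  map_add' φ ψ := by
    rw [← MemLp.toLp_add]
    congr 1
    funext x
    exact nlGrad_add (fun v => (hasDerivAt_space φ.2.1 x.1 v).differentiableAt)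
      (fun v => (hasDerivAt_space ψ.2.1 x.1 v).differentiableAt) x.2
  map_smul' c φ := by
    rw [RingHom.id_apply, ← MemLp.toLp_const_smul]
    congr 1
    funext x
    exact nlGrad_smul c x.2

lemma coeFn_gradLp {e T : ℝ} {g : ℝ → ProbabilityMeasure ℝ} (hg : Continuous g)
    [IsFiniteMeasure (fluxMeasure e T g hg)] (φ : testSpace T) :
    gradLp (e := e) hg φ =ᵐ[fluxMeasure e T g hg] fun x => nlGrad (φ.1 x.1) x.2 :=
  MemLp.coeFn_toLp (memLp_nlGrad hg φ)

lemma measurable_integral_curve {g : ℝ → ProbabilityMeasure ℝ} (hg : Continuous g)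
    {F : ℝ × ℝ → ℝ} (hF : Measurable F) :
    StronglyMeasurable fun t => ∫ v, F (t, v) ∂(g t : Measure ℝ) :=
  hF.stronglyMeasurable.integral_kernel_prod_right' (κ := curveKernel g hg)

lemma intervalIntegrable_time {T : ℝ} {g : ℝ → ProbabilityMeasure ℝ} (hg : Continuous g)
    {φ : ℝ → ℝ → ℝ} (hφ : φ ∈ testSpace T) (a b : ℝ) :
    IntervalIntegrable (fun t => ∫ v, deriv (fun s => φ s v) t ∂(g t : Measure ℝ)) volume a b := by
  obtain ⟨C, hC0, hC, -⟩ := exists_bound_deriv hφ.1 hφ.2.1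
  have hm := measurable_integral_curve hg (continuous_deriv_time hφ.1).measurable
  refine (intervalIntegrable_const (c := C)).mono_fun hm.aestronglyMeasurable
    (ae_of_all _ fun t => ?_)
  have := norm_integral_le_of_norm_le_const (μ := (g t : Measure ℝ))
    (f := fun v => deriv (fun s => φ s v) t) (C := C) (ae_of_all _ fun v => hC t v)
  simpa [abs_of_nonneg hC0] using this

/-- The functional `φ ↦ ∫₀ᵀ ∫ ∂ₜφ dg_t dt`. -/
noncomputable def timeFunctional {T : ℝ} {g : ℝ → ProbabilityMeasure ℝ} (hg : Continuous g) :
    testSpace T →ₗ[ℝ] ℝ where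
  toFun φ := ∫ t in (0 : ℝ)..T, ∫ v, deriv (fun s => φ.1 s v) t ∂(g t : Measure ℝ)
  map_add' φ ψ := by
    rw [← intervalIntegral.integral_add (intervalIntegrable_time hg φ.2 0 T)
      (intervalIntegrable_time hg ψ.2 0 T)]
    congr 1
    funext t
    have hi : ∀ φ : testSpace T,
        Integrable (fun v => deriv (fun s => φ.1 s v) t) (g t : Measure ℝ) := by
      intro φ
      obtain ⟨C, -, hC, -⟩ := exists_bound_deriv φ.2.1 φ.2.2.1
      exact Integrable.of_bound ((continuous_deriv_time φ.2.1).comp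
        (Continuous.prodMk_right t)).aestronglyMeasurable C (ae_of_all _ fun v => hC t v)
    rw [← integral_add (hi φ) (hi ψ)]
    congr 1
    funext v
    exact deriv_add (hasDerivAt_time φ.2.1 t v).differentiableAt
      (hasDerivAt_time ψ.2.1 t v).differentiableAt
  map_smul' c φ := by
    rw [RingHom.id_apply, smul_eq_mul, ← intervalIntegral.integral_const_mul]
    congr 1
    funext t
    rw [← integral_const_mul]
    congr 1
    funext v
    change deriv (fun s => c * φ.1 s v) t = _
    exact deriv_const_mul_field c

lemma enorm_sq_Lp {X : Type*} [MeasurableSpace X] {μ : Measure X} (w : Lp ℝ 2 μ) :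
    ENNReal.ofReal (‖w‖ ^ 2) = ∫⁻ x, ENNReal.ofReal (w x ^ 2) ∂μ := by
  rw [ENNReal.ofReal_pow (norm_nonneg _), ofReal_norm, Lp.enorm_def,
    eLpNorm_eq_lintegral_rpow_enorm_toReal (by simp) (by simp)]
  simp only [ENNReal.toReal_ofNat, ENNReal.rpow_two, one_div]
  rw [← ENNReal.rpow_two, ← ENNReal.rpow_mul]
  simp only [isUnit_iff_ne_zero, ne_eq, OfNat.ofNat_ne_zero, not_false_eq_true,
    IsUnit.inv_mul_cancel, ENNReal.rpow_one]
  congr 1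
  ext x
  rw [← sq_abs, ENNReal.ofReal_pow (abs_nonneg _), ← Real.norm_eq_abs, ofReal_norm]

lemma abs_le_sqrt_mul_of_forall {x a b : ℝ} (ha : 0 ≤ a) (hb : 0 ≤ b)
    (h : ∀ ε > 0, |x| ≤ ε / 2 * a + 1 / (2 * ε) * b ^ 2) : |x| ≤ √a * b := by
  have h1 : ∀ ε : ℝ, 0 ≤ a * (ε * ε) + (-2 * |x|) * ε + b ^ 2 := by
    intro ε
    rcases le_or_gt ε 0 with h0 | h0
    · have := mul_nonneg ha (mul_self_nonneg ε)
      have h2 := mul_nonneg (abs_nonneg x) (neg_nonneg.2 h0)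
      nlinarith [sq_nonneg b]
    · have h2 := mul_le_mul_of_nonneg_left (h ε h0) (by positivity : 0 ≤ 2 * ε)
      have h3 : 2 * ε * (ε / 2 * a + 1 / (2 * ε) * b ^ 2) = a * (ε * ε) + b ^ 2 := by
        field_simp
      linarith
  have h2 := discrim_le_zero h1
  rw [discrim] at h2
  have h3 : |x| ^ 2 ≤ a * b ^ 2 := by nlinarith
  have h4 := Real.abs_le_sqrt h3
  rwa [abs_abs, Real.sqrt_mul ha, Real.sqrt_sq hb] at h4

/-- A curve along which the time functional is dominated by the gradient energy is driven by a
flux with a density. -/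
lemma exists_flux {e T : ℝ} (he0 : 0 ≤ e) (he1 : e < 1) (hT : 0 ≤ T)
    {g : ℝ → ProbabilityMeasure ℝ} (hg : Continuous g) {M : NNReal}
    (hM : ∀ t ∈ Icc 0 T, secondMoment (g t) ≤ M) {a : NNReal}
    (h : ∀ φ ∈ testSpace T, ∀ ε : ℝ, 0 < ε →
      ‖∫ t in (0 : ℝ)..T, ∫ v, deriv (fun s => φ s v) t ∂(g t : Measure ℝ)‖ₑ
        ≤ ENNReal.ofReal (ε / 2) * a
          + ENNReal.ofReal (1 / (2 * ε)) * ∫⁻ t in Icc 0 T, ∫⁻ p, ENNReal.ofReal (sigma e p)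
            * ENNReal.ofReal (nlGrad (φ t) p ^ 2) ∂prodOff (g t)) :
    ∃ W : ℝ × OffDiag → ℝ, Measurable W ∧
      (∀ᵐ t ∂(volume.restrict (Icc 0 T)), Integrable (fun p => W (t, p)) (prodOff (g t))) ∧
      ∫⁻ t in Icc 0 T, ∫⁻ p, ENNReal.ofReal (sigma e p) * ENNReal.ofReal (W (t, p) ^ 2)
        ∂prodOff (g t) ≤ a ∧
      ∀ φ ∈ testSpace T,
        (∫ t in (0 : ℝ)..T, ∫ v, deriv (fun s => φ s v) t ∂(g t : Measure ℝ))
          + (∫ t in (0 : ℝ)..T, ∫ p, sigma e p * nlGrad (φ t) p * W (t, p) ∂prodOff (g t))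
            = 0 := by
  have hfin := isFiniteMeasure_fluxMeasure (e := e) (T := T) hg he0 hM
  have hgrad : ∀ φ : testSpace T, ENNReal.ofReal (‖gradLp (e := e) hg φ‖ ^ 2)
      = ∫⁻ t in Icc 0 T, ∫⁻ p, ENNReal.ofReal (sigma e p)
            * ENNReal.ofReal (nlGrad (φ.1 t) p ^ 2) ∂prodOff (g t) := by
    intro φ
    have hm : Measurable fun x : ℝ × OffDiag => ENNReal.ofReal (nlGrad (φ.1 x.1) x.2 ^ 2) :=
      ((continuous_nlGrad φ.2.1).measurable.pow_const 2).ennreal_ofReal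
    rw [← lintegral_fluxMeasure hg hm, enorm_sq_Lp]
    apply lintegral_congr_ae
    filter_upwards [coeFn_gradLp (e := e) hg φ] with x hx
    rw [hx]
  have hdom : ∀ φ : testSpace T, |timeFunctional hg φ| ≤ √a * ‖gradLp (e := e) hg φ‖ := by
    intro φ
    apply abs_le_sqrt_mul_of_forall a.2 (norm_nonneg _)
    intro ε hε
    have h1 := h φ.1 φ.2 ε hε
    rw [← hgrad φ, ← ENNReal.ofReal_coe_nnreal, ← ENNReal.ofReal_mul (by positivity),
      ← ENNReal.ofReal_mul (by positivity), ← ENNReal.ofReal_add (by positivity) (by positivity),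
      ← ofReal_norm, ENNReal.ofReal_le_ofReal_iff (by positivity)] at h1
    exact h1
  obtain ⟨w, hw, hwn, hwl⟩ := exists_riesz (gradLp (e := e) hg) (timeFunctional hg)
    (Real.sqrt_nonneg _) hdom
  have hwm : Measurable (w : ℝ × OffDiag → ℝ) := (Lp.stronglyMeasurable w).measurable
  have hw2 : ∫⁻ t in Icc 0 T, ∫⁻ p, ENNReal.ofReal (sigma e p) * ENNReal.ofReal (w (t, p) ^ 2)
        ∂prodOff (g t) = ENNReal.ofReal (‖w‖ ^ 2) := by
    rw [enorm_sq_Lp]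
    exact (lintegral_fluxMeasure hg (hwm.pow_const 2).ennreal_ofReal).symm
  refine ⟨fun x => -w x, hwm.neg, ?_, ?_, fun φ hφ => ?_⟩
  · obtain ⟨y, hy, hyw⟩ := mem_closure_iff_seq_limit.1 hw
    choose x hx using hy
    obtain ⟨ns, hns, hae⟩ := (tendstoInMeasure_of_tendsto_Lp hyw).exists_seq_tendsto_ae
    have hae2 : ∀ᵐ z ∂fluxMeasure e T g hg,
        Tendsto (fun i => nlGrad ((x (ns i)).1 z.1) z.2) atTop (𝓝 (w z)) := by
      have h1 : ∀ᵐ z ∂fluxMeasure e T g hg, ∀ i, y (ns i) z = nlGrad ((x (ns i)).1 z.1) z.2 := by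
        rw [ae_all_iff]
        intro i
        rw [← hx]
        exact coeFn_gradLp hg _
      filter_upwards [hae, h1] with z hz1 hz2
      exact hz1.congr hz2
    set b : ℕ → ℝ → ℝ≥0∞ := fun i t => ∫⁻ p, ENNReal.ofReal (sigma e p)
            * ENNReal.ofReal (nlGrad ((x (ns i)).1 t) p ^ 2) ∂prodOff (g t)
    have hbm : ∀ i, Measurable (b i) := fun i =>
      measurable_gradEnergy e hg (G := fun z : ℝ × OffDiag => nlGrad ((x (ns i)).1 z.1) z.2)
        (continuous_nlGrad (x (ns i)).2.1).measurable
    have hb : ∫⁻ t in Icc 0 T, liminf (fun i => b i t) atTop < ⊤ := by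
      refine (lintegral_liminf_le hbm).trans_lt ?_
      have h1 : Tendsto (fun i => ∫⁻ t in Icc 0 T, b i t) atTop (𝓝 (ENNReal.ofReal (‖w‖ ^ 2))) := by
        have h2 : Tendsto (fun i => ENNReal.ofReal (‖y (ns i)‖ ^ 2)) atTop
            (𝓝 (ENNReal.ofReal (‖w‖ ^ 2))) :=
          ENNReal.tendsto_ofReal (((hyw.comp hns.tendsto_atTop).norm).pow 2)
        refine h2.congr fun i => ?_
        rw [← hx, hgrad]
      rw [h1.liminf_eq]
      exact ENNReal.ofReal_lt_top
    have hb2 := ae_lt_top (Measurable.liminf hbm) hb.ne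
    filter_upwards [ae_ae_of_ae_fluxMeasure hg he1 hae2, hb2, ae_restrict_mem measurableSet_Icc]
      with t h1 h2 h3
    have hwt : Measurable fun p => w (t, p) := hwm.comp measurable_prodMk_left
    refine (integrable_of_lintegral_sq hwt ?_).neg
    obtain ⟨C, hC, hP⟩ := poincare he1 ((hM t h3).trans_lt ENNReal.coe_lt_top)
    have hGm : ∀ i, Measurable fun p : OffDiag => nlGrad ((x (ns i)).1 t) p := fun i =>
      (continuous_nlGrad (x (ns i)).2.1).measurable.comp measurable_prodMk_left
    calc ∫⁻ p, ENNReal.ofReal (w (t, p) ^ 2) ∂prodOff (g t)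
        = ∫⁻ p, liminf (fun i => ENNReal.ofReal (nlGrad ((x (ns i)).1 t) p ^ 2)) atTop
            ∂prodOff (g t) := by
          apply lintegral_congr_ae
          filter_upwards [h1] with p hp
          exact (ENNReal.tendsto_ofReal (hp.pow 2)).liminf_eq.symm
      _ ≤ liminf (fun i => ∫⁻ p, ENNReal.ofReal (nlGrad ((x (ns i)).1 t) p ^ 2)
            ∂prodOff (g t)) atTop :=
          lintegral_liminf_le fun i => ((hGm i).pow_const 2).ennreal_ofReal
      _ ≤ liminf (fun i => C * b i t) atTop := by
          refine liminf_le_liminf (Eventually.of_forall fun i => ?_)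
          exact hP _ (measurable_deriv _)
      _ = C * liminf (fun i => b i t) atTop := ENNReal.liminf_const_mul_of_ne_top hC
      _ < ⊤ := ENNReal.mul_lt_top hC.lt_top h2
  · simp only [neg_sq]
    rw [hw2, ← ENNReal.ofReal_coe_nnreal]
    apply ENNReal.ofReal_le_ofReal
    calc ‖w‖ ^ 2 ≤ √a ^ 2 := pow_le_pow_left₀ (norm_nonneg _) hwn 2
      _ = a := Real.sq_sqrt a.2
  · have h1 : timeFunctional hg ⟨φ, hφ⟩ = inner ℝ w (gradLp (e := e) hg ⟨φ, hφ⟩) := hwl _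
    change timeFunctional hg ⟨φ, hφ⟩ + _ = 0
    have hint := L2.integrable_inner (𝕜 := ℝ) w (gradLp (e := e) hg ⟨φ, hφ⟩)
    have hcongr : (fun x => inner ℝ (w x) (gradLp (e := e) hg ⟨φ, hφ⟩ x))
        =ᵐ[fluxMeasure e T g hg] fun x => nlGrad (φ x.1) x.2 * w x := by
      filter_upwards [coeFn_gradLp (e := e) hg ⟨φ, hφ⟩] with x hx
      rw [hx, real_inner_comm]
      simp [mul_comm]
    rw [h1, L2.inner_def, integral_congr_ae hcongr,
      integral_fluxMeasure hg he1 (hint.congr hcongr), intervalIntegral.integral_of_le hT,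
      ← integral_Icc_eq_integral_Ioc]
    simp only [mul_neg, integral_neg, mul_assoc]
    exact add_neg_cancel _

/-- The time change with speed proportional to `m` that maps `[s, t]` onto `[0, 1]`. -/
noncomputable def clock (m : ℝ → ℝ) (s t r : ℝ) : ℝ :=
  (∫ x in s..r, m x) / ∫ x in s..t, m x

section Clock

variable {m : ℝ → ℝ} {s t : ℝ}

lemma sub_le_integral (hm1 : ∀ r, 1 ≤ m r) (hmi : ∀ a b, IntervalIntegrable m volume a b)
    {a b : ℝ} (hab : a ≤ b) : b - a ≤ ∫ x in a..b, m x := by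
  have h := intervalIntegral.integral_mono_on hab intervalIntegrable_const (hmi a b)
    (fun x _ => hm1 x)
  simpa using h

lemma integral_pos_of_one_le (hm1 : ∀ r, 1 ≤ m r)
    (hmi : ∀ a b, IntervalIntegrable m volume a b) (hst : s < t) : 0 < ∫ x in s..t, m x :=
  (sub_pos.2 hst).trans_le (sub_le_integral hm1 hmi hst.le)

lemma clock_left : clock m s t s = 0 := by simp [clock]

lemma clock_right (hm1 : ∀ r, 1 ≤ m r) (hmi : ∀ a b, IntervalIntegrable m volume a b)
    (hst : s < t) : clock m s t t = 1 :=
  div_self (integral_pos_of_one_le hm1 hmi hst).ne'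

lemma clock_sub (hmi : ∀ a b, IntervalIntegrable m volume a b) (a b : ℝ) :
    clock m s t b - clock m s t a = (∫ x in a..b, m x) / ∫ x in s..t, m x := by
  rw [clock, clock, ← sub_div, intervalIntegral.integral_interval_sub_left (hmi _ _) (hmi _ _)]

lemma sub_div_le_clock_sub (hm1 : ∀ r, 1 ≤ m r) (hmi : ∀ a b, IntervalIntegrable m volume a b)
    (hst : s < t) {a b : ℝ} (hab : a ≤ b) :
    (b - a) / (∫ x in s..t, m x) ≤ clock m s t b - clock m s t a := by
  rw [clock_sub hmi]
  have := integral_pos_of_one_le hm1 hmi hst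
  gcongr
  exact sub_le_integral hm1 hmi hab

lemma strictMono_clock (hm1 : ∀ r, 1 ≤ m r) (hmi : ∀ a b, IntervalIntegrable m volume a b)
    (hst : s < t) : StrictMono (clock m s t) := by
  intro a b hab
  have h1 := sub_div_le_clock_sub hm1 hmi hst hab.le
  have h2 := div_pos (sub_pos.2 hab) (integral_pos_of_one_le hm1 hmi hst)
  linarith

lemma continuous_clock (hmi : ∀ a b, IntervalIntegrable m volume a b) :
    Continuous (clock m s t) :=
  (intervalIntegral.continuous_primitive hmi s).div_const _

lemma surjective_clock (hm1 : ∀ r, 1 ≤ m r) (hmi : ∀ a b, IntervalIntegrable m volume a b)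
    (hst : s < t) : Function.Surjective (clock m s t) := by
  have hL := integral_pos_of_one_le hm1 hmi hst
  apply (continuous_clock hmi).surjective
  · apply tendsto_atTop_mono' atTop (f₁ := fun r => (r - s) / ∫ x in s..t, m x)
    · filter_upwards [eventually_ge_atTop s] with r hr
      have := sub_div_le_clock_sub hm1 hmi hst hr
      rwa [clock_left, sub_zero] at this
    · exact (tendsto_atTop_add_const_right _ (-s) tendsto_id).atTop_div_const hL
  · apply tendsto_atBot_mono' atBot (f₁ := fun r => (r - s) / ∫ x in s..t, m x)
    · filter_upwards [eventually_le_atBot s] with r hr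
      have := sub_div_le_clock_sub hm1 hmi hst hr
      rw [clock_left, zero_sub] at this
      have h2 : (r - s) / (∫ x in s..t, m x) = - ((s - r) / ∫ x in s..t, m x) := by ring
      rw [h2]
      linarith
    · exact (tendsto_atBot_add_const_right _ (-s) tendsto_id).atBot_div_const hL

/-- The time change as a homeomorphism. -/
noncomputable def clockHomeo (hm1 : ∀ r, 1 ≤ m r)
    (hmi : ∀ a b, IntervalIntegrable m volume a b) (hst : s < t) : ℝ ≃ₜ ℝ :=
  ((strictMono_clock hm1 hmi hst).orderIsoOfSurjective _
    (surjective_clock hm1 hmi hst)).toHomeomorph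

lemma clockHomeo_apply (hm1 : ∀ r, 1 ≤ m r) (hmi : ∀ a b, IntervalIntegrable m volume a b)
    (hst : s < t) (r : ℝ) : clockHomeo hm1 hmi hst r = clock m s t r := rfl

lemma clock_preimage_Icc (hm1 : ∀ r, 1 ≤ m r) (hmi : ∀ a b, IntervalIntegrable m volume a b)
    (hst : s < t) : clock m s t ⁻¹' Icc 0 1 = Icc s t := by
  ext r
  have h := strictMono_clock hm1 hmi hst
  rw [mem_preimage, mem_Icc, mem_Icc, ← h.le_iff_le (a := s), ← h.le_iff_le (a := r), clock_left,
    clock_right hm1 hmi hst]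

lemma clock_preimage_Ioo (hm1 : ∀ r, 1 ≤ m r) (hmi : ∀ a b, IntervalIntegrable m volume a b)
    (hst : s < t) : clock m s t ⁻¹' Ioo 0 1 = Ioo s t := by
  ext r
  have h := strictMono_clock hm1 hmi hst
  rw [mem_preimage, mem_Ioo, mem_Ioo, ← h.lt_iff_lt (a := s), ← h.lt_iff_lt (a := r), clock_left,
    clock_right hm1 hmi hst]

lemma map_clock (hm1 : ∀ r, 1 ≤ m r) (hmi : ∀ a b, IntervalIntegrable m volume a b)
    (hst : s < t) :
    (volume.withDensity fun r => ENNReal.ofReal (m r / ∫ x in s..t, m x)).map (clock m s t)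
      = volume := by
  have hL := integral_pos_of_one_le hm1 hmi hst
  have hmono := strictMono_clock hm1 hmi hst
  symm
  apply Real.measure_ext_Ioo_rat
  intro a b
  rcases le_or_gt (b : ℝ) (a : ℝ) with hab | hab
  · simp [Ioo_eq_empty_of_le hab]
  obtain ⟨a', ha⟩ := surjective_clock hm1 hmi hst (a : ℝ)
  obtain ⟨b', hb⟩ := surjective_clock hm1 hmi hst (b : ℝ)
  have hpre : clock m s t ⁻¹' Ioo (a : ℝ) b = Ioo a' b' := by
    ext r
    rw [mem_preimage, mem_Ioo, mem_Ioo, ← ha, ← hb, hmono.lt_iff_lt, hmono.lt_iff_lt]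
  have hab' : a' ≤ b' := by
    rw [← hmono.le_iff_le, ha, hb]; exact hab.le
  rw [Measure.map_apply (continuous_clock hmi).measurable measurableSet_Ioo, hpre,
    withDensity_apply _ measurableSet_Ioo, Real.volume_Ioo, ← ofReal_integral_eq_lintegral_ofReal,
    ← integral_Ioc_eq_integral_Ioo, ← intervalIntegral.integral_of_le hab',
    intervalIntegral.integral_div, ← clock_sub hmi, ha, hb]
  · exact (((hmi a' b').1.mono_set Ioo_subset_Ioc_self).div_const _)
  · exact ae_of_all _ fun r => div_nonneg (zero_le_one.trans (hm1 r)) hL.le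

lemma setLIntegral_clock (hm : Measurable m) (hm1 : ∀ r, 1 ≤ m r)
    (hmi : ∀ a b, IntervalIntegrable m volume a b) (hst : s < t) {F : ℝ → ℝ≥0∞}
    (hF : Measurable F) :
    ∫⁻ τ in Icc 0 1, F τ
      = ∫⁻ r in Icc s t, ENNReal.ofReal (m r / ∫ x in s..t, m x) * F (clock m s t r) := by
  have hc := (continuous_clock hmi (s := s) (t := t)).measurable
  have hd : Measurable fun r => ENNReal.ofReal (m r / ∫ x in s..t, m x) :=
    (hm.div_const _).ennreal_ofReal
  conv_lhs => rw [← map_clock hm1 hmi hst]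
  rw [setLIntegral_map measurableSet_Icc hF hc, clock_preimage_Icc hm1 hmi hst,
    restrict_withDensity measurableSet_Icc, lintegral_withDensity_mul _ hd
      (g := fun r => F (clock m s t r)) (hF.comp hc)]

lemma setIntegral_clock (hm : Measurable m) (hm1 : ∀ r, 1 ≤ m r)
    (hmi : ∀ a b, IntervalIntegrable m volume a b) (hst : s < t) (F : ℝ → ℝ) :
    ∫ τ in Icc 0 1, F τ
      = ∫ r in Icc s t, (m r / ∫ x in s..t, m x) * F (clock m s t r) := by
  have hL := integral_pos_of_one_le hm1 hmi hst
  have hd : Measurable fun r => ENNReal.ofReal (m r / ∫ x in s..t, m x) :=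
    (hm.div_const _).ennreal_ofReal
  conv_lhs => rw [← map_clock hm1 hmi hst]
  rw [(clockHomeo hm1 hmi hst).measurableEmbedding.setIntegral_map (f := clock m s t),
    clock_preimage_Icc hm1 hmi hst, restrict_withDensity measurableSet_Icc,
    integral_withDensity_eq_integral_toReal_smul hd (ae_of_all _ fun _ => ENNReal.ofReal_lt_top)]
  congr 1
  funext r
  rw [smul_eq_mul, ENNReal.toReal_ofReal (div_nonneg (zero_le_one.trans (hm1 r)) hL.le)]

lemma ae_clock_symm (hm1 : ∀ r, 1 ≤ m r)
    (hmi : ∀ a b, IntervalIntegrable m volume a b) (hst : s < t) {P : ℝ → Prop}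
    (h : ∀ᵐ r ∂volume.restrict (Icc s t), P r) :
    ∀ᵐ τ ∂volume.restrict (Icc 0 1), P ((clockHomeo hm1 hmi hst).symm τ) := by
  have hemb : MeasurableEmbedding (clock m s t) := (clockHomeo hm1 hmi hst).measurableEmbedding
  conv => enter [2]; rw [← map_clock hm1 hmi hst]
  rw [hemb.restrict_map, hemb.ae_map_iff, clock_preimage_Icc hm1 hmi hst,
    restrict_withDensity measurableSet_Icc]
  apply (withDensity_absolutelyContinuous _ _).ae_le
  filter_upwards [h] with r hr
  rw [← clockHomeo_apply hm1 hmi hst, Homeomorph.symm_apply_apply]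
  exact hr

lemma hasDerivAt_clock (hm : Continuous m) (r : ℝ) :
    HasDerivAt (clock m s t) (m r / ∫ x in s..t, m x) r :=
  (intervalIntegral.integral_hasDerivAt_right (hm.intervalIntegrable _ _)
    hm.stronglyMeasurable.stronglyMeasurableAtFilter hm.continuousAt).div_const _

lemma contDiff_clock (hm : Continuous m) : ContDiff ℝ 1 (clock m s t) := by
  rw [contDiff_one_iff_deriv]
  refine ⟨fun r => (hasDerivAt_clock hm r).differentiableAt, ?_⟩
  rw [show deriv (clock m s t) = fun r => m r / ∫ x in s..t, m x from
    funext fun r => (hasDerivAt_clock hm r).deriv]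
  exact hm.div_const _

lemma comp_clock_mem_testSpace {T : ℝ} (hm : Continuous m) (hm1 : ∀ r, 1 ≤ m r) (hs : 0 ≤ s)
    (hst : s < t) (ht : t ≤ T) {φ : ℝ → ℝ → ℝ} (hφ : φ ∈ testSpace 1) :
    (fun r => φ (clock m s t r)) ∈ testSpace T := by
  have hmi : ∀ a b, IntervalIntegrable m volume a b := fun a b => hm.intervalIntegrable a b
  have hc : Continuous (Prod.map (clock m s t) (id : ℝ → ℝ)) :=
    (continuous_clock hmi).prodMap continuous_id
  have h1 : tsupport (Function.uncurry fun r => φ (clock m s t r))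
      ⊆ Prod.map (clock m s t) id ⁻¹' tsupport (Function.uncurry φ) :=
    tsupport_comp_subset_preimage (Function.uncurry φ) hc
  have h2 : tsupport (Function.uncurry fun r => φ (clock m s t r)) ⊆ Ioo s t ×ˢ univ := by
    intro x hx
    have h3 := hφ.2.2 (h1 hx)
    refine ⟨?_, mem_univ _⟩
    rw [← clock_preimage_Ioo hm1 hmi hst]
    exact h3.1
  refine ⟨?_, ?_, h2.trans (prod_mono (Ioo_subset_Ioo hs ht) le_rfl)⟩
  · exact hφ.1.comp ((contDiff_clock hm).prodMap contDiff_id)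
  · have hK : IsCompact (Icc s t ×ˢ (Prod.snd '' tsupport (Function.uncurry φ))) :=
      isCompact_Icc.prod (hφ.2.1.isCompact.image continuous_snd)
    refine hK.of_isClosed_subset (isClosed_tsupport _) fun x hx => ⟨?_, ?_⟩
    · exact Ioo_subset_Icc_self (h2 hx).1
    · exact ⟨_, h1 hx, rfl⟩

lemma deriv_comp_clock (hm : Continuous m) {φ : ℝ → ℝ → ℝ} {T : ℝ} (hφ : φ ∈ testSpace T)
    (r v : ℝ) : deriv (fun x => φ (clock m s t x) v) r
      = (m r / ∫ x in s..t, m x) * deriv (fun x => φ x v) (clock m s t r) := by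
  have h := (hasDerivAt_time hφ.1 (clock m s t r) v).differentiableAt.hasDerivAt
  rw [mul_comm]
  exact (h.comp r (hasDerivAt_clock hm r)).deriv

/-- Locally integrable speeds are approximated by continuous speeds in `L¹`. -/
lemma exists_continuous_speed {T : ℝ} (hm1 : ∀ r, 1 ≤ m r)
    (hmi : ∀ a b, IntervalIntegrable m volume a b) :
    ∃ n : ℕ → ℝ → ℝ, (∀ k, Continuous (n k)) ∧ (∀ k r, 1 ≤ n k r) ∧
      Tendsto (fun k => ∫ r in Ioc 0 T, ‖n k r - m r‖) atTop (𝓝 0) ∧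
      ∀ a ∈ Icc 0 T, ∀ b ∈ Icc 0 T,
        Tendsto (fun k => ∫ r in a..b, n k r) atTop (𝓝 (∫ r in a..b, m r)) := by
  have hmT : Integrable m (volume.restrict (Ioc 0 T)) := (hmi 0 T).1
  have hex : ∀ k : ℕ, ∃ n : ℝ → ℝ, Continuous n ∧ (∀ r, 1 ≤ n r) ∧
      ∫ r in Ioc 0 T, ‖n r - m r‖ ≤ 1 / ((k : ℝ) + 1) := by
    intro k
    obtain ⟨g, hg, hgi⟩ := hmT.exists_boundedContinuous_integral_sub_le
      (ε := 1 / ((k : ℝ) + 1)) (by positivity)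
    have hc : Continuous fun r => max (g r) 1 := g.continuous.max continuous_const
    refine ⟨fun r => max (g r) 1, hc, fun r => le_max_right _ _, le_trans ?_ hg⟩
    apply integral_mono_ae
    · exact ((hc.integrableOn_Ioc).sub hmT).norm
    · exact (hmT.sub hgi).norm
    · refine ae_of_all _ fun r => ?_
      have := abs_max_sub_max_le_abs (g r) (m r) 1
      rw [max_eq_left (hm1 r)] at this
      change |max (g r) 1 - m r| ≤ |m r - g r|
      rwa [abs_sub_comm (m r)]
  choose n hn1 hn2 hn3 using hex
  have hlim : Tendsto (fun k => ∫ r in Ioc 0 T, ‖n k r - m r‖) atTop (𝓝 0) :=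
    squeeze_zero (fun k => integral_nonneg fun _ => norm_nonneg _) hn3
      tendsto_one_div_add_atTop_nhds_zero_nat
  refine ⟨n, hn1, hn2, hlim, fun a ha b hb => ?_⟩
  rw [tendsto_iff_norm_sub_tendsto_zero]
  refine squeeze_zero (fun _ => norm_nonneg _) (fun k => ?_) hlim
  rw [← intervalIntegral.integral_sub ((hn1 k).intervalIntegrable _ _) (hmi _ _)]
  refine (intervalIntegral.norm_integral_le_integral_norm_uIoc).trans ?_
  apply setIntegral_mono_set
  · exact (((hn1 k).integrableOn_Ioc).sub hmT).norm
  · exact ae_of_all _ fun _ => norm_nonneg _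
  · refine LE.le.eventuallyLE fun x hx => ?_
    rw [uIoc, mem_Ioc] at hx
    exact ⟨(le_min ha.1 hb.1).trans_lt hx.1, hx.2.trans (max_le ha.2 hb.2)⟩

end Clock

section TimeChange

variable {e T : ℝ} {g : ℝ → ProbabilityMeasure ℝ}

lemma tendsto_integral_time {φ : ℝ → ℝ → ℝ} (hφ : φ ∈ testSpace T) (μ : ProbabilityMeasure ℝ)
    {τs : ℕ → ℝ} {τ : ℝ} (h : Tendsto τs atTop (𝓝 τ)) :
    Tendsto (fun k => ∫ v, deriv (fun x => φ x v) (τs k) ∂(μ : Measure ℝ)) atTop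
      (𝓝 (∫ v, deriv (fun x => φ x v) τ ∂(μ : Measure ℝ))) := by
  obtain ⟨C, -, hC, -⟩ := exists_bound_deriv hφ.1 hφ.2.1
  have hc := continuous_deriv_time hφ.1
  apply tendsto_integral_of_dominated_convergence (fun _ => C)
  · intro k
    exact (hc.comp (Continuous.prodMk_right (τs k))).aestronglyMeasurable
  · exact integrable_const _
  · exact fun k => ae_of_all _ fun v => hC _ v
  · refine ae_of_all _ fun v => ?_
    exact (hc.tendsto (τ, v)).comp (h.prodMk_nhds tendsto_const_nhds)

lemma tendsto_integral_space (he0 : 0 ≤ e) (he1 : e < 1) {φ : ℝ → ℝ → ℝ} (hφ : φ ∈ testSpace T)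
    {f : ProbabilityMeasure ℝ} (hf : secondMoment f < ⊤) {w : OffDiag → ℝ} (hw : Measurable w)
    (hfin : ∫⁻ p, ENNReal.ofReal (sigma e p) * ENNReal.ofReal (w p ^ 2) ∂prodOff f < ⊤)
    {τs : ℕ → ℝ} {τ : ℝ} (h : Tendsto τs atTop (𝓝 τ)) :
    Tendsto (fun k => ∫ p, sigma e p * nlGrad (φ (τs k)) p * w p ∂prodOff f) atTop
      (𝓝 (∫ p, sigma e p * nlGrad (φ τ) p * w p ∂prodOff f)) := by
  obtain ⟨C, hC0, -, hC⟩ := exists_bound_deriv hφ.1 hφ.2.1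
  have hc := continuous_nlGrad hφ.1
  have hi : Integrable (fun p => sigma e p * (2 * C) * w p) (prodOff f) :=
    integrable_sigma_mul he0 he1 hf hw (G := fun _ => 2 * C) measurable_const
      (fun _ => le_rfl) hfin
  apply tendsto_integral_of_dominated_convergence fun p => ‖sigma e p * (2 * C) * w p‖
  · intro k
    exact (((continuous_sigma e).measurable.mul
      (hc.measurable.comp measurable_prodMk_left)).mul hw).aestronglyMeasurable
  · exact hi.norm
  · refine fun k => ae_of_all _ fun p => ?_
    rw [norm_mul, norm_mul, norm_mul, norm_mul, Real.norm_eq_abs (nlGrad _ _)]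
    gcongr
    exact (abs_nlGrad_le (hC _) p).trans (le_abs_self _)
  · refine ae_of_all _ fun p => ?_
    exact (((hc.tendsto (τ, p)).comp (h.prodMk_nhds tendsto_const_nhds)).const_mul _).mul_const _

/-- The weak formulation is invariant under absolutely continuous changes of time. -/
lemma weak_form_clock (he0 : 0 ≤ e) (he1 : e < 1) (hT : 0 ≤ T) (hg : Continuous g) {M : NNReal}
    (hM : ∀ t ∈ Icc 0 T, secondMoment (g t) ≤ M) {W : ℝ × OffDiag → ℝ} (hW : Measurable W)
    (hfin : ∫⁻ t in Icc 0 T, ∫⁻ p, ENNReal.ofReal (sigma e p) * ENNReal.ofReal (W (t, p) ^ 2)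
      ∂prodOff (g t) < ⊤)
    (hweak : ∀ φ ∈ testSpace T,
      (∫ t in (0 : ℝ)..T, ∫ v, deriv (fun s => φ s v) t ∂(g t : Measure ℝ))
        + (∫ t in (0 : ℝ)..T, ∫ p, sigma e p * nlGrad (φ t) p * W (t, p) ∂prodOff (g t)) = 0)
    {m : ℝ → ℝ} (hm1 : ∀ r, 1 ≤ m r)
    (hmi : ∀ a b, IntervalIntegrable m volume a b)
    {s t : ℝ} (hs : 0 ≤ s) (hst : s < t) (ht : t ≤ T) {φ : ℝ → ℝ → ℝ} (hφ : φ ∈ testSpace 1) :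
    (∫ r in Icc s t, (m r / ∫ x in s..t, m x)
        * ∫ v, deriv (fun x => φ x v) (clock m s t r) ∂(g r : Measure ℝ))
      + (∫ r in Icc s t, ∫ p, sigma e p * nlGrad (φ (clock m s t r)) p * W (r, p) ∂prodOff (g r))
        = 0 := by
  obtain ⟨C, hC0, hCt, hCs⟩ := exists_bound_deriv hφ.1 hφ.2.1
  obtain ⟨n, hn, hn1, hnm, hnlim⟩ := exists_continuous_speed (T := T) hm1 hmi
  have hsT : s ∈ Icc 0 T := ⟨hs, hst.le.trans ht⟩
  have htT : t ∈ Icc 0 T := ⟨hs.trans hst.le, ht⟩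
  have hL := integral_pos_of_one_le hm1 hmi hst
  set L := ∫ x in s..t, m x with hLdef
  have hni : ∀ k, ∀ a b, IntervalIntegrable (n k) volume a b :=
    fun k a b => (hn k).intervalIntegrable a b
  have hLk := hnlim s hsT t htT
  rw [← hLdef] at hLk
  have hθ : ∀ r ∈ Icc 0 T, Tendsto (fun k => clock (n k) s t r) atTop (𝓝 (clock m s t r)) := by
    intro r hr
    exact (hnlim s hsT r hr).div hLk hL.ne'
  set D : ℝ → ℝ → ℝ := fun τ r => ∫ v, deriv (fun x => φ x v) τ ∂(g r : Measure ℝ) with hD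
  set E : ℝ → ℝ → ℝ := fun τ r => ∫ p, sigma e p * nlGrad (φ τ) p * W (r, p) ∂prodOff (g r) with hE
  have hDb : ∀ τ r, ‖D τ r‖ ≤ C := by
    intro τ r
    have := norm_integral_le_of_norm_le_const (μ := (g r : Measure ℝ))
      (f := fun v => deriv (fun x => φ x v) τ) (C := C) (ae_of_all _ fun v => hCt τ v)
    simpa using this
  have hDm : ∀ θ : ℝ → ℝ, Continuous θ → Measurable fun r => D (θ r) r := by
    intro θ hθc
    have h1 : Continuous fun x : ℝ × ℝ => deriv (fun y => φ y x.2) (θ x.1) :=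
      (continuous_deriv_time hφ.1).comp ((hθc.comp continuous_fst).prodMk continuous_snd)
    exact (measurable_integral_curve hg h1.measurable).measurable
  have hEm : ∀ θ : ℝ → ℝ, Continuous θ → StronglyMeasurable fun r => E (θ r) r := by
    intro θ hθc
    have h1 : Measurable fun x : ℝ × OffDiag =>
        sigma e x.2 * nlGrad (φ (θ x.1)) x.2 * W x :=
      (((continuous_sigma e).measurable.comp measurable_snd).mul ((continuous_nlGrad hφ.1).comp
        ((hθc.comp continuous_fst).prodMk continuous_snd)).measurable).mul hW
    have h2 := h1.stronglyMeasurable.integral_kernel_prod_right' (κ := pairKernel g hg)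
    exact h2
  set A : ℝ → ℝ≥0∞ := fun r => ∫⁻ p, ENNReal.ofReal (sigma e p) * ENNReal.ofReal (W (r, p) ^ 2)
      ∂prodOff (g r) with hA
  have hAm : Measurable A := measurable_gradEnergy e hg hW
  have hAfin : ∀ᵐ r ∂volume.restrict (Ioc 0 T), A r < ⊤ :=
    ae_restrict_of_ae_restrict_of_subset Ioc_subset_Icc_self (ae_lt_top hAm hfin.ne)
  have hmT : Integrable m (volume.restrict (Ioc 0 T)) := (hmi 0 T).1
  have hweakk : ∀ k, (∫ r in Ioc 0 T, (n k r / ∫ x in s..t, n k x) * D (clock (n k) s t r) r)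
      + (∫ r in Ioc 0 T, E (clock (n k) s t r) r) = 0 := by
    intro k
    have h1 := hweak _ (comp_clock_mem_testSpace (hn k) (hn1 k) hs hst ht hφ)
    rw [intervalIntegral.integral_of_le hT, intervalIntegral.integral_of_le hT] at h1
    simp only [deriv_comp_clock (hn k) hφ, integral_const_mul] at h1
    exact h1
  have lim1 : Tendsto (fun k => ∫ r in Ioc 0 T, (n k r / ∫ x in s..t, n k x)
      * D (clock (n k) s t r) r) atTop
      (𝓝 (∫ r in Ioc 0 T, (m r / L) * D (clock m s t r) r)) := by
    have e1 : ∀ (x : ℝ → ℝ) (c : ℝ) (y : ℝ → ℝ), ∫ r in Ioc 0 T, (x r / c) * y r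
        = (∫ r in Ioc 0 T, x r * y r) / c := by
      intro x c y
      rw [← integral_div]
      congr 1; funext r; ring
    simp_rw [e1]
    refine Tendsto.div ?_ hLk hL.ne'
    have hmul : ∀ (x : ℝ → ℝ) (θ : ℝ → ℝ), Integrable x (volume.restrict (Ioc 0 T)) →
        Continuous θ → Integrable (fun r => x r * D (θ r) r) (volume.restrict (Ioc 0 T)) := by
      intro x θ hx hθc
      exact hx.mul_bdd (c := C) (hDm θ hθc).aestronglyMeasurable (ae_of_all _ fun r => hDb _ _)
    have hnT : ∀ k, Integrable (n k) (volume.restrict (Ioc 0 T)) := fun k => (hni k 0 T).1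
    have hsplit : ∀ k, ∫ r in Ioc 0 T, n k r * D (clock (n k) s t r) r
        = (∫ r in Ioc 0 T, (n k r - m r) * D (clock (n k) s t r) r)
          + ∫ r in Ioc 0 T, m r * D (clock (n k) s t r) r := by
      intro k
      rw [← integral_add (hmul (fun r => n k r - m r) _ ((hnT k).sub hmT)
          (continuous_clock (hni k)))
        (hmul _ _ hmT (continuous_clock (hni k)))]
      congr 1; funext r; ring
    simp_rw [hsplit]
    rw [← zero_add (∫ r in Ioc 0 T, m r * D (clock m s t r) r)]
    apply Tendsto.add
    · rw [tendsto_zero_iff_norm_tendsto_zero]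
      refine squeeze_zero (fun _ => norm_nonneg _) (fun k => ?_)
        (by simpa using hnm.mul_const C)
      rw [← integral_mul_const]
      refine (norm_integral_le_integral_norm _).trans (integral_mono_ae ?_ ?_ ?_)
      · exact (hmul (fun r => n k r - m r) _ ((hnT k).sub hmT) (continuous_clock (hni k))).norm
      · exact (((hnT k).sub hmT).norm).mul_const C
      · refine ae_of_all _ fun r => ?_
        beta_reduce
        rw [norm_mul]
        exact mul_le_mul_of_nonneg_left (hDb _ _) (norm_nonneg _)
    · apply tendsto_integral_of_dominated_convergence fun r => ‖m r‖ * C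
      · exact fun k => (hmul _ _ hmT (continuous_clock (hni k))).aestronglyMeasurable
      · exact hmT.norm.mul_const C
      · refine fun k => ae_of_all _ fun r => ?_
        rw [norm_mul]
        gcongr
        exact hDb _ _
      · filter_upwards [ae_restrict_mem measurableSet_Ioc] with r hr
        exact (tendsto_integral_time hφ (g r) (hθ r (Ioc_subset_Icc_self hr))).const_mul _
  have lim2 : Tendsto (fun k => ∫ r in Ioc 0 T, E (clock (n k) s t r) r) atTop
      (𝓝 (∫ r in Ioc 0 T, E (clock m s t r) r)) := by
    apply tendsto_integral_of_dominated_convergence fun r =>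
      (ENNReal.ofReal |2 * C| * ((1 + 2 * M) + A r)).toReal
    · exact fun k => (hEm _ (continuous_clock (hni k))).aestronglyMeasurable
    · apply integrable_toReal_of_lintegral_ne_top
      · exact ((hAm.const_add _).const_mul _).aemeasurable
      · rw [lintegral_const_mul' _ _ ENNReal.ofReal_ne_top, lintegral_add_left measurable_const,
          setLIntegral_const]
        refine ENNReal.mul_ne_top ENNReal.ofReal_ne_top (ENNReal.add_ne_top.2 ⟨?_, ?_⟩)
        · exact ENNReal.mul_ne_top (ENNReal.add_ne_top.2 ⟨by simp, ENNReal.mul_ne_top (by simp)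
            (by simp)⟩) (by simp)
        · exact ((lintegral_mono_set Ioc_subset_Icc_self).trans_lt hfin).ne
    · intro k
      filter_upwards [hAfin, ae_restrict_mem measurableSet_Ioc] with r h1 h2
      refine (norm_integral_le_lintegral_norm _).trans (ENNReal.toReal_mono ?_ ?_)
      · refine ENNReal.mul_ne_top ENNReal.ofReal_ne_top (ENNReal.add_ne_top.2 ⟨?_, h1.ne⟩)
        exact ENNReal.add_ne_top.2 ⟨by simp, ENNReal.mul_ne_top (by simp) (by simp)⟩
      · refine (lintegral_sigma_mul_le he0 he1 (g r) (fun p => W (r, p))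
          (abs_nlGrad_le (hCs _))).trans ?_
        gcongr
        exact hM r (Ioc_subset_Icc_self h2)
    · filter_upwards [hAfin, ae_restrict_mem measurableSet_Ioc] with r h1 h2
      exact tendsto_integral_space he0 he1 hφ
        ((hM r (Ioc_subset_Icc_self h2)).trans_lt ENNReal.coe_lt_top)
        (hW.comp measurable_prodMk_left) h1 (hθ r (Ioc_subset_Icc_self h2))
  have hlim := tendsto_nhds_unique (lim1.add lim2)
    (tendsto_const_nhds.congr fun k => (hweakk k).symm)
  have hout : ∀ r ∈ Ioc 0 T \ Ioc s t, clock m s t r ∉ Ioo 0 1 := by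
    intro r hr hr2
    have : r ∈ Ioo s t := by
      rw [← clock_preimage_Ioo hm1 hmi hst]; exact hr2
    exact hr.2 (Ioo_subset_Ioc_self this)
  have hsub : Ioc s t ⊆ Ioc 0 T := Ioc_subset_Ioc hs ht
  rw [integral_Icc_eq_integral_Ioc, integral_Icc_eq_integral_Ioc,
    ← setIntegral_eq_of_subset_of_forall_sdiff_eq_zero measurableSet_Ioc hsub
      (f := fun r => (m r / L) * D (clock m s t r) r),
    ← setIntegral_eq_of_subset_of_forall_sdiff_eq_zero measurableSet_Ioc hsub
      (f := fun r => E (clock m s t r) r)]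
  · exact hlim
  · intro r hr
    simp only [hE, nlGrad, deriv_space_eq_zero hφ.1 hφ.2.2 (hout r hr), sub_self, mul_zero,
      zero_mul, integral_zero]
  · intro r hr
    simp only [hD, deriv_time_eq_zero hφ.1 hφ.2.2 (hout r hr), mul_zero, integral_zero]

end TimeChange

lemma collisionDist_le {e : ℝ} {μ ν : ProbabilityMeasure ℝ} {f : ℝ → ProbabilityMeasure ℝ}
    {U : ℝ → SignedMeasure OffDiag} (h : IsGCEBetween e 1 μ ν f U) {c : ℝ≥0∞}
    (hc : ∫⁻ t in Icc (0 : ℝ) 1, action e (f t) (U t) ≤ c) :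
    collisionDist e μ ν ≤ c ^ (1 / 2 : ℝ) := by
  refine ENNReal.rpow_le_rpow (le_trans ?_ hc) (by norm_num)
  refine iInf_le_of_le f ?_
  refine iInf_le_of_le U ?_
  exact iInf_le _ h

lemma collisionDist_self {e : ℝ} (he0 : 0 ≤ e) (he1 : e < 1) {μ : ProbabilityMeasure ℝ}
    (hμ : secondMoment μ < ⊤) : collisionDist e μ μ = 0 := by
  have hM : ∀ t ∈ Icc (0 : ℝ) 1, secondMoment μ ≤ (secondMoment μ).toNNReal := fun _ _ =>
    (ENNReal.coe_toNNReal hμ.ne).ge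
  have hweak : ∀ φ ∈ testSpace 1,
      (∫ t in (0 : ℝ)..1, ∫ v, deriv (fun s => φ s v) t ∂(μ : Measure ℝ))
        + (∫ t in (0 : ℝ)..1, ∫ p, sigma e p * nlGrad (φ t) p * (0 : ℝ) ∂prodOff μ) = 0 := by
    intro φ hφ
    obtain ⟨C, -, hC, -⟩ := exists_bound_deriv hφ.1 hφ.2.1
    have hc := continuous_deriv_time hφ.1
    simp only [mul_zero, integral_zero, intervalIntegral.integral_zero, add_zero]
    rw [intervalIntegral.integral_of_le zero_le_one, integral_integral_swap]
    · apply integral_eq_zero_of_ae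
      refine ae_of_all _ fun v => ?_
      beta_reduce
      have hd : ∀ x ∈ uIcc (0 : ℝ) 1, DifferentiableAt ℝ (fun s => φ s v) x :=
        fun x _ => (hasDerivAt_time hφ.1 x v).differentiableAt
      have hci : IntervalIntegrable (deriv fun s => φ s v) volume 0 1 :=
        (hc.comp (Continuous.prodMk_left v)).intervalIntegrable _ _
      rw [← intervalIntegral.integral_of_le zero_le_one,
        intervalIntegral.integral_deriv_eq_sub hd hci]
      have hz : ∀ t : ℝ, t ∉ Ioo (0 : ℝ) 1 → φ t v = 0 := by
        intro t ht
        by_contra hne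
        exact ht (hφ.2.2 (subset_tsupport (Function.uncurry φ) (a := (t, v)) hne)).1
      rw [hz 1 (by simp), hz 0 (by simp), sub_zero]
      rfl
    · exact Integrable.of_bound hc.aestronglyMeasurable C (ae_of_all _ fun x => hC x.1 x.2)
  obtain ⟨h1, h2⟩ := isGCE_of_density (g := fun _ => μ) he0 he1 zero_le_one continuous_const hM
    (W := fun _ => 0) measurable_const (ae_of_all _ fun _ => integrable_zero _ _ _)
    (by simp) hweak
  have h3 := collisionDist_le ⟨h1, continuousOn_const, rfl, rfl⟩
    ((lintegral_mono_ae h2).trans (c := 0) (by simp))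
  rw [ENNReal.zero_rpow_of_pos (by norm_num)] at h3
  exact le_antisymm h3 zero_le

/-- A curve driven by a flux of finite action is absolutely continuous. -/
lemma collisionDist_le_integral {e T : ℝ} (he0 : 0 ≤ e) (he1 : e < 1) (hT : 0 ≤ T)
    {g : ℝ → ProbabilityMeasure ℝ} (hg : Continuous g) {M : NNReal}
    (hM : ∀ t ∈ Icc 0 T, secondMoment (g t) ≤ M) {W : ℝ × OffDiag → ℝ} (hW : Measurable W)
    (hint : ∀ᵐ t ∂(volume.restrict (Icc 0 T)), Integrable (fun p => W (t, p)) (prodOff (g t)))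
    (hfin : ∫⁻ t in Icc 0 T, ∫⁻ p, ENNReal.ofReal (sigma e p) * ENNReal.ofReal (W (t, p) ^ 2)
      ∂prodOff (g t) < ⊤)
    (hweak : ∀ φ ∈ testSpace T,
      (∫ t in (0 : ℝ)..T, ∫ v, deriv (fun s => φ s v) t ∂(g t : Measure ℝ))
        + (∫ t in (0 : ℝ)..T, ∫ p, sigma e p * nlGrad (φ t) p * W (t, p) ∂prodOff (g t)) = 0)
    {m : ℝ → ℝ} (hm : Measurable m) (hm1 : ∀ r, 1 ≤ m r)
    (hmi : ∀ a b, IntervalIntegrable m volume a b)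
    (hAm : ∀ᵐ t ∂(volume.restrict (Icc 0 T)), ∫⁻ p, ENNReal.ofReal (sigma e p)
      * ENNReal.ofReal (W (t, p) ^ 2) ∂prodOff (g t) ≤ ENNReal.ofReal (m t ^ 2))
    {s t : ℝ} (hs : 0 ≤ s) (hst : s < t) (ht : t ≤ T) :
    collisionDist e (g s) (g t) ≤ ENNReal.ofReal (∫ r in s..t, m r) := by
  have hL := integral_pos_of_one_le hm1 hmi hst
  set L := ∫ x in s..t, m x with hLdef
  set H := clockHomeo hm1 hmi hst
  have hHs : ∀ r, H.symm (clock m s t r) = r := fun r => H.symm_apply_apply r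
  have hsub : Icc s t ⊆ Icc 0 T := Icc_subset_Icc hs ht
  have hmpos : ∀ r, 0 < m r := fun r => zero_lt_one.trans_le (hm1 r)
  have hsymm : ∀ τ ∈ Icc (0 : ℝ) 1, H.symm τ ∈ Icc s t := by
    intro τ hτ
    rw [← clock_preimage_Icc hm1 hmi hst, mem_preimage, ← clockHomeo_apply hm1 hmi hst]
    change H (H.symm τ) ∈ _
    rwa [H.apply_symm_apply]
  set V : ℝ × OffDiag → ℝ := fun x => L / m (H.symm x.1) * W (H.symm x.1, x.2) with hV
  have hVm : Measurable V := by
    have h1 : Measurable fun x : ℝ × OffDiag => H.symm x.1 := H.symm.measurable.comp measurable_fst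
    exact ((hm.comp h1).const_div L).mul (hW.comp (h1.prodMk measurable_snd))
  have hgc : Continuous fun τ => g (H.symm τ) := hg.comp H.symm.continuous
  have hgM : ∀ τ ∈ Icc (0 : ℝ) 1, secondMoment (g (H.symm τ)) ≤ M := fun τ hτ =>
    hM _ (hsub (hsymm τ hτ))
  have hVint : ∀ᵐ τ ∂(volume.restrict (Icc (0 : ℝ) 1)),
      Integrable (fun p => V (τ, p)) (prodOff (g (H.symm τ))) := by
    filter_upwards [ae_clock_symm hm1 hmi hst (ae_restrict_of_ae_restrict_of_subset hsub hint)]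
      with τ hτ
    exact hτ.const_mul (L / m (H.symm τ))
  have hVfin : ∫⁻ τ in Icc (0 : ℝ) 1, ∫⁻ p, ENNReal.ofReal (sigma e p)
      * ENNReal.ofReal (V (τ, p) ^ 2) ∂prodOff (g (H.symm τ)) ≤ ENNReal.ofReal (L ^ 2) := by
    rw [setLIntegral_clock hm hm1 hmi hst (measurable_gradEnergy e hgc hVm)]
    simp only [hHs, hV]
    calc _ ≤ ∫⁻ r in Icc s t, ENNReal.ofReal L * ENNReal.ofReal (m r) := by
          apply lintegral_mono_ae
          filter_upwards [ae_restrict_of_ae_restrict_of_subset hsub hAm] with r hr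
          have h1 : ∫⁻ p, ENNReal.ofReal (sigma e p)
              * ENNReal.ofReal ((L / m r * W (r, p)) ^ 2) ∂prodOff (g r)
              = ENNReal.ofReal ((L / m r) ^ 2) * ∫⁻ p, ENNReal.ofReal (sigma e p)
              * ENNReal.ofReal (W (r, p) ^ 2) ∂prodOff (g r) := by
            rw [← lintegral_const_mul' _ _ ENNReal.ofReal_ne_top]
            congr 1; funext p
            rw [mul_pow, ENNReal.ofReal_mul (sq_nonneg _)]
            ring
          rw [h1]
          calc _ ≤ ENNReal.ofReal (m r / L) * (ENNReal.ofReal ((L / m r) ^ 2)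
                * ENNReal.ofReal (m r ^ 2)) := by gcongr
            _ = _ := by
              rw [← ENNReal.ofReal_mul (sq_nonneg _),
                ← ENNReal.ofReal_mul (div_nonneg (hmpos r).le hL.le), ← ENNReal.ofReal_mul hL.le]
              congr 1
              have := (hmpos r).ne'
              field_simp
      _ = ENNReal.ofReal (L ^ 2) := by
          rw [lintegral_const_mul' _ _ ENNReal.ofReal_ne_top,
            ← ofReal_integral_eq_lintegral_ofReal, integral_Icc_eq_integral_Ioc,
            ← intervalIntegral.integral_of_le hst.le, ← hLdef, ← ENNReal.ofReal_mul hL.le, sq]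
          · exact (intervalIntegrable_iff_integrableOn_Icc_of_le hst.le).1 (hmi s t)
          · exact ae_of_all _ fun r => (hmpos r).le
  have hVweak : ∀ φ ∈ testSpace 1,
      (∫ τ in (0 : ℝ)..1, ∫ v, deriv (fun x => φ x v) τ ∂(g (H.symm τ) : Measure ℝ))
        + (∫ τ in (0 : ℝ)..1, ∫ p, sigma e p * nlGrad (φ τ) p * V (τ, p)
          ∂prodOff (g (H.symm τ))) = 0 := by
    intro φ hφ
    rw [intervalIntegral.integral_of_le zero_le_one, intervalIntegral.integral_of_le zero_le_one,
      ← integral_Icc_eq_integral_Ioc, ← integral_Icc_eq_integral_Ioc,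
      setIntegral_clock hm hm1 hmi hst, setIntegral_clock hm hm1 hmi hst]
    simp only [hHs, hV]
    refine Eq.trans ?_ (weak_form_clock he0 he1 hT hg hM hW hfin hweak hm1 hmi hs hst ht hφ)
    congr 2
    funext r
    rw [← integral_const_mul]
    congr 1; funext p
    rw [← hLdef]
    have := (hmpos r).ne'
    field_simp
  obtain ⟨h1, h2⟩ := isGCE_of_density he0 he1 zero_le_one hgc hgM hVm hVint
    (hVfin.trans_lt ENNReal.ofReal_lt_top) hVweak
  have h3 : IsGCEBetween e 1 (g s) (g t) (fun τ => g (H.symm τ))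
      (fun τ => (prodOff (g (H.symm τ))).withDensityᵥ fun p => V (τ, p)) :=
    ⟨h1, hgc.continuousOn, by
      rw [← clock_left (m := m) (s := s) (t := t), hHs], by
      rw [← clock_right hm1 hmi hst, hHs]⟩
  calc collisionDist e (g s) (g t) ≤ (ENNReal.ofReal (L ^ 2)) ^ (1 / 2 : ℝ) :=
        collisionDist_le h3 ((lintegral_mono_ae h2).trans hVfin)
    _ = ENNReal.ofReal L := by
        rw [ENNReal.ofReal_rpow_of_nonneg (sq_nonneg _) (by norm_num), ← Real.sqrt_eq_rpow,
          Real.sqrt_sq hL.le]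

lemma mem_ACCurves {e T : ℝ} (he0 : 0 ≤ e) (he1 : e < 1) (hT : 0 ≤ T)
    {g : ℝ → ProbabilityMeasure ℝ} (hg : Continuous g) {M : NNReal}
    (hM : ∀ t ∈ Icc 0 T, secondMoment (g t) ≤ M) (hcm : ∀ t ∈ Icc 0 T, g t ∈ P2cm)
    {W : ℝ × OffDiag → ℝ} (hW : Measurable W)
    (hint : ∀ᵐ t ∂(volume.restrict (Icc 0 T)), Integrable (fun p => W (t, p)) (prodOff (g t)))
    (hfin : ∫⁻ t in Icc 0 T, ∫⁻ p, ENNReal.ofReal (sigma e p) * ENNReal.ofReal (W (t, p) ^ 2)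
      ∂prodOff (g t) < ⊤)
    (hweak : ∀ φ ∈ testSpace T,
      (∫ t in (0 : ℝ)..T, ∫ v, deriv (fun s => φ s v) t ∂(g t : Measure ℝ))
        + (∫ t in (0 : ℝ)..T, ∫ p, sigma e p * nlGrad (φ t) p * W (t, p) ∂prodOff (g t)) = 0) :
    g ∈ ACCurves e T := by
  set A : ℝ → ℝ≥0∞ := fun r => ∫⁻ p, ENNReal.ofReal (sigma e p) * ENNReal.ofReal (W (r, p) ^ 2)
      ∂prodOff (g r) with hA
  have hAm : Measurable A := measurable_gradEnergy e hg hW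
  have hAfin : ∀ᵐ r ∂volume.restrict (Icc 0 T), A r < ⊤ := ae_lt_top hAm hfin.ne
  have hq : Measurable fun r => √(A r).toReal := hAm.ennreal_toReal.sqrt
  have hq2 : MemLp (fun r => √(A r).toReal) 2 (volume.restrict (Icc 0 T)) := by
    rw [memLp_two_iff_integrable_sq hq.aestronglyMeasurable]
    simp only [Real.sq_sqrt ENNReal.toReal_nonneg]
    exact integrable_toReal_of_lintegral_ne_top hAm.aemeasurable hfin.ne
  set m : ℝ → ℝ := fun r => 1 + (Icc 0 T).indicator (fun r => √(A r).toReal) r with hmdef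
  have hm : Measurable m := (hq.indicator measurableSet_Icc).const_add 1
  have hm1 : ∀ r, 1 ≤ m r := fun r =>
    le_add_of_nonneg_right (indicator_nonneg (fun _ _ => Real.sqrt_nonneg _) r)
  have hmeq : ∀ r ∈ Icc 0 T, m r = 1 + √(A r).toReal := by
    intro r hr
    simp only [hmdef, indicator_of_mem hr]
  have hmi : ∀ a b, IntervalIntegrable m volume a b := by
    intro a b
    refine intervalIntegrable_const.add (Integrable.intervalIntegrable ?_)
    rw [integrable_indicator_iff measurableSet_Icc]
    exact hq2.integrable one_le_two
  refine ⟨hcm, m, fun r => zero_le_one.trans (hm1 r), ?_, fun s t hs hst ht => ?_⟩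
  · refine ((memLp_const (1 : ℝ)).add hq2).ae_eq ?_
    filter_upwards [ae_restrict_mem measurableSet_Icc] with r hr
    exact (hmeq r hr).symm
  · rcases hst.eq_or_lt with rfl | hst
    · rw [collisionDist_self he0 he1 ((hM s ⟨hs, ht⟩).trans_lt ENNReal.coe_lt_top)]
      exact zero_le
    · refine collisionDist_le_integral he0 he1 hT hg hM hW hint hfin hweak hm hm1 hmi ?_ hs hst ht
      filter_upwards [hAfin, ae_restrict_mem measurableSet_Icc] with r h1 h2
      change A r ≤ _
      rw [← ENNReal.ofReal_toReal h1.ne]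
      apply ENNReal.ofReal_le_ofReal
      rw [hmeq r h2]
      calc (A r).toReal = √(A r).toReal ^ 2 := (Real.sq_sqrt ENNReal.toReal_nonneg).symm
        _ ≤ _ := pow_le_pow_left₀ (Real.sqrt_nonneg _) (by linarith) 2

section Limits

variable {e T : ℝ}

lemma tendsto_prod_self {μs : ℕ → ProbabilityMeasure ℝ} {μ : ProbabilityMeasure ℝ}
    (h : Tendsto μs atTop (𝓝 μ)) :
    Tendsto (fun n => (μs n).prod (μs n)) atTop (𝓝 (μ.prod μ)) :=
  (ProbabilityMeasure.continuous_prod.tendsto (μ, μ)).comp (h.prodMk_nhds h)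

/-- The energy of a fixed gradient is continuous along narrowly convergent sequences with bounded
second moments. -/
lemma tendsto_gradEnergy (he0 : 0 ≤ e) (he1 : e < 1) {μs : ℕ → ProbabilityMeasure ℝ}
    {μ : ProbabilityMeasure ℝ} (h : Tendsto μs atTop (𝓝 μ)) {M : NNReal}
    (hM : ∀ n, secondMoment (μs n) ≤ M) (hM' : secondMoment μ ≤ M) {ζ : ℝ → ℝ}
    (hζ : Continuous ζ) {C : ℝ} (hC : ∀ v, |ζ v| ≤ C) :
    Tendsto (fun n => ∫⁻ p : OffDiag, ENNReal.ofReal (sigma e p)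
        * ENNReal.ofReal ((ζ p.1.2 - ζ p.1.1) ^ 2) ∂prodOff (μs n)) atTop
      (𝓝 (∫⁻ p : OffDiag, ENNReal.ofReal (sigma e p)
        * ENNReal.ofReal ((ζ p.1.2 - ζ p.1.1) ^ 2) ∂prodOff μ)) := by
  set F : ℝ × ℝ → ℝ := fun x => (1 - e) / 4 * |x.1 - x.2| * (ζ x.2 - ζ x.1) ^ 2 with hF
  have hFc : Continuous F := by
    simp only [hF]; fun_prop
  have hc : 0 ≤ (1 - e) / 4 := by linarith
  have hF0 : ∀ x, 0 ≤ F x := fun x => by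
    simp only [hF]; positivity
  have hFb : ∀ x : ℝ × ℝ, |F x| ≤ (2 * C) ^ 2 * |x.1 - x.2| := by
    intro x
    rw [abs_of_nonneg (hF0 x)]
    have h1 : (ζ x.2 - ζ x.1) ^ 2 ≤ (2 * C) ^ 2 := by
      rw [← sq_abs]
      refine pow_le_pow_left₀ (abs_nonneg _) ?_ 2
      have := abs_sub (ζ x.2) (ζ x.1)
      linarith [hC x.1, hC x.2]
    simp only [hF]
    calc (1 - e) / 4 * |x.1 - x.2| * (ζ x.2 - ζ x.1) ^ 2
        ≤ 1 * |x.1 - x.2| * (2 * C) ^ 2 := by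
          gcongr; linarith
      _ = _ := by ring
  have hmom : ∀ ν : ProbabilityMeasure ℝ, secondMoment ν ≤ M →
      ∫⁻ x, ENNReal.ofReal (x.1 ^ 2 + x.2 ^ 2) ∂(ν.prod ν : Measure (ℝ × ℝ))
        ≤ ENNReal.ofReal (2 * M) := by
    intro ν hν
    have hm : Measurable fun v : ℝ => ENNReal.ofReal (v ^ 2) := by fun_prop
    simp only [ENNReal.ofReal_add (sq_nonneg _) (sq_nonneg _)]
    rw [lintegral_add_left (by fun_prop)]
    change ∫⁻ x : ℝ × ℝ, ENNReal.ofReal (x.1 ^ 2) ∂(ν : Measure ℝ).prod (ν : Measure ℝ)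
      + ∫⁻ x : ℝ × ℝ, ENNReal.ofReal (x.2 ^ 2) ∂(ν : Measure ℝ).prod (ν : Measure ℝ) ≤ _
    rw [lintegral_fst_prod ν hm, lintegral_snd_prod ν hm]
    change secondMoment ν + secondMoment ν ≤ _
    rw [two_mul, ENNReal.ofReal_add M.coe_nonneg M.coe_nonneg, ENNReal.ofReal_coe_nnreal]
    gcongr
  have hdom : ∀ ε > 0, ∃ K, ∀ x : ℝ × ℝ, |F x| ≤ K + ε * (x.1 ^ 2 + x.2 ^ 2) := by
    intro ε hε
    refine ⟨((2 * C) ^ 2) ^ 2 / (2 * ε), fun x => (hFb x).trans ?_⟩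
    set k := (2 * C) ^ 2
    have h1 : |x.1 - x.2| ^ 2 ≤ 2 * (x.1 ^ 2 + x.2 ^ 2) := by
      rw [sq_abs]; nlinarith [sq_nonneg (x.1 + x.2)]
    have h2 : k * |x.1 - x.2| ≤ k ^ 2 / (2 * ε) + ε / 2 * |x.1 - x.2| ^ 2 := by
      rw [div_add' _ _ _ (by positivity), le_div_iff₀ (by positivity)]
      nlinarith [sq_nonneg (k - ε * |x.1 - x.2|)]
    nlinarith
  have hlim := tendsto_integral_of_moment (tendsto_prod_self h) hFc
    (W := fun x : ℝ × ℝ => x.1 ^ 2 + x.2 ^ 2) (by fun_prop) (fun x => by positivity)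
    (by positivity) (fun n => hmom _ (hM n)) (hmom _ hM') hdom
  have hrepr : ∀ ν : ProbabilityMeasure ℝ, secondMoment ν ≤ M →
      ∫⁻ p : OffDiag, ENNReal.ofReal (sigma e p)
        * ENNReal.ofReal ((ζ p.1.2 - ζ p.1.1) ^ 2) ∂prodOff ν
      = ENNReal.ofReal (∫ x, F x ∂(ν.prod ν : Measure (ℝ × ℝ))) := by
    intro ν hν
    have h1 : ∫⁻ p : OffDiag, ENNReal.ofReal (sigma e p)
        * ENNReal.ofReal ((ζ p.1.2 - ζ p.1.1) ^ 2) ∂prodOff ν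
        = ∫⁻ p : OffDiag, ENNReal.ofReal (F p.1) ∂prodOff ν := by
      congr 1; funext p
      rw [← ENNReal.ofReal_mul (sigma_pos he1 p).le]
      rfl
    rw [h1, lintegral_prodOff ν (fun x => ENNReal.ofReal (F x)) (by simp [hF])]
    refine (ofReal_integral_eq_lintegral_ofReal ?_ (ae_of_all _ hF0)).symm
    obtain ⟨K, hK⟩ := hdom 1 one_pos
    have hW : Integrable (fun x : ℝ × ℝ => x.1 ^ 2 + x.2 ^ 2) (ν.prod ν : Measure (ℝ × ℝ)) := by
      refine ⟨by fun_prop, ?_⟩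
      rw [hasFiniteIntegral_iff_ofReal (ae_of_all _ fun x => by positivity)]
      exact (hmom ν hν).trans_lt ENNReal.ofReal_lt_top
    exact ((integrable_const K).add (hW.const_mul 1)).mono' hFc.aestronglyMeasurable
      (ae_of_all _ hK)
  rw [hrepr μ hM']
  simp_rw [fun n => hrepr (μs n) (hM n)]
  exact ENNReal.tendsto_ofReal hlim

lemma dissipation_le_liminf (he1 : e < 1) {μs : ℕ → ProbabilityMeasure ℝ}
    {μ : ProbabilityMeasure ℝ} (h : Tendsto μs atTop (𝓝 μ)) :
    dissipation e μ ≤ liminf (fun n => dissipation e (μs n)) atTop := by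
  set F : ℝ × ℝ → ℝ := fun x => |x.1 - x.2| ^ 2 * ((1 - e) / 4 * |x.1 - x.2|) with hF
  have hc : 0 ≤ (1 - e) / 4 := by linarith
  have hrepr : ∀ ν : ProbabilityMeasure ℝ,
      dissipation e ν = ∫⁻ x, ENNReal.ofReal (F x) ∂(ν.prod ν : Measure (ℝ × ℝ)) := fun ν =>
    lintegral_prodOff ν (fun x => ENNReal.ofReal (F x)) (by simp [hF])
  simp_rw [hrepr]
  exact lintegral_le_liminf_of_tendsto (tendsto_prod_self h) (by simp only [hF]; fun_prop)
    fun x => by simp only [hF]; positivity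

lemma measurable_dissipation {g : ℝ → ProbabilityMeasure ℝ} (hg : Continuous g) :
    Measurable fun t => dissipation e (g t) := by
  have h1 : Measurable fun x : ℝ × OffDiag =>
      ENNReal.ofReal (|x.2.1.1 - x.2.1.2| ^ 2 * sigma e x.2) := by
    have := (continuous_sigma e).measurable
    fun_prop
  exact h1.lintegral_kernel_prod_right' (κ := pairKernel g hg)

lemma secondMoment_le_liminf {μs : ℕ → ProbabilityMeasure ℝ}
    {μ : ProbabilityMeasure ℝ} (h : Tendsto μs atTop (𝓝 μ)) :
    secondMoment μ ≤ liminf (fun n => secondMoment (μs n)) atTop :=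
  lintegral_le_liminf_of_tendsto h (by fun_prop) fun v => sq_nonneg v

lemma secondMoment_le_of_tendsto {μs : ℕ → ProbabilityMeasure ℝ}
    {μ : ProbabilityMeasure ℝ} (h : Tendsto μs atTop (𝓝 μ)) {M : ℝ≥0∞}
    (hM : ∀ n, secondMoment (μs n) ≤ M) : secondMoment μ ≤ M :=
  (secondMoment_le_liminf h).trans
    ((liminf_le_liminf (Eventually.of_forall hM)).trans (by simp))

lemma kineticEnergy_eq (f : ProbabilityMeasure ℝ) :
    kineticEnergy f = (1 / 2) * secondMoment f := rfl

lemma secondMoment_lt_top_of_mem {f : ProbabilityMeasure ℝ} (hf : f ∈ P2cm) :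
    secondMoment f < ⊤ :=
  (hasFiniteIntegral_iff_ofReal (ae_of_all _ fun v => sq_nonneg v)).1 hf.1.2

lemma mem_P2cm_of_tendsto {μs : ℕ → ProbabilityMeasure ℝ}
    {μ : ProbabilityMeasure ℝ} (h : Tendsto μs atTop (𝓝 μ)) {M : NNReal}
    (hM : ∀ n, secondMoment (μs n) ≤ M) (hcm : ∀ n, μs n ∈ P2cm) : μ ∈ P2cm := by
  have hμ := secondMoment_le_of_tendsto h hM
  refine ⟨⟨by fun_prop, ?_⟩, ?_⟩
  · rw [hasFiniteIntegral_iff_ofReal (ae_of_all _ fun v => sq_nonneg v)]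
    exact hμ.trans_lt ENNReal.coe_lt_top
  · have hlim := tendsto_integral_of_moment h (F := fun v => v) (W := fun v => v ^ 2)
      continuous_id (by fun_prop) (fun v => sq_nonneg v) (M := M) M.2
      (fun n => by rw [ENNReal.ofReal_coe_nnreal]; exact hM n)
      (by rw [ENNReal.ofReal_coe_nnreal]; exact hμ) (by
        intro ε hε
        refine ⟨1 / (4 * ε), fun v => ?_⟩
        rw [← sq_abs v, div_add' _ _ _ (by positivity), le_div_iff₀ (by positivity)]
        nlinarith [sq_nonneg (1 - 2 * ε * |v|)])
    refine tendsto_nhds_unique hlim (tendsto_const_nhds.congr fun n => ((hcm n).2).symm)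

lemma tendsto_timeFunctional {F : ℕ → ℝ → ProbabilityMeasure ℝ} (hF : ∀ n, Continuous (F n))
    {g : ℝ → ProbabilityMeasure ℝ} (h : ∀ t, Tendsto (fun n => F n t) atTop (𝓝 (g t)))
    (hT : 0 ≤ T) {φ : ℝ → ℝ → ℝ} (hφ : φ ∈ testSpace T) :
    Tendsto (fun n => ∫ t in (0 : ℝ)..T, ∫ v, deriv (fun s => φ s v) t ∂(F n t : Measure ℝ)) atTop
      (𝓝 (∫ t in (0 : ℝ)..T, ∫ v, deriv (fun s => φ s v) t ∂(g t : Measure ℝ))) := by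
  obtain ⟨C, hC0, hC, -⟩ := exists_bound_deriv hφ.1 hφ.2.1
  have hc := continuous_deriv_time hφ.1
  simp_rw [intervalIntegral.integral_of_le hT]
  apply tendsto_integral_of_dominated_convergence fun _ => C
  · exact fun n => (measurable_integral_curve (hF n) hc.measurable).aestronglyMeasurable
  · exact integrable_const _
  · refine fun n => ae_of_all _ fun t => ?_
    have := norm_integral_le_of_norm_le_const (μ := (F n t : Measure ℝ))
      (f := fun v => deriv (fun s => φ s v) t) (C := C) (ae_of_all _ fun v => hC t v)
    simpa using this
  · refine ae_of_all _ fun t => ?_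
    exact (ProbabilityMeasure.tendsto_iff_forall_integral_tendsto.1 (h t))
      (BoundedContinuousFunction.ofNormedAddCommGroup (fun v => deriv (fun s => φ s v) t)
        (hc.comp (Continuous.prodMk_right t)) C (fun v => hC t v))

/-- The domination of the time functional passes to limits of curves. -/
lemma weak_bound_of_tendsto (he0 : 0 ≤ e) (he1 : e < 1) (hT : 0 ≤ T)
    {F : ℕ → ℝ → ProbabilityMeasure ℝ} (hF : ∀ n, Continuous (F n))
    {U : ℕ → ℝ → SignedMeasure OffDiag} (hU : ∀ n, IsGCE e T (F n) (U n))
    {M : NNReal} (hM : ∀ n t, secondMoment (F n t) ≤ M)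
    {g : ℝ → ProbabilityMeasure ℝ} (h : ∀ t, Tendsto (fun n => F n t) atTop (𝓝 (g t)))
    {a : ℝ≥0∞} (ha : Tendsto (fun n => ∫⁻ t in Icc 0 T, action e (F n t) (U n t)) atTop (𝓝 a))
    {φ : ℝ → ℝ → ℝ} (hφ : φ ∈ testSpace T) {ε : ℝ} (hε : 0 < ε) :
    ‖∫ t in (0 : ℝ)..T, ∫ v, deriv (fun s => φ s v) t ∂(g t : Measure ℝ)‖ₑ
      ≤ ENNReal.ofReal (ε / 2) * a
        + ENNReal.ofReal (1 / (2 * ε)) * ∫⁻ t in Icc 0 T, ∫⁻ p, ENNReal.ofReal (sigma e p)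
          * ENNReal.ofReal (nlGrad (φ t) p ^ 2) ∂prodOff (g t) := by
  obtain ⟨C, hC0, -, hC⟩ := exists_bound_deriv hφ.1 hφ.2.1
  have hG : Measurable fun x : ℝ × OffDiag => nlGrad (φ x.1) x.2 :=
    (continuous_nlGrad hφ.1).measurable
  have hB : Tendsto (fun n => ∫⁻ t in Icc 0 T, ∫⁻ p, ENNReal.ofReal (sigma e p)
          * ENNReal.ofReal (nlGrad (φ t) p ^ 2) ∂prodOff (F n t)) atTop
      (𝓝 (∫⁻ t in Icc 0 T, ∫⁻ p, ENNReal.ofReal (sigma e p)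
          * ENNReal.ofReal (nlGrad (φ t) p ^ 2) ∂prodOff (g t))) := by
    apply tendsto_lintegral_of_dominated_convergence
      fun _ => ENNReal.ofReal ((2 * C) ^ 2) * (1 + 2 * M)
    · exact fun n => measurable_gradEnergy e (hF n)
        (G := fun x : ℝ × OffDiag => nlGrad (φ x.1) x.2) hG
    · refine fun n => ae_of_all _ fun t => ?_
      refine (lintegral_sigma_sq_le he0 (F n t) (abs_nlGrad_le (hC t))).trans ?_
      beta_reduce
      gcongr
      exact hM n t
    · rw [setLIntegral_const]
      refine ENNReal.mul_ne_top (ENNReal.mul_ne_top ENNReal.ofReal_ne_top ?_) (by simp)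
      exact ENNReal.add_ne_top.2 ⟨by simp, ENNReal.mul_ne_top (by simp) (by simp)⟩
    · refine ae_of_all _ fun t => ?_
      exact tendsto_gradEnergy (ζ := deriv (φ t)) he0 he1 (h t) (fun n => hM n t)
        (secondMoment_le_of_tendsto (h t) fun n => hM n t)
        ((continuous_deriv_space hφ.1).comp (Continuous.prodMk_right t)) (hC t)
  refine le_of_tendsto_of_tendsto' ((continuous_enorm.tendsto _).comp
    (tendsto_timeFunctional hF h hT hφ)) ?_
    fun n => weak_bound he1 (hF n) (hU n) hT hφ hε
  exact (ENNReal.Tendsto.const_mul ha (Or.inr ENNReal.ofReal_ne_top)).add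
    (ENNReal.Tendsto.const_mul hB (Or.inr ENNReal.ofReal_ne_top))

end Limits

section Extension

variable {e T : ℝ}

/-- The extension of a curve from `[0, T]` by constants. -/
noncomputable def extendCurve (hT : 0 ≤ T) (f : ℝ → ProbabilityMeasure ℝ) (t : ℝ) :
    ProbabilityMeasure ℝ :=
  f (projIcc 0 T hT t)

lemma extendCurve_of_mem (hT : 0 ≤ T) (f : ℝ → ProbabilityMeasure ℝ) {t : ℝ}
    (ht : t ∈ Icc 0 T) : extendCurve hT f t = f t := by
  rw [extendCurve, projIcc_of_mem hT ht]

lemma extendCurve_eq (hT : 0 ≤ T) (f : ℝ → ProbabilityMeasure ℝ) (t : ℝ) :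
    extendCurve hT f t = extendCurve hT f (projIcc 0 T hT t) := by
  rw [extendCurve_of_mem hT f (projIcc 0 T hT t).2, extendCurve]

lemma continuous_extendCurve (hT : 0 ≤ T) {f : ℝ → ProbabilityMeasure ℝ}
    (hf : ContinuousOn f (Icc 0 T)) : Continuous (extendCurve hT f) :=
  hf.comp_continuous (continuous_subtype_val.comp continuous_projIcc)
    fun t => (projIcc 0 T hT t).2

lemma isGCE_extendCurve (hT : 0 ≤ T) {f : ℝ → ProbabilityMeasure ℝ}
    {U : ℝ → SignedMeasure OffDiag} (h : IsGCE e T f U) : IsGCE e T (extendCurve hT f) U where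
  measurable_curve k := by
    refine (h.measurable_curve k).congr ?_
    filter_upwards [ae_restrict_mem measurableSet_Icc] with t ht
    rw [extendCurve_of_mem hT f ht]
  measurable_flux := h.measurable_flux
  integrable_flux := h.integrable_flux
  weak_form φ h1 h2 h3 := by
    refine Eq.trans ?_ (h.weak_form φ h1 h2 h3)
    congr 1
    apply intervalIntegral.integral_congr
    intro t ht
    rw [uIcc_of_le hT] at ht
    beta_reduce
    rw [extendCurve_of_mem hT f ht]

lemma exists_flux_near (hT : 0 ≤ T) {f : ℝ → ProbabilityMeasure ℝ}
    (h : curveAction e T f < ⊤) {δ : ℝ≥0∞} (hδ : 0 < δ) :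
    ∃ U : ℝ → SignedMeasure OffDiag, Continuous (extendCurve hT f) ∧
      IsGCE e T (extendCurve hT f) U ∧
      ∫⁻ t in Icc 0 T, action e (extendCurve hT f t) (U t) ≤ curveAction e T f + δ := by
  have h1 : curveAction e T f < curveAction e T f + δ := ENNReal.lt_add_right h.ne hδ.ne'
  conv_lhs at h1 => rw [curveAction]
  rw [iInf_lt_iff] at h1
  obtain ⟨U, hU⟩ := h1
  rw [iInf_lt_iff] at hU
  obtain ⟨hU1, hU2⟩ := hU
  have hact : ∫⁻ t in Icc 0 T, action e (extendCurve hT f t) (U t)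
      = ∫⁻ t in Icc 0 T, action e (f t) (U t) := by
    apply setLIntegral_congr_fun measurableSet_Icc
    intro t ht
    beta_reduce
    rw [extendCurve_of_mem hT f ht]
  refine ⟨U, continuous_extendCurve hT hU1.continuousOn, isGCE_extendCurve hT hU1.isGCE, ?_⟩
  rw [hact]
  exact hU2.le

end Extension

/-- The positive part `ℰ(f_T) + ½ ∫ 𝒜 + ½ ∫ 𝒟` of the De Giorgi functional. -/
noncomputable def energyBudget (e T : ℝ) (f : ℝ → ProbabilityMeasure ℝ) : ℝ≥0∞ :=
  kineticEnergy (f T) + (1 / 2) * curveAction e T f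
    + (1 / 2) * ∫⁻ t in Icc 0 T, dissipation e (f t)

lemma deGiorgi_le_iff {e T : ℝ} {f : ℝ → ProbabilityMeasure ℝ} (h : kineticEnergy (f 0) ≠ ⊤)
    {c : EReal} :
    deGiorgi e T f ≤ c ↔ (energyBudget e T f : EReal) ≤ c + (kineticEnergy (f 0) : EReal) := by
  have h1 : deGiorgi e T f = (energyBudget e T f : EReal) - (kineticEnergy (f 0) : EReal) := by
    rw [deGiorgi, energyBudget, EReal.coe_ennreal_add, EReal.coe_ennreal_add, sub_eq_add_neg,
      sub_eq_add_neg, add_right_comm _ (-_), add_right_comm _ (-_)]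
  rw [h1]
  exact EReal.sub_le_iff_le_add (Or.inl (EReal.coe_ennreal_ne_bot _))
    (Or.inl (by rwa [Ne, EReal.coe_ennreal_eq_top_iff]))

/-- Subsequences that realise the lower limit. -/
lemma exists_subseq_liminf {u : ℕ → EReal} {b : EReal} (hb : liminf u atTop < b)
    {P : ℕ → Prop} (hP : ∀ᶠ n in atTop, P n) :
    ∃ (k : ℕ → ℕ) (c : ℕ → EReal), StrictMono k ∧ Tendsto c atTop (𝓝 (liminf u atTop)) ∧
      (∀ j, u (k j) ≤ c j) ∧ ∀ j, P (k j) := by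
  obtain ⟨c, -, hc, hlim⟩ := exists_seq_strictAnti_tendsto' hb
  obtain ⟨k, hk, hkP⟩ := extraction_forall_of_frequently
    (P := fun j n => u n < c j ∧ P n) fun j =>
      (frequently_lt_of_liminf_lt (by isBoundedDefault) (hc j).1).and_eventually hP
  exact ⟨k, c, hk, hlim, fun j => (hkP j).1.le, fun j => (hkP j).2⟩

/-- Compactness of curves with bounded second moments and bounded action. -/
lemma exists_subseq_curve {e T : ℝ} (he0 : 0 ≤ e) (he1 : e < 1) (hT : 0 ≤ T)
    {f : ℕ → ℝ → ProbabilityMeasure ℝ} (hF : ∀ n, Continuous (extendCurve hT (f n)))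
    {U : ℕ → ℝ → SignedMeasure OffDiag} (hU : ∀ n, IsGCE e T (extendCurve hT (f n)) (U n))
    {M : NNReal} (hM : ∀ n t, secondMoment (extendCurve hT (f n) t) ≤ M) {a : NNReal}
    (ha : ∀ n, ∫⁻ t in Icc 0 T, action e (extendCurve hT (f n) t) (U n t) ≤ a) :
    ∃ (k : ℕ → ℕ) (g : ℝ → ProbabilityMeasure ℝ), StrictMono k ∧ Continuous g ∧
      ∀ t, Tendsto (fun j => extendCurve hT (f (k j)) t) atTop (𝓝 (g t)) := by
  apply exists_subseq_limit (M := M) (fun n => extendCurve hT (f n))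
  · exact fun n t => mem_tailSet (hM n t)
  · intro ψ hψ hψc
    obtain ⟨C, hC0, hC⟩ := increment_sqrt (T := T) he0 he1 (M := M) (a := a) hψ hψc
    refine ⟨C, fun n s t => ?_⟩
    rw [extendCurve_eq hT (f n) s, extendCurve_eq hT (f n) t]
    refine (hC _ _ (hF n) (hU n) (fun r _ => hM n r) (ha n) _ (projIcc 0 T hT s).2 _
      (projIcc 0 T hT t).2).trans ?_
    exact mul_le_mul_of_nonneg_left (Real.sqrt_le_sqrt (abs_projIcc_sub_projIcc hT)) hC0

lemma curveAction_le_of_flux {e T : ℝ} {g : ℝ → ProbabilityMeasure ℝ}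
    {U : ℝ → SignedMeasure OffDiag} (h : IsGCEBetween e T (g 0) (g T) g U) {a : ℝ≥0∞}
    (ha : ∫⁻ t in Icc 0 T, action e (g t) (U t) ≤ a) : curveAction e T g ≤ a :=
  (iInf₂_le U h).trans ha

/-- Limits of curves with converging actions are absolutely continuous, and the action is lower
semicontinuous. -/
lemma mem_ACCurves_of_tendsto {e T : ℝ} (he0 : 0 ≤ e) (he1 : e < 1) (hT : 0 ≤ T)
    {F : ℕ → ℝ → ProbabilityMeasure ℝ} (hF : ∀ n, Continuous (F n))
    {U : ℕ → ℝ → SignedMeasure OffDiag} (hU : ∀ n, IsGCE e T (F n) (U n))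
    {M : NNReal} (hM : ∀ n t, secondMoment (F n t) ≤ M) (hcm : ∀ n, ∀ t ∈ Icc 0 T, F n t ∈ P2cm)
    {g : ℝ → ProbabilityMeasure ℝ} (hg : Continuous g)
    (h : ∀ t, Tendsto (fun n => F n t) atTop (𝓝 (g t)))
    {a : NNReal}
    (ha : Tendsto (fun n => ∫⁻ t in Icc 0 T, action e (F n t) (U n t)) atTop (𝓝 a)) :
    g ∈ ACCurves e T ∧ curveAction e T g ≤ a := by
  have hgM : ∀ t ∈ Icc 0 T, secondMoment (g t) ≤ M := fun t _ =>
    secondMoment_le_of_tendsto (h t) fun n => hM n t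
  obtain ⟨W, hW, hint, hfin, hweak⟩ := exists_flux he0 he1 hT hg hgM (a := a)
    fun φ hφ ε hε => weak_bound_of_tendsto he0 he1 hT hF hU hM h ha hφ hε
  have hfin' := hfin.trans_lt ENNReal.coe_lt_top
  obtain ⟨h1, h2⟩ := isGCE_of_density he0 he1 hT hg hgM hW hint hfin' hweak
  refine ⟨mem_ACCurves he0 he1 hT hg hgM (fun t ht => ?_) hW hint hfin' hweak, ?_⟩
  · exact mem_P2cm_of_tendsto (h t) (fun n => hM n t) fun n => hcm n t ht
  · exact curveAction_le_of_flux ⟨h1, hg.continuousOn, rfl, rfl⟩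
      ((lintegral_mono_ae h2).trans hfin)

lemma kineticEnergy_le_of_tendsto {μs : ℕ → ProbabilityMeasure ℝ} {μ : ProbabilityMeasure ℝ}
    (h : Tendsto μs atTop (𝓝 μ)) {x : ℝ≥0∞}
    (hx : Tendsto (fun n => kineticEnergy (μs n)) atTop (𝓝 x)) : kineticEnergy μ ≤ x := by
  rw [← hx.liminf_eq]
  simp_rw [kineticEnergy_eq]
  rw [ENNReal.liminf_const_mul_of_ne_top (by simp)]
  gcongr
  exact secondMoment_le_liminf h

lemma two_mul_half_mul (x : ℝ≥0∞) : 2 * (1 / 2 * x) = x := by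
  rw [← mul_assoc, one_div, ENNReal.mul_inv_cancel (by simp) (by simp), one_mul]

lemma le_two_mul_of_half_mul_le {x y : ℝ≥0∞} (h : 1 / 2 * x ≤ y) : x ≤ 2 * y := by
  rw [← two_mul_half_mul x]
  gcongr

lemma integral_dissipation_le_of_tendsto {e T : ℝ} (he1 : e < 1)
    {F : ℕ → ℝ → ProbabilityMeasure ℝ} (hF : ∀ n, Continuous (F n))
    {g : ℝ → ProbabilityMeasure ℝ} (h : ∀ t, Tendsto (fun n => F n t) atTop (𝓝 (g t)))
    {z : ℝ≥0∞}
    (hz : Tendsto (fun n => ∫⁻ t in Icc 0 T, dissipation e (F n t)) atTop (𝓝 z)) :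
    ∫⁻ t in Icc 0 T, dissipation e (g t) ≤ z := by
  rw [← hz.liminf_eq]
  exact (lintegral_mono fun t => dissipation_le_liminf he1 (h t)).trans
    (lintegral_liminf_le fun n => measurable_dissipation (hF n))

/-- Along a sequence with bounded energy budgets, a subsequence of the curves converges to an
absolutely continuous curve that satisfies the limit bound on the energy budget. -/
lemma exists_limit_curve {e T : ℝ} (he0 : 0 ≤ e) (he1 : e < 1) (hT : 0 ≤ T)
    {f : ℕ → ℝ → ProbabilityMeasure ℝ} (hf : ∀ n, ∀ t ∈ Icc 0 T, f n t ∈ P2cm)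
    {B E : ℝ≥0∞} (hB : B ≠ ⊤) (hE : E ≠ ⊤) (hbudget : ∀ n, energyBudget e T (f n) ≤ B)
    (hkin : ∀ n, kineticEnergy (f n 0) ≤ E) :
    ∃ g ∈ ACCurves e T, ∃ k : ℕ → ℕ, StrictMono k ∧
      (∀ t ∈ Icc 0 T, Tendsto (fun j => f (k j) t) atTop (𝓝 (g t))) ∧
      ∃ b : ℝ≥0∞, energyBudget e T g ≤ b ∧
        ∃ δ s : ℕ → ℝ≥0∞, Tendsto δ atTop (𝓝 0) ∧ Tendsto s atTop (𝓝 b) ∧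
          ∀ j, s j ≤ energyBudget e T (f (k j)) + δ j := by
  have hCA : ∀ n, curveAction e T (f n) ≤ 2 * B := fun n =>
    le_two_mul_of_half_mul_le ((le_add_self.trans le_self_add).trans (hbudget n))
  have hD : ∀ n, ∫⁻ t in Icc 0 T, dissipation e (f n t) ≤ 2 * B := fun n =>
    le_two_mul_of_half_mul_le (le_add_self.trans (hbudget n))
  have h2B : 2 * B ≠ ⊤ := ENNReal.mul_ne_top (by simp) hB
  have hflux : ∀ n : ℕ, ∃ U : ℝ → SignedMeasure OffDiag, Continuous (extendCurve hT (f n)) ∧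
      IsGCE e T (extendCurve hT (f n)) U ∧
      ∫⁻ t in Icc 0 T, action e (extendCurve hT (f n) t) (U t)
        ≤ curveAction e T (f n) + (((n + 1 : ℕ) : ℝ≥0∞))⁻¹ := by
    intro n
    exact exists_flux_near hT ((hCA n).trans_lt h2B.lt_top) (by simp)
  choose U hFc hU hUA using hflux
  set F : ℕ → ℝ → ProbabilityMeasure ℝ := fun n => extendCurve hT (f n) with hFdef
  have hFeq : ∀ n, ∀ t ∈ Icc 0 T, F n t = f n t := fun n t ht => extendCurve_of_mem hT (f n) ht
  have h0T : (0 : ℝ) ∈ Icc 0 T := ⟨le_rfl, hT⟩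
  have hTT : T ∈ Icc 0 T := ⟨hT, le_rfl⟩
  have hDF : ∀ n, ∫⁻ t in Icc 0 T, dissipation e (F n t)
      = ∫⁻ t in Icc 0 T, dissipation e (f n t) := by
    intro n
    apply setLIntegral_congr_fun measurableSet_Icc
    intro t ht
    beta_reduce
    rw [hFeq n t ht]
  have hA : ∀ n, ∫⁻ t in Icc 0 T, action e (F n t) (U n t) ≤ 2 * B + 1 := by
    intro n
    refine (hUA n).trans (add_le_add (hCA n) ?_)
    rw [ENNReal.inv_le_one]
    exact_mod_cast Nat.succ_le_succ (Nat.zero_le n)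
  have hA' : 2 * B + 1 ≠ ⊤ := ENNReal.add_ne_top.2 ⟨h2B, by simp⟩
  obtain ⟨K, hK⟩ := secondMoment_bound
  set M₀ : ℝ≥0∞ := 2 * E + ((2 * B + 1) + K * (2 * B)) with hM₀
  have hM₀' : M₀ ≠ ⊤ := ENNReal.add_ne_top.2 ⟨ENNReal.mul_ne_top (by simp) hE,
    ENNReal.add_ne_top.2 ⟨hA', ENNReal.mul_ne_top (by simp) h2B⟩⟩
  have hM : ∀ n t, secondMoment (F n t) ≤ M₀.toNNReal := by
    intro n t
    rw [ENNReal.coe_toNNReal hM₀', hFdef]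
    beta_reduce
    rw [extendCurve_eq]
    refine (hK e T he1 _ _ (hFc n) (hU n) _ (projIcc 0 T hT t).2).trans ?_
    refine add_le_add ?_ (add_le_add (hA n) (mul_le_mul_right ((hDF n).le.trans (hD n)) _))
    rw [extendCurve_of_mem hT (f n) h0T]
    exact le_two_mul_of_half_mul_le (hkin n)
  obtain ⟨k₁, g, hk₁, hg, hlim⟩ := exists_subseq_curve he0 he1 hT hFc hU hM
    (a := (2 * B + 1).toNNReal) (fun n => by rw [ENNReal.coe_toNNReal hA']; exact hA n)
  obtain ⟨⟨x, y, z⟩, k₂, hk₂, hxyz⟩ := CompactSpace.tendsto_subseq fun j =>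
    (kineticEnergy (F (k₁ j) T), ∫⁻ t in Icc 0 T, action e (F (k₁ j) t) (U (k₁ j) t),
      ∫⁻ t in Icc 0 T, dissipation e (F (k₁ j) t))
  have hx : Tendsto (fun j => kineticEnergy (F (k₁ (k₂ j)) T)) atTop (𝓝 x) :=
    (continuous_fst.tendsto _).comp hxyz
  have hy : Tendsto (fun j => ∫⁻ t in Icc 0 T,
      action e (F (k₁ (k₂ j)) t) (U (k₁ (k₂ j)) t)) atTop (𝓝 y) :=
    ((continuous_fst.comp continuous_snd).tendsto _).comp hxyz
  have hz : Tendsto (fun j => ∫⁻ t in Icc 0 T, dissipation e (F (k₁ (k₂ j)) t)) atTop (𝓝 z) :=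
    ((continuous_snd.comp continuous_snd).tendsto _).comp hxyz
  have hlim2 : ∀ t, Tendsto (fun j => F (k₁ (k₂ j)) t) atTop (𝓝 (g t)) := fun t =>
    (hlim t).comp hk₂.tendsto_atTop
  have hy' : y ≠ ⊤ := ((le_of_tendsto' hy fun j => hA _).trans_lt hA'.lt_top).ne
  obtain ⟨hgAC, hgA⟩ := mem_ACCurves_of_tendsto (a := y.toNNReal) he0 he1 hT
    (fun j => hFc (k₁ (k₂ j))) (fun j => hU (k₁ (k₂ j))) (fun j => hM (k₁ (k₂ j)))
    (fun j t ht => by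
      change F _ t ∈ P2cm
      rw [hFeq _ t ht]; exact hf _ t ht) hg hlim2
    (by rw [ENNReal.coe_toNNReal hy']; exact hy)
  rw [ENNReal.coe_toNNReal hy'] at hgA
  refine ⟨g, hgAC, fun j => k₁ (k₂ j), hk₁.comp hk₂, fun t ht => ?_,
    x + (1 / 2) * y + (1 / 2) * z, ?_, fun j => (((k₁ (k₂ j) + 1 : ℕ) : ℝ≥0∞))⁻¹,
    fun j => kineticEnergy (F (k₁ (k₂ j)) T)
      + (1 / 2) * (∫⁻ t in Icc 0 T, action e (F (k₁ (k₂ j)) t) (U (k₁ (k₂ j)) t))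
      + (1 / 2) * ∫⁻ t in Icc 0 T, dissipation e (F (k₁ (k₂ j)) t), ?_, ?_, fun j => ?_⟩
  · exact (hlim2 t).congr fun j => hFeq _ t ht
  · refine add_le_add (add_le_add (kineticEnergy_le_of_tendsto (hlim2 T) hx)
      (mul_le_mul_right hgA _)) (mul_le_mul_right ?_ _)
    exact integral_dissipation_le_of_tendsto he1 (fun j => hFc (k₁ (k₂ j))) hlim2 hz
  · exact ENNReal.tendsto_inv_nat_nhds_zero.comp
      ((tendsto_add_atTop_nat 1).comp (hk₁.comp hk₂).tendsto_atTop)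
  · exact (hx.add (ENNReal.Tendsto.const_mul hy (Or.inr (by simp)))).add
      (ENNReal.Tendsto.const_mul hz (Or.inr (by simp)))
  · beta_reduce
    set n := k₁ (k₂ j)
    set δ : ℝ≥0∞ := (((n + 1 : ℕ) : ℝ≥0∞))⁻¹
    rw [hDF n, hFeq n T hTT, energyBudget]
    calc _ ≤ kineticEnergy (f n T) + 1 / 2 * (curveAction e T (f n) + δ)
          + 1 / 2 * ∫⁻ t in Icc 0 T, dissipation e (f n t) := by
          gcongr
          exact hUA n
      _ ≤ kineticEnergy (f n T) + (1 / 2 * curveAction e T (f n) + δ)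
          + 1 / 2 * ∫⁻ t in Icc 0 T, dissipation e (f n t) := by
          gcongr
          rw [mul_add]
          gcongr
          refine mul_le_of_le_one_left zero_le ?_
          rw [one_div]
          exact ENNReal.inv_le_one.2 one_le_two
      _ = _ := by ring

end Granular

theorem mainTheorem8 (e T : ℝ) (he0 : 0 ≤ e) (he1 : e < 1) (hT : 0 < T)
    (f : ℕ → ℝ → ProbabilityMeasure ℝ)
    (hf : ∀ n, f n ∈ Granular.ACCurves e T)
    (hG : (⨆ n, Granular.deGiorgi e T (f n)) < ⊤)
    (μ₀ : ProbabilityMeasure ℝ)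
    (hμ₀ : Granular.kineticEnergy μ₀ < ⊤)
    (hf0 : Tendsto (fun n => f n 0) atTop (𝓝 μ₀))
    (hE0 : Tendsto (fun n => Granular.kineticEnergy (f n 0)) atTop
      (𝓝 (Granular.kineticEnergy μ₀))) :
    ∃ g ∈ Granular.ACCurves e T, g 0 = μ₀ ∧
      (∃ k : ℕ → ℕ, StrictMono k ∧
        ∀ᵐ t ∂(volume.restrict (Icc 0 T)),
          Tendsto (fun j => f (k j) t) atTop (𝓝 (g t))) ∧
      Granular.deGiorgi e T g ≤ liminf (fun n => Granular.deGiorgi e T (f n)) atTop := by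
  have h0T : (0 : ℝ) ∈ Icc 0 T := ⟨le_rfl, hT.le⟩
  have hfin : ∀ n, Granular.kineticEnergy (f n 0) ≠ ⊤ := fun n =>
    ENNReal.mul_ne_top (by simp) (Granular.secondMoment_lt_top_of_mem ((hf n).1 0 h0T)).ne
  obtain ⟨S, hS, -⟩ := EReal.lt_iff_exists_real_btwn.1 hG
  have hS' : ∀ n, Granular.deGiorgi e T (f n) ≤ (S : EReal) := fun n =>
    (le_iSup (fun n => Granular.deGiorgi e T (f n)) n).trans hS.le
  have hlim : liminf (fun n => Granular.deGiorgi e T (f n)) atTop < ⊤ :=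
    (liminf_le_liminf (Eventually.of_forall hS')).trans_lt (by simp)
  have hev : ∀ᶠ n in atTop, Granular.kineticEnergy (f n 0) ≤ Granular.kineticEnergy μ₀ + 1 := by
    filter_upwards [(tendsto_order.1 hE0).2 _ (ENNReal.lt_add_right hμ₀.ne one_ne_zero)] with n hn
    exact hn.le
  obtain ⟨k, c, hk, hc, hkc, hkE⟩ := Granular.exists_subseq_liminf hlim hev
  have hE : Granular.kineticEnergy μ₀ + 1 ≠ ⊤ := ENNReal.add_ne_top.2 ⟨hμ₀.ne, by simp⟩
  have hbudget : ∀ j, Granular.energyBudget e T (f (k j))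
      ≤ ENNReal.ofReal S + (Granular.kineticEnergy μ₀ + 1) := by
    intro j
    rw [← EReal.coe_ennreal_le_coe_ennreal_iff, EReal.coe_ennreal_add]
    refine ((Granular.deGiorgi_le_iff (hfin (k j))).1 (hS' (k j))).trans (add_le_add ?_ ?_)
    · rw [EReal.coe_ennreal_ofReal]
      exact_mod_cast le_max_left S 0
    · rw [EReal.coe_ennreal_le_coe_ennreal_iff]
      exact hkE j
  obtain ⟨g, hg, l, hl, hgl, b, hgb, δ, s, hδ, hs, hsδ⟩ := Granular.exists_limit_curve he0 he1
    hT.le (fun j => (hf (k j)).1) (ENNReal.add_ne_top.2 ⟨ENNReal.ofReal_ne_top, hE⟩) hE hbudget hkE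
  have hkl := (hk.comp hl).tendsto_atTop
  have hg0 : g 0 = μ₀ := tendsto_nhds_unique (hgl 0 h0T) (hf0.comp hkl)
  refine ⟨g, hg, hg0, ⟨fun j => k (l j), hk.comp hl, ?_⟩, ?_⟩
  · filter_upwards [ae_restrict_mem measurableSet_Icc] with t ht using hgl t ht
  · rw [Granular.deGiorgi_le_iff (by rw [hg0]; exact hμ₀.ne), hg0]
    refine (EReal.coe_ennreal_le_coe_ennreal_iff.2 hgb).trans ?_
    have hs' := (continuous_coe_ennreal_ereal.tendsto b).comp hs
    have hδ' := (continuous_coe_ennreal_ereal.tendsto 0).comp hδ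
    have hE' := (continuous_coe_ennreal_ereal.tendsto _).comp (hE0.comp hkl)
    have hb1 : ((Granular.kineticEnergy μ₀ : ℝ≥0∞) : EReal) ≠ ⊥ := EReal.coe_ennreal_ne_bot _
    have hb2 : ((Granular.kineticEnergy μ₀ : ℝ≥0∞) : EReal) ≠ ⊤ := by
      rw [Ne, EReal.coe_ennreal_eq_top_iff]; exact hμ₀.ne
    have hsum := (EReal.continuousAt_add (p :=
      (liminf (fun n => Granular.deGiorgi e T (f n)) atTop,
        ((Granular.kineticEnergy μ₀ : ℝ≥0∞) : EReal))) (Or.inr hb1) (Or.inr hb2)).tendsto.comp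
      ((hc.comp hl.tendsto_atTop).prodMk_nhds hE')
    have hsum2 := (EReal.continuousAt_add (p :=
      (liminf (fun n => Granular.deGiorgi e T (f n)) atTop
        + ((Granular.kineticEnergy μ₀ : ℝ≥0∞) : EReal), ((0 : ℝ≥0∞) : EReal)))
      (Or.inr (by simp)) (Or.inr (by simp))).tendsto.comp (hsum.prodMk_nhds hδ')
    refine (le_of_tendsto_of_tendsto' hs' hsum2 fun j => ?_).trans (by simp)
    have h1 := EReal.coe_ennreal_le_coe_ennreal_iff.2 (hsδ j)
    rw [EReal.coe_ennreal_add] at h1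
    exact h1.trans (add_le_add ((Granular.deGiorgi_le_iff (hfin _)).1 (hkc (l j))) le_rfl)
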